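/- Let $M$ be a compact connected smooth manifold (without boundary) of dimension $2n+1$ with a cooriented contact structure $\xi=\ker\alpha$. Let $G=\widetilde{\mathrm{Cont}_0}(M,\xi)$ be the universal cover of the identity component of the contactomorphism group: the group of smooth contact isotopies $\{\phi_t\}_{t\in[0,1]}$ with $\phi_0=\mathrm{id}$, modulo homotopy with fixed endpoints, with product $[\{\phi_t\}]\cdot[\{\psi_t\}]=[\{\phi_t\circ\psi_t\}]$. Write $\phi_t^*\alpha=e^{g_t}\alpha$. A contact isotopy is called *positive* (*negative*, *non-negative*) if $\alpha\big(\tfrac{d}{dt}\phi_t(x)\big)>0$ ($<0$, $\ge 0$) for all $t\in[0,1]$ and $x\in M$, and *embedded* if $(t,q)\mapsto(q,\phi_t(q),g_t(q))$ is an embedding of $[0,1]\times M$ into $M\times M\times\mathbb{R}$. Let $\widetilde{\mathcal E}_+$ (respectively $\widetilde{\mathcal E}_-$) be the set of classes in $G$ that are represented by a positive (respectively negative) embedded contact isotopy. For $c\in G$ consider all decompositions of $c$ as a finite product, in any order, of positive pieces (elements of $\widetilde{\mathcal E}_+$) and negative pieces (elements of $\widetilde{\mathcal E}_-$). Let $\nu^+(c)$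 be the minimal number of positive pieces in such a decomposition, let $\nu^-(c)$ be minus the minimal number of negative pieces in such a decomposition (the two minima being taken separately), and let $\nu_{\mathrm{osc}}(c)=\nu^+(c)-\nu^-(c)$. Then every $c\in G$ has such a decomposition, so that $\nu_{\mathrm{osc}}$ is well defined, and $\nu_{\mathrm{osc}}$ is a conjugation-invariant pseudo-norm on $G$: for all $f,g\in G$, $$\nu_{\mathrm{osc}}(g)\ge 0,\quad \nu_{\mathrm{osc}}(1)=0,\quad \nu_{\mathrm{osc}}(g^{-1})=\nu_{\mathrm{osc}}(g),\quad \nu_{\mathrm{osc}}(fg)\le\nu_{\mathrm{osc}}(f)+\nu_{\mathrm{osc}}(g),\quad \nu_{\mathrm{osc}}(gfg^{-1})=\nu_{\mathrm{osc}}(f).$$ Moreover $\nu_{\mathrm{osc}}$ is non-degenerate (that is, $\nu_{\mathrm{osc}}(c)=0$ if and only if $c=1$) if and only if $(M,\xi)$ is orderable in the sense of Eliashberg and Polterovich, i.e. if and only if the reflexive and transitive relation on $G$ given by $a\le b$ when $ba^{-1}$ is represented by a non-negative contact isotopy is antisymmetric. -/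

import Mathlib

open Set
open scoped Manifold ContDiff

noncomputable section

namespace ContactGeometry

/-- The Euclidean space on which manifolds of dimension `2 * n + 1` are modelled. -/
abbrev Model (n : ℕ) : Type := EuclideanSpace ℝ (Fin (2 * n + 1))

section Forms

variable {n : ℕ} {M : Type*} [TopologicalSpace M] [ChartedSpace (Model n) M]

/-- The exterior derivative at `x` of a 1-form `α` on `M`, as a bilinear function on `T_x M`.
It is computed in the preferred chart at `x`, which is also the chart through which Mathlib
identifies `T_x M` with the model space: the local expression of `α` is
`y ↦ α (χ⁻¹ y) ∘ D(χ⁻¹)(y)`, and `dα (u, v) = (D_u α) v - (D_v α) u`. -/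
def extDerivOneForm (α : ∀ x : M, TangentSpace (𝓡 (2 * n + 1)) x →L[ℝ] ℝ) (x : M)
    (u v : TangentSpace (𝓡 (2 * n + 1)) x) : ℝ :=
  let χ := extChartAt (𝓡 (2 * n + 1)) x
  let a : Model n → (Model n →L[ℝ] ℝ) := fun y =>
    (α (χ.symm y)).comp (mfderiv (𝓡 (2 * n + 1)) (𝓡 (2 * n + 1)) χ.symm y)
  (fderiv ℝ a (χ x) u) v - (fderiv ℝ a (χ x) v) u

/-- `α` is a contact form: a smooth, nowhere vanishing 1-form whose exterior derivative is
nondegenerate on the hyperplane field `ξ = ker α`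
(in dimension `2 * n + 1` this says that `α ∧ (dα)^n` vanishes nowhere). -/
structure IsContactForm [IsManifold (𝓡 (2 * n + 1)) ∞ M]
    (α : ∀ x : M, TangentSpace (𝓡 (2 * n + 1)) x →L[ℝ] ℝ) : Prop where
  smooth : ContMDiff (𝓡 (2 * n + 1)).tangent 𝓘(ℝ, ℝ) ∞
    (fun v : TangentBundle (𝓡 (2 * n + 1)) M => α v.proj v.2)
  ne_zero : ∀ x, α x ≠ 0
  nondegenerate : ∀ (x : M) (u : TangentSpace (𝓡 (2 * n + 1)) x), α x u = 0 →
    (∀ v : TangentSpace (𝓡 (2 * n + 1)) x, α x v = 0 → extDerivOneForm α x u v = 0) → u = 0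

end Forms

/-- A smooth family of contactomorphisms of `(M, ker α)`, parametrized by the points `p` of a
subset `S` of a normed space: for `p ∈ S`, `toFun p` is a diffeomorphism with inverse `invFun p`
and `(toFun p)^* α = e^(factor p) α`, where everything is smooth in `(p, x) ∈ S × M`.
Values at parameters outside `S` are irrelevant. -/
structure ContactFamily {n : ℕ} {M : Type*} [TopologicalSpace M] [ChartedSpace (Model n) M]
    (α : ∀ x : M, TangentSpace (𝓡 (2 * n + 1)) x →L[ℝ] ℝ)
    {P : Type} [NormedAddCommGroup P] [NormedSpace ℝ P] (S : Set P) where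
  toFun : P → M → M
  invFun : P → M → M
  factor : P → M → ℝ
  smooth_toFun : ContMDiffOn (𝓘(ℝ, P).prod (𝓡 (2 * n + 1))) (𝓡 (2 * n + 1)) ∞
    (fun z : P × M => toFun z.1 z.2) (S ×ˢ univ)
  smooth_invFun : ContMDiffOn (𝓘(ℝ, P).prod (𝓡 (2 * n + 1))) (𝓡 (2 * n + 1)) ∞
    (fun z : P × M => invFun z.1 z.2) (S ×ˢ univ)
  smooth_factor : ContMDiffOn (𝓘(ℝ, P).prod (𝓡 (2 * n + 1))) 𝓘(ℝ, ℝ) ∞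
    (fun z : P × M => factor z.1 z.2) (S ×ˢ univ)
  left_inv : ∀ p ∈ S, ∀ x, invFun p (toFun p x) = x
  right_inv : ∀ p ∈ S, ∀ x, toFun p (invFun p x) = x
  pullback_eq : ∀ p ∈ S, ∀ (x : M) (v : TangentSpace (𝓡 (2 * n + 1)) x),
    α (toFun p x) (mfderiv (𝓡 (2 * n + 1)) (𝓡 (2 * n + 1)) (toFun p) x v)
      = Real.exp (factor p x) * α x v

section Families

variable {n : ℕ} {M : Type*} [TopologicalSpace M] [ChartedSpace (Model n) M]
  {α : ∀ x : M, TangentSpace (𝓡 (2 * n + 1)) x →L[ℝ] ℝ}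
  {P : Type} [NormedAddCommGroup P] [NormedSpace ℝ P] {S : Set P}

theorem mdifferentiable_slice {f : P → M → M}
    (hf : ContMDiffOn (𝓘(ℝ, P).prod (𝓡 (2 * n + 1))) (𝓡 (2 * n + 1)) ∞
      (fun z : P × M => f z.1 z.2) (S ×ˢ univ)) {p : P} (hp : p ∈ S) :
    MDifferentiable (𝓡 (2 * n + 1)) (𝓡 (2 * n + 1)) (f p) := by
  have h : ContMDiffOn (𝓡 (2 * n + 1)) (𝓘(ℝ, P).prod (𝓡 (2 * n + 1))) ∞
      (fun x : M => (p, x)) univ := (contMDiff_const.prodMk contMDiff_id).contMDiffOn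
  have h2 : ContMDiffOn (𝓡 (2 * n + 1)) (𝓡 (2 * n + 1)) ∞ (f p) univ :=
    hf.comp h (fun x _ => ⟨hp, mem_univ _⟩)
  exact (contMDiffOn_univ.1 h2).mdifferentiable (by simp)

theorem form_mfderiv_of_eq_self {f : M → M} (hf : ∀ x, f x = x) (x : M)
    (v : TangentSpace (𝓡 (2 * n + 1)) x) :
    α (f x) (mfderiv (𝓡 (2 * n + 1)) (𝓡 (2 * n + 1)) f x v) = α x v := by
  obtain rfl : f = id := funext hf
  rw [mfderiv_id]
  rfl

theorem smooth_comp_aux {N : Type*} {H' : Type*} [TopologicalSpace H'] {E' : Type*}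
    [NormedAddCommGroup E'] [NormedSpace ℝ E'] {J : ModelWithCorners ℝ E' H'}
    [TopologicalSpace N] [ChartedSpace H' N] {f : P → M → N} {g : P → M → M}
    (hf : ContMDiffOn (𝓘(ℝ, P).prod (𝓡 (2 * n + 1))) J ∞
      (fun z : P × M => f z.1 z.2) (S ×ˢ univ))
    (hg : ContMDiffOn (𝓘(ℝ, P).prod (𝓡 (2 * n + 1))) (𝓡 (2 * n + 1)) ∞
      (fun z : P × M => g z.1 z.2) (S ×ˢ univ)) :
    ContMDiffOn (𝓘(ℝ, P).prod (𝓡 (2 * n + 1))) J ∞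
      (fun z : P × M => f z.1 (g z.1 z.2)) (S ×ˢ univ) :=
  hf.comp (contMDiff_fst.contMDiffOn.prodMk hg) (fun _ hz => ⟨hz.1, mem_univ _⟩)

/-- The constant family at the identity. -/
def ContactFamily.one (α : ∀ x : M, TangentSpace (𝓡 (2 * n + 1)) x →L[ℝ] ℝ) (S : Set P) :
    ContactFamily α S where
  toFun _ x := x
  invFun _ x := x
  factor _ _ := 0
  smooth_toFun := contMDiff_snd.contMDiffOn
  smooth_invFun := contMDiff_snd.contMDiffOn
  smooth_factor := contMDiff_const.contMDiffOn
  left_inv _ _ _ := rfl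
  right_inv _ _ _ := rfl
  pullback_eq _ _ x v := by
    rw [Real.exp_zero, one_mul]
    exact form_mfderiv_of_eq_self (f := fun x => x) (fun _ => rfl) x v

/-- The parameterwise composition `p ↦ φ_p ∘ ψ_p`. -/
def ContactFamily.mul (φ ψ : ContactFamily α S) : ContactFamily α S where
  toFun p x := φ.toFun p (ψ.toFun p x)
  invFun p x := ψ.invFun p (φ.invFun p x)
  factor p x := φ.factor p (ψ.toFun p x) + ψ.factor p x
  smooth_toFun := smooth_comp_aux φ.smooth_toFun ψ.smooth_toFun
  smooth_invFun := smooth_comp_aux ψ.smooth_invFun φ.smooth_invFun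
  smooth_factor := (smooth_comp_aux φ.smooth_factor ψ.smooth_toFun).add ψ.smooth_factor
  left_inv p hp x := by rw [φ.left_inv p hp, ψ.left_inv p hp]
  right_inv p hp x := by rw [ψ.right_inv p hp, φ.right_inv p hp]
  pullback_eq p hp x v := by
    have h := mfderiv_comp x (mdifferentiable_slice φ.smooth_toFun hp (ψ.toFun p x))
      (mdifferentiable_slice ψ.smooth_toFun hp x)
    have h1 : mfderiv (𝓡 (2 * n + 1)) (𝓡 (2 * n + 1))
        (fun x => φ.toFun p (ψ.toFun p x)) x v
        = mfderiv (𝓡 (2 * n + 1)) (𝓡 (2 * n + 1)) (φ.toFun p) (ψ.toFun p x)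
          (mfderiv (𝓡 (2 * n + 1)) (𝓡 (2 * n + 1)) (ψ.toFun p) x v) :=
      DFunLike.congr_fun h v
    rw [h1, φ.pullback_eq p hp, ψ.pullback_eq p hp, Real.exp_add, mul_assoc]

/-- The parameterwise inverse `p ↦ φ_p⁻¹`. -/
def ContactFamily.inv (φ : ContactFamily α S) : ContactFamily α S where
  toFun := φ.invFun
  invFun := φ.toFun
  factor p x := -φ.factor p (φ.invFun p x)
  smooth_toFun := φ.smooth_invFun
  smooth_invFun := φ.smooth_toFun
  smooth_factor := (smooth_comp_aux φ.smooth_factor φ.smooth_invFun).neg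
  left_inv := φ.right_inv
  right_inv := φ.left_inv
  pullback_eq p hp x v := by
    have h := mfderiv_comp x (mdifferentiable_slice φ.smooth_toFun hp (φ.invFun p x))
      (mdifferentiable_slice φ.smooth_invFun hp x)
    have h1 : mfderiv (𝓡 (2 * n + 1)) (𝓡 (2 * n + 1))
        (fun x => φ.toFun p (φ.invFun p x)) x v
        = mfderiv (𝓡 (2 * n + 1)) (𝓡 (2 * n + 1)) (φ.toFun p) (φ.invFun p x)
          (mfderiv (𝓡 (2 * n + 1)) (𝓡 (2 * n + 1)) (φ.invFun p) x v) :=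
      DFunLike.congr_fun h v
    have h2 := φ.pullback_eq p hp (φ.invFun p x)
      (mfderiv (𝓡 (2 * n + 1)) (𝓡 (2 * n + 1)) (φ.invFun p) x v)
    rw [← h1, form_mfderiv_of_eq_self (α := α) (f := fun x => φ.toFun p (φ.invFun p x))
      (φ.right_inv p hp) x v] at h2
    rw [h2, ← mul_assoc, ← Real.exp_add, neg_add_cancel, Real.exp_zero, one_mul]

end Families

section Isotopies

variable {n : ℕ} {M : Type*} [TopologicalSpace M] [ChartedSpace (Model n) M]

/-- A contact isotopy `{φ_t}`, `t ∈ [0,1]`, starting at the identity. -/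
structure ContactIsotopy (α : ∀ x : M, TangentSpace (𝓡 (2 * n + 1)) x →L[ℝ] ℝ) where
  family : ContactFamily α (Icc (0 : ℝ) 1)
  map_zero : ∀ x, family.toFun 0 x = x

/-- Two contact isotopies are homotopic with fixed endpoints, through contact isotopies
`t ↦ φ_(s,t)`, `s ∈ [0,1]`, depending smoothly on `(s, t, x)`. -/
def Homotopic {α : ∀ x : M, TangentSpace (𝓡 (2 * n + 1)) x →L[ℝ] ℝ}
    (φ ψ : ContactIsotopy α) : Prop :=
  ∃ K : ContactFamily α (Icc (0 : ℝ) 1 ×ˢ Icc (0 : ℝ) 1),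
    (∀ t ∈ Icc (0 : ℝ) 1, ∀ x, K.toFun (0, t) x = φ.family.toFun t x) ∧
    (∀ t ∈ Icc (0 : ℝ) 1, ∀ x, K.toFun (1, t) x = ψ.family.toFun t x) ∧
    (∀ s ∈ Icc (0 : ℝ) 1, ∀ x, K.toFun (s, 0) x = x) ∧
    (∀ s ∈ Icc (0 : ℝ) 1, ∀ x, K.toFun (s, 1) x = φ.family.toFun 1 x)

/-- The universal cover of the identity component of the group of contactomorphisms of
`(M, ker α)`: contact isotopies starting at the identity, modulo (the equivalence relation
generated by) smooth homotopy with fixed endpoints. -/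
def UniversalCover (α : ∀ x : M, TangentSpace (𝓡 (2 * n + 1)) x →L[ℝ] ℝ) : Type _ :=
  Quot (Homotopic (α := α))

variable {α : ∀ x : M, TangentSpace (𝓡 (2 * n + 1)) x →L[ℝ] ℝ}

/-- The constant isotopy at the identity. -/
def ContactIsotopy.one (α : ∀ x : M, TangentSpace (𝓡 (2 * n + 1)) x →L[ℝ] ℝ) :
    ContactIsotopy α where
  family := ContactFamily.one α _
  map_zero _ := rfl

/-- The isotopy `{φ_t ∘ ψ_t}`. -/
def ContactIsotopy.mul (φ ψ : ContactIsotopy α) : ContactIsotopy α where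
  family := φ.family.mul ψ.family
  map_zero x := by
    change φ.family.toFun 0 (ψ.family.toFun 0 x) = x
    rw [ψ.map_zero, φ.map_zero]

/-- The isotopy `{φ_t⁻¹}`. -/
def ContactIsotopy.inv (φ : ContactIsotopy α) : ContactIsotopy α where
  family := φ.family.inv
  map_zero x := by
    have h := φ.family.left_inv 0 ⟨le_rfl, zero_le_one⟩ x
    rwa [φ.map_zero] at h

/-- The class `[{φ_t}]` in the universal cover. -/
def UniversalCover.mk (φ : ContactIsotopy α) : UniversalCover α := Quot.mk _ φ

/-- The constant homotopy, between isotopies that agree on `[0,1]`. -/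
theorem homotopic_of_eqOn {φ ψ : ContactIsotopy α}
    (h : ∀ t ∈ Icc (0 : ℝ) 1, ∀ x, φ.family.toFun t x = ψ.family.toFun t x) :
    Homotopic φ ψ := by
  have hc : ContMDiffOn (𝓘(ℝ, ℝ × ℝ).prod (𝓡 (2 * n + 1))) (𝓘(ℝ, ℝ).prod (𝓡 (2 * n + 1))) ∞
      (fun z : (ℝ × ℝ) × M => (z.1.2, z.2)) ((Icc (0 : ℝ) 1 ×ˢ Icc (0 : ℝ) 1) ×ˢ univ) := by
    have h1 : ContMDiff 𝓘(ℝ, ℝ × ℝ) 𝓘(ℝ, ℝ) ∞ (fun w : ℝ × ℝ => w.2) :=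
      contDiff_snd.contMDiff
    exact ((h1.comp contMDiff_fst).prodMk contMDiff_snd).contMDiffOn
  refine ⟨{ toFun := fun p => φ.family.toFun p.2
            invFun := fun p => φ.family.invFun p.2
            factor := fun p => φ.family.factor p.2
            smooth_toFun := φ.family.smooth_toFun.comp hc (fun z hz => ⟨hz.1.2, mem_univ _⟩)
            smooth_invFun := φ.family.smooth_invFun.comp hc (fun z hz => ⟨hz.1.2, mem_univ _⟩)
            smooth_factor := φ.family.smooth_factor.comp hc (fun z hz => ⟨hz.1.2, mem_univ _⟩)
            left_inv := fun p hp => φ.family.left_inv p.2 hp.2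
            right_inv := fun p hp => φ.family.right_inv p.2 hp.2
            pullback_eq := fun p hp => φ.family.pullback_eq p.2 hp.2 }, ?_, ?_, ?_, ?_⟩
  · exact fun t _ x => rfl
  · exact h
  · exact fun s _ x => φ.map_zero x
  · exact fun s _ x => rfl

theorem homotopic_mul {φ φ' ψ ψ' : ContactIsotopy α} (h : Homotopic φ φ')
    (h' : Homotopic ψ ψ') : Homotopic (φ.mul ψ) (φ'.mul ψ') := by
  obtain ⟨K, h1, h2, h3, h4⟩ := h
  obtain ⟨L, k1, k2, k3, k4⟩ := h'
  refine ⟨K.mul L, ?_, ?_, ?_, ?_⟩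
  · intro t ht x
    change K.toFun (0, t) (L.toFun (0, t) x) = φ.family.toFun t (ψ.family.toFun t x)
    rw [k1 t ht, h1 t ht]
  · intro t ht x
    change K.toFun (1, t) (L.toFun (1, t) x) = φ'.family.toFun t (ψ'.family.toFun t x)
    rw [k2 t ht, h2 t ht]
  · intro s hs x
    change K.toFun (s, 0) (L.toFun (s, 0) x) = x
    rw [k3 s hs, h3 s hs]
  · intro s hs x
    change K.toFun (s, 1) (L.toFun (s, 1) x) = φ.family.toFun 1 (ψ.family.toFun 1 x)
    rw [k4 s hs, h4 s hs]

theorem ContactFamily.invFun_congr {P Q : Type} [NormedAddCommGroup P] [NormedSpace ℝ P]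
    [NormedAddCommGroup Q] [NormedSpace ℝ Q] {S : Set P} {T : Set Q}
    (φ : ContactFamily α S) (ψ : ContactFamily α T) {p : P} {q : Q} (hp : p ∈ S) (hq : q ∈ T)
    (h : ∀ x, φ.toFun p x = ψ.toFun q x) (x : M) : φ.invFun p x = ψ.invFun q x := by
  have h1 := φ.left_inv p hp (ψ.invFun q x)
  rwa [h, ψ.right_inv q hq] at h1

theorem homotopic_inv {φ φ' : ContactIsotopy α} (h : Homotopic φ φ') :
    Homotopic φ.inv φ'.inv := by
  obtain ⟨K, h1, h2, h3, h4⟩ := h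
  have h0 : (0 : ℝ) ∈ Icc (0 : ℝ) 1 := ⟨le_rfl, zero_le_one⟩
  have h01 : (1 : ℝ) ∈ Icc (0 : ℝ) 1 := ⟨zero_le_one, le_rfl⟩
  refine ⟨K.inv, ?_, ?_, ?_, ?_⟩
  · exact fun t ht => K.invFun_congr φ.family ⟨h0, ht⟩ ht (h1 t ht)
  · exact fun t ht => K.invFun_congr φ'.family ⟨h01, ht⟩ ht (h2 t ht)
  · intro s hs x
    have h5 := K.left_inv (s, 0) ⟨hs, h0⟩ x
    rwa [h3 s hs] at h5
  · exact fun s hs => K.invFun_congr φ.family ⟨hs, h01⟩ h01 (h4 s hs)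

/-- The group structure `[{φ_t}] * [{ψ_t}] = [{φ_t ∘ ψ_t}]`. -/
instance : Group (UniversalCover α) where
  one := UniversalCover.mk (ContactIsotopy.one α)
  mul := Quot.map₂ ContactIsotopy.mul
    (fun _ _ _ h => homotopic_mul (homotopic_of_eqOn (fun _ _ _ => rfl)) h)
    (fun _ _ _ h => homotopic_mul h (homotopic_of_eqOn (fun _ _ _ => rfl)))
  inv := Quot.map ContactIsotopy.inv (fun _ _ h => homotopic_inv h)
  mul_assoc := by
    rintro ⟨a⟩ ⟨b⟩ ⟨c⟩
    exact Quot.sound (homotopic_of_eqOn (fun _ _ _ => rfl))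
  one_mul := by
    rintro ⟨a⟩
    exact Quot.sound (homotopic_of_eqOn (fun _ _ _ => rfl))
  mul_one := by
    rintro ⟨a⟩
    exact Quot.sound (homotopic_of_eqOn (fun _ _ _ => rfl))
  inv_mul_cancel := by
    rintro ⟨a⟩
    exact Quot.sound (homotopic_of_eqOn (fun t ht x => a.family.left_inv t ht x))

/-- The velocity `d/dt φ_t(x)` of a contact isotopy (one-sided at `t = 0` and `t = 1`). -/
def ContactIsotopy.velocity (φ : ContactIsotopy α) (t : ℝ) (x : M) :
    TangentSpace (𝓡 (2 * n + 1)) (φ.family.toFun t x) :=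
  mfderivWithin 𝓘(ℝ, ℝ) (𝓡 (2 * n + 1)) (fun s : ℝ => φ.family.toFun s x) (Icc (0 : ℝ) 1) t
    (1 : ℝ)

/-- The isotopy moves every point positively transversely to the contact distribution. -/
def ContactIsotopy.IsPositive (φ : ContactIsotopy α) : Prop :=
  ∀ t ∈ Icc (0 : ℝ) 1, ∀ x, 0 < α (φ.family.toFun t x) (φ.velocity t x)

/-- The isotopy moves every point negatively transversely to the contact distribution. -/
def ContactIsotopy.IsNegative (φ : ContactIsotopy α) : Prop :=
  ∀ t ∈ Icc (0 : ℝ) 1, ∀ x, α (φ.family.toFun t x) (φ.velocity t x) < 0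

/-- The isotopy is generated by a non-negative contact Hamiltonian. -/
def ContactIsotopy.IsNonneg (φ : ContactIsotopy α) : Prop :=
  ∀ t ∈ Icc (0 : ℝ) 1, ∀ x, 0 ≤ α (φ.family.toFun t x) (φ.velocity t x)

/-- The map `(t, q) ↦ (q, φ_t(q), g_t(q))` whose image over `t ∈ [0,1]` is the union of the
graphs `gr(φ_t)` in `M × M × ℝ`, where `φ_t^* α = e^(g_t) α`. -/
def ContactIsotopy.graphMap (φ : ContactIsotopy α) (z : ℝ × M) : M × M × ℝ :=
  (z.2, φ.family.toFun z.1 z.2, φ.family.factor z.1 z.2)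

/-- The union of the graphs `gr(φ_t)`, `t ∈ [0,1]`, is embedded in `M × M × ℝ`: the map
`(t, q) ↦ (q, φ_t(q), g_t(q))` on `[0,1] × M` is an injective immersion
(for compact `M`, this is a smooth embedding). -/
def ContactIsotopy.IsEmbedded (φ : ContactIsotopy α) : Prop :=
  InjOn φ.graphMap (Icc (0 : ℝ) 1 ×ˢ univ) ∧
  ∀ z ∈ Icc (0 : ℝ) 1 ×ˢ (univ : Set M), Function.Injective
    (mfderivWithin (𝓘(ℝ, ℝ).prod (𝓡 (2 * n + 1)))
      ((𝓡 (2 * n + 1)).prod ((𝓡 (2 * n + 1)).prod 𝓘(ℝ, ℝ)))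
      φ.graphMap (Icc (0 : ℝ) 1 ×ˢ (univ : Set M)) z)

/-- Classes represented by a positive embedded isotopy. -/
def positivePieces (α : ∀ x : M, TangentSpace (𝓡 (2 * n + 1)) x →L[ℝ] ℝ) :
    Set (UniversalCover α) :=
  {c | ∃ φ : ContactIsotopy α, UniversalCover.mk φ = c ∧ φ.IsEmbedded ∧ φ.IsPositive}

/-- Classes represented by a negative embedded isotopy. -/
def negativePieces (α : ∀ x : M, TangentSpace (𝓡 (2 * n + 1)) x →L[ℝ] ℝ) :
    Set (UniversalCover α) :=
  {c | ∃ φ : ContactIsotopy α, UniversalCover.mk φ = c ∧ φ.IsEmbedded ∧ φ.IsNegative}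

/-- `l` is a decomposition of `c` as a product of positive pieces (marked `true`) and negative
pieces (marked `false`), in any order. -/
def IsDecomposition (l : List (Bool × UniversalCover α)) (c : UniversalCover α) : Prop :=
  (∀ a, (true, a) ∈ l → a ∈ positivePieces α) ∧
  (∀ a, (false, a) ∈ l → a ∈ negativePieces α) ∧
  (l.map Prod.snd).prod = c

/-- `ν⁺(c)`: the minimal number of positive pieces in a decomposition of `c`. -/
def nuPlus (c : UniversalCover α) : ℤ :=
  (sInf {k : ℕ | ∃ l : List (Bool × UniversalCover α), IsDecomposition l c ∧
    l.countP (fun p => p.1) = k} : ℕ)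

/-- `ν⁻(c)`: minus the minimal number of negative pieces in a decomposition of `c`. -/
def nuMinus (c : UniversalCover α) : ℤ :=
  -(sInf {k : ℕ | ∃ l : List (Bool × UniversalCover α), IsDecomposition l c ∧
    l.countP (fun p => !p.1) = k} : ℕ)

/-- The oscillation pseudo-norm `ν_osc = ν⁺ - ν⁻`. -/
def nuOsc (c : UniversalCover α) : ℤ := nuPlus c - nuMinus c

/-- The relation `a ≤ b`: the class `b * a⁻¹` is represented by a non-negative isotopy. -/
def LeEP (a b : UniversalCover α) : Prop :=
  ∃ φ : ContactIsotopy α, UniversalCover.mk φ = b * a⁻¹ ∧ φ.IsNonneg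

/-- `(M, ker α)` is orderable: the (always reflexive and transitive) relation `LeEP` on the
universal cover is a partial order, i.e. is antisymmetric. -/
def Orderable (α : ∀ x : M, TangentSpace (𝓡 (2 * n + 1)) x →L[ℝ] ℝ) : Prop :=
  ∀ a b : UniversalCover α, LeEP a b → LeEP b a → a = b

end Isotopies

/-- Conjugation-invariant pseudo-norms on a group. -/
structure IsConjInvPseudoNorm {G : Type*} [Group G] (ν : G → ℝ) : Prop where
  nonneg : ∀ g, 0 ≤ ν g
  map_one : ν 1 = 0
  map_inv : ∀ g, ν g⁻¹ = ν g
  map_mul_le : ∀ f g, ν (f * g) ≤ ν f + ν g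
  map_conj : ∀ f g, ν (g * f * g⁻¹) = ν f

end ContactGeometry

end

open ContactGeometry

/-!
The rate `α (d/dt φ_t)` at which an isotopy crosses the contact distribution, its Hamiltonian
`ContactFamily.ham`, obeys simple rules under composition, inversion, conjugation and
reparametrization. They show that the classes of non-negative isotopies form a
conjugation-invariant submonoid, in which the classes of positive isotopies form an ideal.

*Decompositions exist.* The points of a compact manifold move injectively for a uniformly short
time under a positive isotopy, so that its short parts are embedded and its class is a product of
positive pieces (`IsPositive.mk_mem_closure`). Some positive isotopy `π` exists: near each point,
the flow of the contact vector field of a bump function starts in non-negative directions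
everywhere and in a positive one at the point (`exists_isotopy_ham_pos`), and finitely many of
these flows compose to an isotopy that is positive for a short time (`exists_ham_pos_of_local`,
`exists_isPositive_piece`). A short part `c` of an arbitrary isotopy is `π⁻¹ (π c)`, where `π c`
is still positive (`mem_closure_pieces`). The axioms of a pseudo-norm follow by concatenating,
conjugating and inverting decompositions, as positive pieces are conjugation-invariant and inverse
to negative ones.

*Non-degeneracy.* A class has `ν_osc = 0` exactly if it is a product of positive pieces and also a
product of negative pieces (`nuOsc_eq_zero_iff`). Such a class and its inverse are both
non-negative, hence the class is trivial if `M` is orderable. Conversely, let `c ≠ 1` be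
non-negative together with its inverse. As in the work of Eliashberg and Polterovich, there is
then a positive contractible loop (`one_mem_positiveClasses`): an isotopy with zero Hamiltonian is
constant (`mk_eq_one_of_ham_eq_zero`), so that a non-negative isotopy representing `c` crosses the
distribution somewhere; contact isotopies carry this behaviour to all other points
(`isClosed_of_invariant`), and a composition of conjugated parts is positive at every point.
Multiplying by this loop makes `c` and `c⁻¹` positive, and `ν_osc c = 0`.

The flows of contact vector fields, which have to depend smoothly on time and on the initial
point, are obtained from the implicit function theorem for the Picard operator on `C([0,1], E)`
(`contDiffAt_flowCurve`).
-/

noncomputable section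

namespace ContactGeometry

/-! ### Composition operators on spaces of continuous functions -/

section Nemytskii

open Topology

universe u

/-- Pointwise evaluation of a continuous family of operators on a continuous family of vectors. -/
def pointwiseApply (K : Type*) [TopologicalSpace K] [CompactSpace K] (E F : Type*)
    [NormedAddCommGroup E] [NormedSpace ℝ E] [NormedAddCommGroup F] [NormedSpace ℝ F] :
    C(K, E →L[ℝ] F) →L[ℝ] C(K, E) →L[ℝ] C(K, F) :=
  LinearMap.mkContinuous₂
    (LinearMap.mk₂ ℝ (fun (A : C(K, E →L[ℝ] F)) (η : C(K, E)) =>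
        (⟨fun k => A k (η k), by fun_prop⟩ : C(K, F)))
      (fun _ _ _ => by ext; simp) (fun _ _ _ => by ext; simp)
      (fun _ _ _ => by ext; simp) (fun _ _ _ => by ext; simp)) 1
    (fun A η => by
      rw [one_mul]
      refine (ContinuousMap.norm_le _ (mul_nonneg (norm_nonneg A) (norm_nonneg η))).2 fun k => ?_
      exact ((A k).le_opNorm _).trans
        (mul_le_mul (A.norm_coe_le_norm k) (η.norm_coe_le_norm k) (norm_nonneg _) (norm_nonneg _)))

variable {K : Type*} [TopologicalSpace K] [CompactSpace K]

theorem hasFDerivAt_postcomp {E F : Type*}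
    [NormedAddCommGroup E] [NormedSpace ℝ E] [NormedAddCommGroup F] [NormedSpace ℝ F]
    {f : C(E, F)} {f' : C(E, E →L[ℝ] F)} (hf : ∀ x, HasFDerivAt f (f' x) x) (γ : C(K, E)) :
    HasFDerivAt (fun γ : C(K, E) => f.comp γ) (pointwiseApply K E F (f'.comp γ)) γ := by
  rw [hasFDerivAt_iff_isLittleO_nhds_zero, Asymptotics.isLittleO_iff]
  intro c hc
  have h1 : ∀ᶠ z : E in 𝓝 0, ∀ k ∈ (univ : Set K), ‖f' (γ k + z) - f' (γ k)‖ < c := by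
    refine isCompact_univ.eventually_forall_of_forall_eventually fun k _ => ?_
    have hcont : Continuous fun w : E × K => ‖f' (γ w.2 + w.1) - f' (γ w.2)‖ := by fun_prop
    exact hcont.continuousAt.eventually_lt continuousAt_const (by simpa using hc)
  obtain ⟨δ, hδ, hball⟩ := Metric.eventually_nhds_iff_ball.1 h1
  filter_upwards [Metric.ball_mem_nhds (0 : C(K, E)) hδ] with η hη
  rw [mem_ball_zero_iff] at hη
  refine (ContinuousMap.norm_le _ (by positivity)).2 fun k => ?_
  have hηk : ‖η k‖ < δ := (η.norm_coe_le_norm k).trans_lt hη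
  have h2 := (convex_ball (γ k) δ).norm_image_sub_le_of_norm_hasFDerivWithin_le' (f := f)
    (f' := fun x => f' x) (φ := f' (γ k)) (C := c) (x := γ k) (y := γ k + η k)
    (fun x _ => (hf x).hasFDerivWithinAt) (fun x hx => by
      have := hball (x - γ k) (by simpa [dist_eq_norm] using hx) k (mem_univ _)
      simpa using this.le) (Metric.mem_ball_self hδ) (by simpa [dist_eq_norm] using hηk)
  rw [add_sub_cancel_left] at h2
  exact h2.trans (mul_le_mul_of_nonneg_left (η.norm_coe_le_norm k) hc.le)

theorem contDiff_postcomp_nat (m : ℕ) : ∀ {E F : Type u}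
    [NormedAddCommGroup E] [NormedSpace ℝ E] [NormedAddCommGroup F] [NormedSpace ℝ F]
    (f : C(E, F)), ContDiff ℝ m f → ContDiff ℝ m (fun γ : C(K, E) => f.comp γ) := by
  induction m with
  | zero =>
    intro E F _ _ _ _ f _
    exact contDiff_zero.2 (ContinuousMap.continuous_postcomp f)
  | succ m ih =>
    intro E F _ _ _ _ f hf
    have hf1 : ContDiff ℝ m (fderiv ℝ f) :=
      hf.fderiv_right (by norm_cast)
    have hd : ∀ x, HasFDerivAt f (fderiv ℝ f x) x := fun x =>
      ((hf.differentiable (by simp)) x).hasFDerivAt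
    let f' : C(E, E →L[ℝ] F) := ⟨fderiv ℝ f, hf1.continuous⟩
    have h := hasFDerivAt_postcomp (K := K) (f := f) (f' := f') hd
    push_cast
    rw [contDiff_succ_iff_fderiv]
    refine ⟨fun γ => (h γ).differentiableAt, by simp, ?_⟩
    rw [show fderiv ℝ (fun γ : C(K, E) => f.comp γ) = fun γ => pointwiseApply K E F (f'.comp γ)
      from funext fun γ => (h γ).fderiv]
    exact (pointwiseApply K E F).contDiff.comp (ih f' hf1)

/-- Composition with a smooth map is a smooth (Nemytskii) operator on spaces of continuous
functions over a compact space. -/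
theorem contDiff_postcomp {E F : Type u}
    [NormedAddCommGroup E] [NormedSpace ℝ E] [NormedAddCommGroup F] [NormedSpace ℝ F]
    (f : C(E, F)) (hf : ContDiff ℝ ∞ f) : ContDiff ℝ ∞ (fun γ : C(K, E) => f.comp γ) :=
  contDiff_infty.2 fun m => contDiff_postcomp_nat m f (contDiff_infty.1 hf m)

end Nemytskii

/-! ### Smooth dependence of flows on time and initial point -/

section Flow

open unitInterval Topology

variable {E : Type} [NormedAddCommGroup E] [NormedSpace ℝ E]

/-- The Volterra operator `γ ↦ (s ↦ ∫₀ˢ γ)` on continuous curves `γ : [0,1] → E`. -/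
def integralCLM (E : Type) [NormedAddCommGroup E] [NormedSpace ℝ E] : C(I, E) →L[ℝ] C(I, E) :=
  LinearMap.mkContinuous
    { toFun := fun γ => ⟨fun s => ∫ r in (0 : ℝ)..s, IccExtend zero_le_one γ r,
        (intervalIntegral.continuous_primitive (fun a b =>
          ((γ.continuous.Icc_extend' (h := zero_le_one)).intervalIntegrable a b)) 0).comp
          continuous_subtype_val⟩
      map_add' := fun γ η => by
        ext s
        exact intervalIntegral.integral_add
          ((γ.continuous.Icc_extend' (h := zero_le_one)).intervalIntegrable _ _)
          ((η.continuous.Icc_extend' (h := zero_le_one)).intervalIntegrable _ _)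
      map_smul' := fun c γ => by
        ext s
        exact intervalIntegral.integral_smul c _ } 1
    (fun γ => by
      rw [one_mul]
      refine (ContinuousMap.norm_le _ (norm_nonneg _)).2 fun s => ?_
      refine (intervalIntegral.norm_integral_le_of_norm_le_const
        (C := ‖γ‖) fun r _ => γ.norm_coe_le_norm _).trans ?_
      rw [sub_zero, abs_of_nonneg s.2.1]
      exact mul_le_of_le_one_right (norm_nonneg _) s.2.2)

theorem integralCLM_apply (γ : C(I, E)) (s : I) :
    integralCLM E γ s = ∫ r in (0 : ℝ)..s, IccExtend zero_le_one γ r := rfl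

theorem norm_integralCLM_le : ‖integralCLM E‖ ≤ 1 :=
  LinearMap.mkContinuous_norm_le _ zero_le_one _

variable {X : C(E, E)}

/-- The Picard operator, whose fixed points are the curves `γ : [0,1] → E` with
`γ' = τ • X (γ)`, `γ 0 = x`, where `p = (τ, x)`. -/
def picardMap (X : C(E, E)) (p : ℝ × E) (γ : C(I, E)) : C(I, E) :=
  ContinuousMap.const I p.2 + p.1 • integralCLM E (X.comp γ)

theorem contDiff_picardMap (hX : ContDiff ℝ ∞ X) :
    ContDiff ℝ ∞ (fun w : (ℝ × E) × C(I, E) => picardMap X w.1 w.2) := by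
  have h1 : ContDiff ℝ ∞ (fun x : E => ContinuousMap.const I x) := by
    let L : E →L[ℝ] C(I, E) := LinearMap.mkContinuous
      { toFun := fun x => ContinuousMap.const I x
        map_add' := fun _ _ => rfl
        map_smul' := fun _ _ => rfl } 1
      (fun x => by
        rw [one_mul]
        exact (ContinuousMap.norm_le _ (norm_nonneg _)).2 fun _ => le_rfl)
    exact L.contDiff
  have h2 : ContDiff ℝ ∞ (fun w : (ℝ × E) × C(I, E) => integralCLM E (X.comp w.2)) :=
    (integralCLM E).contDiff.comp ((contDiff_postcomp X hX).comp contDiff_snd)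
  exact (h1.comp (contDiff_snd.comp contDiff_fst)).add
    ((contDiff_fst.comp contDiff_fst).smul h2)

theorem lipschitzWith_picardMap (hL : LipschitzWith (1 / 4) X) {p : ℝ × E} (hp : |p.1| < 2) :
    LipschitzWith (1 / 2) (picardMap X p) := by
  refine LipschitzWith.of_dist_le_mul fun γ η => ?_
  have h1 : dist (X.comp γ) (X.comp η) ≤ 1 / 4 * dist γ η := by
    refine (ContinuousMap.dist_le (by positivity)).2 fun k => ?_
    refine (hL.dist_le_mul _ _).trans ?_
    have := ContinuousMap.dist_apply_le_dist (f := γ) (g := η) k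
    push_cast
    gcongr
  have h2 : dist (picardMap X p γ) (picardMap X p η)
      = |p.1| * ‖integralCLM E (X.comp γ - X.comp η)‖ := by
    rw [dist_eq_norm, picardMap, picardMap, add_sub_add_left_eq_sub, ← smul_sub, ← map_sub,
      norm_smul, Real.norm_eq_abs]
  rw [h2]
  have h3 : ‖integralCLM E (X.comp γ - X.comp η)‖ ≤ 1 * ‖X.comp γ - X.comp η‖ :=
    (integralCLM E).le_of_opNorm_le norm_integralCLM_le _
  rw [dist_eq_norm] at h1
  push_cast
  nlinarith [abs_nonneg p.1, norm_nonneg (integralCLM E (X.comp γ - X.comp η)),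
    dist_nonneg (x := γ) (y := η)]

theorem contractingWith_picardMap (hL : LipschitzWith (1 / 4) X) {p : ℝ × E} (hp : |p.1| < 2) :
    ContractingWith (1 / 2) (picardMap X p) :=
  ⟨by norm_num, lipschitzWith_picardMap hL hp⟩

variable [CompleteSpace E]

open Classical in
/-- The curve `s ↦ φ_(sτ)(x)`, `s ∈ [0,1]`, where `φ` is the flow of `X` and `p = (τ, x)`;
meaningful for `|τ| < 2` when `X` is `1/4`-Lipschitz. -/
def flowCurve (X : C(E, E)) (p : ℝ × E) : C(I, E) :=
  if h : ContractingWith (1 / 2) (picardMap X p) then h.fixedPoint else 0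

theorem picardMap_flowCurve (hL : LipschitzWith (1 / 4) X) {p : ℝ × E} (hp : |p.1| < 2) :
    picardMap X p (flowCurve X p) = flowCurve X p := by
  rw [flowCurve, dif_pos (contractingWith_picardMap hL hp)]
  exact (contractingWith_picardMap hL hp).fixedPoint_isFixedPt

theorem eq_flowCurve (hL : LipschitzWith (1 / 4) X) {p : ℝ × E} (hp : |p.1| < 2)
    {γ : C(I, E)} (hγ : picardMap X p γ = γ) : γ = flowCurve X p :=
  (contractingWith_picardMap hL hp).fixedPoint_unique' hγ (picardMap_flowCurve hL hp)

/-- Smooth dependence of the solution curve on time and initial condition: since the Picard operator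
is a contraction, the implicit function theorem applies to the fixed point equation. -/
theorem contDiffAt_flowCurve (hX : ContDiff ℝ ∞ X) (hL : LipschitzWith (1 / 4) X) {p : ℝ × E}
    (hp : |p.1| < 2) : ContDiffAt ℝ ∞ (flowCurve X) p := by
  let G : (ℝ × E) × C(I, E) → C(I, E) := fun w => w.2 - picardMap X w.1 w.2
  have hG : ContDiff ℝ ∞ G := contDiff_snd.sub (contDiff_picardMap hX)
  set u : (ℝ × E) × C(I, E) := (p, flowCurve X p) with hu
  have hG0 : G u = 0 := sub_eq_zero.2 (picardMap_flowCurve hL hp).symm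
  have hdiff : DifferentiableAt ℝ (fun w : (ℝ × E) × C(I, E) => picardMap X w.1 w.2) u :=
    (contDiff_picardMap hX).differentiable (by simp) u
  set D := fderiv ℝ (fun w : (ℝ × E) × C(I, E) => picardMap X w.1 w.2) u ∘L
    ContinuousLinearMap.inr ℝ (ℝ × E) (C(I, E)) with hD
  have hinr : HasFDerivAt (fun γ : C(I, E) => ((p, γ) : (ℝ × E) × C(I, E)))
      (ContinuousLinearMap.inr ℝ (ℝ × E) (C(I, E))) (flowCurve X p) :=
    hasFDerivAt_prodMk_right p _
  have hDd : HasFDerivAt (picardMap X p) D (flowCurve X p) :=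
    HasFDerivAt.comp (f := fun γ : C(I, E) => ((p, γ) : (ℝ × E) × C(I, E))) (flowCurve X p)
      hdiff.hasFDerivAt hinr
  have hDn : ‖D‖ < 1 := by
    have := hDd.le_of_lipschitz (lipschitzWith_picardMap hL hp)
    refine this.trans_lt (by norm_num)
  have hGd : fderiv ℝ G u ∘L ContinuousLinearMap.inr ℝ (ℝ × E) (C(I, E)) = 1 - D := by
    have h1 : HasFDerivAt G (ContinuousLinearMap.snd ℝ (ℝ × E) (C(I, E))
        - fderiv ℝ (fun w : (ℝ × E) × C(I, E) => picardMap X w.1 w.2) u) u :=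
      hasFDerivAt_snd.sub hdiff.hasFDerivAt
    rw [h1.fderiv, hD, ContinuousLinearMap.sub_comp]
    rfl
  have hinv : (fderiv ℝ G u ∘L ContinuousLinearMap.inr ℝ (ℝ × E) (C(I, E))).IsInvertible := by
    rw [hGd]
    obtain ⟨v, hv⟩ := isUnit_one_sub_of_norm_lt_one (R := C(I, E) →L[ℝ] C(I, E)) (x := D) hDn
    exact ⟨ContinuousLinearEquiv.ofUnit v, by rw [← hv]; rfl⟩
  have hGu : ContDiffAt ℝ ∞ G u := hG.contDiffAt
  have hsm := hGu.contDiffAt_implicitFunction (by simp) hinv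
  refine hsm.congr_of_eventuallyEq ?_
  have h1 := hGu.eventually_apply_implicitFunction (by simp) hinv
  have h2 : ∀ᶠ q : ℝ × E in 𝓝 p, |q.1| < 2 :=
    (continuous_fst.abs.continuousAt).eventually_lt continuousAt_const hp
  filter_upwards [h1, h2] with q hq hq2
  rw [hG0] at hq
  exact (eq_flowCurve hL hq2 (sub_eq_zero.1 hq).symm).symm

/-- The flow `φ_t(x)` of `X`, for `|t| < 2`. -/
def localFlow (X : C(E, E)) (t : ℝ) (x : E) : E := flowCurve X (t, x) 1

theorem flowCurve_apply (hL : LipschitzWith (1 / 4) X) {t : ℝ} (ht : |t| < 2) (x : E) (s : I) :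
    flowCurve X (t, x) s = localFlow X (s * t) x := by
  set γ := flowCurve X (t, x) with hγ
  have hfix := picardMap_flowCurve (p := (t, x)) hL ht
  rw [← hγ] at hfix
  have hst : |(s : ℝ) * t| < 2 := by
    rw [abs_mul, abs_of_nonneg s.2.1]
    exact (mul_le_of_le_one_left (abs_nonneg _) s.2.2).trans_lt ht
  let η : C(I, E) := ⟨fun r => γ (s * r), by fun_prop⟩
  have hη : picardMap X (s * t, x) η = η := by
    ext r
    have h1 := DFunLike.congr_fun hfix (s * r)
    rw [show η r = γ (s * r) from rfl, ← h1]
    simp only [picardMap, ContinuousMap.add_apply, ContinuousMap.smul_apply,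
      ContinuousMap.const_apply, integralCLM_apply]
    congr 1
    rw [mul_comm, mul_smul]
    congr 1
    have h2 := intervalIntegral.smul_integral_comp_mul_left (a := 0) (b := (r : ℝ))
      (fun z => IccExtend zero_le_one (X.comp γ) z) (s : ℝ)
    rw [mul_zero] at h2
    rw [show (((s * r : I) : ℝ)) = (s : ℝ) * r from rfl, ← h2]
    congr 1
    refine intervalIntegral.integral_congr fun z hz => ?_
    rw [uIcc_of_le r.2.1] at hz
    have hz1 : z ∈ Icc (0 : ℝ) 1 := ⟨hz.1, hz.2.trans r.2.2⟩
    have hz2 : (s : ℝ) * z ∈ Icc (0 : ℝ) 1 :=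
      ⟨mul_nonneg s.2.1 hz1.1, mul_le_one₀ s.2.2 hz1.1 hz1.2⟩
    rw [IccExtend_of_mem _ _ hz1, IccExtend_of_mem _ _ hz2]
    rfl
  have h3 := eq_flowCurve (p := ((s : ℝ) * t, x)) hL hst hη
  rw [localFlow, ← h3]
  change γ s = γ (s * 1)
  rw [mul_one]

theorem smul_integral_flowCurve (hL : LipschitzWith (1 / 4) X) {F : Type*} [NormedAddCommGroup F]
    [NormedSpace ℝ F] (f : E → F) {t : ℝ} (ht : |t| < 2) (x : E) :
    t • (∫ r in (0 : ℝ)..1, IccExtend zero_le_one (fun s => f (flowCurve X (t, x) s)) r)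
      = ∫ r in (0 : ℝ)..t, f (localFlow X r x) := by
  have h2 := intervalIntegral.smul_integral_comp_mul_left (a := 0) (b := 1)
    (fun z => f (localFlow X z x)) t
  rw [mul_zero, mul_one] at h2
  rw [← h2]
  congr 1
  refine intervalIntegral.integral_congr fun z hz => ?_
  rw [uIcc_of_le zero_le_one] at hz
  rw [IccExtend_of_mem _ _ hz, flowCurve_apply hL ht, mul_comm]

theorem contDiffAt_localFlow (hX : ContDiff ℝ ∞ X) (hL : LipschitzWith (1 / 4) X)
    {p : ℝ × E} (hp : |p.1| < 2) : ContDiffAt ℝ ∞ (fun p : ℝ × E => localFlow X p.1 p.2) p :=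
  (ContinuousMap.evalCLM ℝ (1 : I) : C(I, E) →L[ℝ] E).contDiff.contDiffAt.comp p
    (contDiffAt_flowCurve hX hL hp)

theorem localFlow_eq_integral (hL : LipschitzWith (1 / 4) X) {t : ℝ} (ht : |t| < 2) (x : E) :
    localFlow X t x = x + ∫ r in (0 : ℝ)..t, X (localFlow X r x) := by
  rw [← smul_integral_flowCurve hL X ht x]
  exact (DFunLike.congr_fun (picardMap_flowCurve (p := (t, x)) hL ht) 1).symm

theorem localFlow_zero (hL : LipschitzWith (1 / 4) X) (x : E) : localFlow X 0 x = x := by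
  rw [localFlow_eq_integral hL (by simp) x, intervalIntegral.integral_same, add_zero]

theorem continuousOn_localFlow (hX : ContDiff ℝ ∞ X) (hL : LipschitzWith (1 / 4) X) (x : E) :
    ContinuousOn (fun t => localFlow X t x) (Ioo (-2) 2) := fun t ht =>
  ((contDiffAt_localFlow hX hL (p := (t, x)) (abs_lt.2 ht)).continuousAt.comp
    (f := fun t : ℝ => (t, x)) (by fun_prop)).continuousWithinAt

theorem hasDerivAt_integral_localFlow (hX : ContDiff ℝ ∞ X) (hL : LipschitzWith (1 / 4) X)
    {F : Type*} [NormedAddCommGroup F] [NormedSpace ℝ F] [CompleteSpace F] {f : E → F}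
    (hf : Continuous f) {t : ℝ} (ht : |t| < 2) (x : E) :
    HasDerivAt (fun t => ∫ r in (0 : ℝ)..t, f (localFlow X r x)) (f (localFlow X t x)) t := by
  have hc : ContinuousOn (fun t => f (localFlow X t x)) (Ioo (-2) 2) :=
    hf.comp_continuousOn (continuousOn_localFlow hX hL x)
  have ht' : t ∈ Ioo (-2 : ℝ) 2 := abs_lt.1 ht
  refine intervalIntegral.integral_hasDerivAt_right ?_ ?_ ?_
  · exact (hc.mono ((ordConnected_Ioo.uIcc_subset (by norm_num) ht'))).intervalIntegrable
  · exact hc.stronglyMeasurableAtFilter isOpen_Ioo t ht'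
  · exact hc.continuousAt (isOpen_Ioo.mem_nhds ht')

theorem hasDerivAt_localFlow (hX : ContDiff ℝ ∞ X) (hL : LipschitzWith (1 / 4) X)
    {t : ℝ} (ht : |t| < 2) (x : E) :
    HasDerivAt (fun t => localFlow X t x) (X (localFlow X t x)) t := by
  refine ((hasDerivAt_integral_localFlow hX hL X.continuous ht x).const_add x).congr_of_eventuallyEq
    ?_
  filter_upwards [isOpen_Ioo.mem_nhds (abs_lt.1 ht)] with r hr
  exact localFlow_eq_integral hL (abs_lt.2 hr) x

/-- Integrals of smooth functions along the flow lines depend smoothly on the end time and on the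
initial point. -/
theorem contDiffAt_integral_localFlow (hX : ContDiff ℝ ∞ X) (hL : LipschitzWith (1 / 4) X)
    {F : Type} [NormedAddCommGroup F] [NormedSpace ℝ F] {f : C(E, F)}
    (hf : ContDiff ℝ ∞ f) {p : ℝ × E} (hp : |p.1| < 2) :
    ContDiffAt ℝ ∞ (fun p : ℝ × E => ∫ r in (0 : ℝ)..p.1, f (localFlow X r p.2)) p := by
  have h1 : ContDiffAt ℝ ∞
      (fun p : ℝ × E => p.1 • integralCLM F (f.comp (flowCurve X p)) 1) p :=
    contDiffAt_fst.smul
      ((ContinuousMap.evalCLM ℝ (1 : I) : C(I, F) →L[ℝ] F).contDiff.contDiffAt.comp p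
        ((integralCLM F).contDiff.contDiffAt.comp p
        ((contDiff_postcomp f hf).contDiffAt.comp p (contDiffAt_flowCurve hX hL hp))))
  refine h1.congr_of_eventuallyEq ?_
  have h2 : ∀ᶠ q : ℝ × E in 𝓝 p, |q.1| < 2 :=
    (continuous_fst.abs.continuousAt).eventually_lt continuousAt_const hp
  filter_upwards [h2] with q hq
  exact (smul_integral_flowCurve hL f hq q.2).symm

theorem localFlow_neg_localFlow (hX : ContDiff ℝ ∞ X) (hL : LipschitzWith (1 / 4) X)
    {t : ℝ} (ht : |t| < 2) (x : E) : localFlow X (-t) (localFlow X t x) = x := by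
  have hIoo : ∀ s ∈ Icc (0 : ℝ) 1, |s * t| < 2 ∧ |t - s * t| < 2 := by
    intro s hs
    constructor
    · rw [abs_mul, abs_of_nonneg hs.1]
      exact (mul_le_of_le_one_left (abs_nonneg _) hs.2).trans_lt ht
    · rw [show t - s * t = (1 - s) * t by ring, abs_mul, abs_of_nonneg (sub_nonneg.2 hs.2)]
      exact (mul_le_of_le_one_left (abs_nonneg _) (by linarith [hs.1])).trans_lt ht
  have h1 : ∀ s ∈ Icc (0 : ℝ) 1, HasDerivAt (fun s => localFlow X (-(s * t)) (localFlow X t x))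
      ((-t) • X (localFlow X (-(s * t)) (localFlow X t x))) s := by
    intro s hs
    have hd : HasDerivAt (fun s : ℝ => -(s * t)) (-t) s := by
      simp_rw [← mul_neg]
      simpa using (hasDerivAt_id s).mul_const (-t)
    exact (hasDerivAt_localFlow hX hL (t := -(s * t)) (by rw [abs_neg]; exact (hIoo s hs).1)
      (localFlow X t x)).scomp s hd
  have h2 : ∀ s ∈ Icc (0 : ℝ) 1, HasDerivAt (fun s => localFlow X (t - s * t) x)
      ((-t) • X (localFlow X (t - s * t) x)) s := by
    intro s hs
    have hd : HasDerivAt (fun s : ℝ => t - s * t) (-t) s := by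
      simpa using ((hasDerivAt_id s).mul_const t).const_sub t
    exact (hasDerivAt_localFlow hX hL (hIoo s hs).2 x).scomp s hd
  have h3 := ODE_solution_unique (v := fun _ y => (-t) • X y) (K := ‖-t‖₊ * (1 / 4))
    (f := fun s => localFlow X (-(s * t)) (localFlow X t x))
    (g := fun s => localFlow X (t - s * t) x) (a := 0) (b := 1)
    (fun _ => (lipschitzWith_smul (-t)).comp hL)
    (fun s hs => (h1 s hs).continuousAt.continuousWithinAt)
    (fun s hs => (h1 s ⟨hs.1, hs.2.le⟩).hasDerivWithinAt)
    (fun s hs => (h2 s hs).continuousAt.continuousWithinAt)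
    (fun s hs => (h2 s ⟨hs.1, hs.2.le⟩).hasDerivWithinAt)
    (by simp [localFlow_zero hL]) (right_mem_Icc.2 zero_le_one)
  simpa [localFlow_zero hL] using h3

theorem localFlow_eq_self (hL : LipschitzWith (1 / 4) X)
    {t : ℝ} (ht : |t| < 2) {x : E} (hx : X x = 0) : localFlow X t x = x := by
  have h : picardMap X (t, x) (ContinuousMap.const I x) = ContinuousMap.const I x := by
    ext s
    simp [picardMap, hx]
  rw [localFlow, ← eq_flowCurve (p := (t, x)) hL ht h]
  rfl

end Flow

/-! ### Contact forms and contact vector fields on vector spaces -/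

section LocalContact

open Topology Metric

variable {E : Type} [NormedAddCommGroup E] [NormedSpace ℝ E]

/-- The exterior derivative of a 1-form on a vector space, `da (u, v) = (D_u a) v - (D_v a) u`. -/
def formDeriv (a : E → E →L[ℝ] ℝ) (y : E) : E →L[ℝ] E →L[ℝ] ℝ :=
  fderiv ℝ a y - (fderiv ℝ a y).flip

theorem formDeriv_apply (a : E → E →L[ℝ] ℝ) (y u v : E) :
    formDeriv a y u v = fderiv ℝ a y u v - fderiv ℝ a y v u := rfl

/-- The operator `u ↦ a(u) a + da(u, ·)` from vectors to covectors, which is invertible wherever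
`a` is a contact form. -/
def contactOp (a : E → E →L[ℝ] ℝ) (y : E) : E →L[ℝ] E →L[ℝ] ℝ :=
  (a y).smulRight (a y) + formDeriv a y

theorem contactOp_apply (a : E → E →L[ℝ] ℝ) (y u v : E) :
    contactOp a y u v = a y u * a y v + formDeriv a y u v := rfl

/-- The Reeb vector field of `a`. -/
def reeb (a : E → E →L[ℝ] ℝ) (y : E) : E := (contactOp a y).inverse (a y)

/-- The contact vector field with Hamiltonian `H`, determined by `a(X) = H` and
`da(X, ·) = dH(R) a - dH`. -/
def contactField (a : E → E →L[ℝ] ℝ) (H : E → ℝ) (y : E) : E :=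
  (contactOp a y).inverse (H y • a y + (fderiv ℝ H y (reeb a y)) • a y - fderiv ℝ H y)

/-- `a` is a contact form on the open set `V`, phrased through the operator `contactOp`. -/
structure IsContactOn (a : E → E →L[ℝ] ℝ) (V : Set E) : Prop where
  isOpen : IsOpen V
  contDiffOn : ContDiffOn ℝ ∞ a V
  isInvertible : ∀ y ∈ V, (contactOp a y).IsInvertible
  reeb_ne : ∀ y ∈ V, a y (reeb a y) ≠ 0

theorem contDiffAt_formDeriv {a : E → E →L[ℝ] ℝ} {y : E} (ha : ContDiffAt ℝ ∞ a y) :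
    ContDiffAt ℝ ∞ (formDeriv a) y := by
  have h1 : ContDiffAt ℝ ∞ (fderiv ℝ a) y := ha.fderiv_right (by simp)
  have hflip : IsBoundedLinearMap ℝ (fun B : E →L[ℝ] E →L[ℝ] ℝ => B.flip) :=
    { map_add := fun _ _ => rfl
      map_smul := fun _ _ => rfl
      bound := ⟨1, one_pos, fun B => by rw [one_mul]; exact B.opNorm_flip.le⟩ }
  have h2 : ContDiff ℝ ∞ (fun B : E →L[ℝ] E →L[ℝ] ℝ => B.flip) := hflip.contDiff
  exact h1.sub (h2.contDiffAt.comp y h1)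

theorem contDiffAt_contactOp {a : E → E →L[ℝ] ℝ} {y : E} (ha : ContDiffAt ℝ ∞ a y) :
    ContDiffAt ℝ ∞ (contactOp a) y :=
  (ha.smulRight ha).add (contDiffAt_formDeriv ha)

variable {a : E → E →L[ℝ] ℝ} {V : Set E} {y : E}

theorem contDiffAt_reeb [CompleteSpace E] (ha : ContDiffAt ℝ ∞ a y)
    (hi : (contactOp a y).IsInvertible) : ContDiffAt ℝ ∞ (reeb a) y :=
  (hi.contDiffAt_map_inverse.comp y (contDiffAt_contactOp ha)).clm_apply ha

/-- The contact condition at one point, in the form of nondegeneracy on `ker a`, spreads to a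
neighbourhood. -/
theorem exists_isContactOn [FiniteDimensional ℝ E] {U : Set E} (hU : IsOpen U)
    (ha : ContDiffOn ℝ ∞ a U) (hy : y ∈ U) (hne : a y ≠ 0)
    (hnd : ∀ u, a y u = 0 → (∀ v, a y v = 0 → formDeriv a y u v = 0) → u = 0) :
    ∃ V ⊆ U, y ∈ V ∧ IsContactOn a V := by
  have : CompleteSpace E := FiniteDimensional.complete ℝ E
  have hay : ContDiffAt ℝ ∞ a y := ha.contDiffAt (hU.mem_nhds hy)
  have hskew : ∀ u, formDeriv a y u u = 0 := fun u => by rw [formDeriv_apply, sub_self]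
  have hinj : ∀ u, contactOp a y u = 0 → u = 0 := by
    intro u hu
    have h1 : a y u = 0 := by
      have := DFunLike.congr_fun hu u
      rw [contactOp_apply, hskew, add_zero] at this
      exact mul_self_eq_zero.1 this
    refine hnd u h1 fun v _ => ?_
    have := DFunLike.congr_fun hu v
    rwa [contactOp_apply, h1, zero_mul, zero_add] at this
  have hinv : (contactOp a y).IsInvertible := by
    have hi : Function.Injective (contactOp a y : E →ₗ[ℝ] E →L[ℝ] ℝ) :=
      (injective_iff_map_eq_zero _).2 hinj
    have hfr : Module.finrank ℝ E = Module.finrank ℝ (E →L[ℝ] ℝ) := by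
      rw [← (LinearMap.toContinuousLinearMap (𝕜 := ℝ) (E := E) (F' := ℝ)).finrank_eq]
      exact (Subspace.dual_finrank_eq).symm
    exact ⟨(LinearEquiv.ofInjectiveOfFinrankEq (contactOp a y : E →ₗ[ℝ] E →L[ℝ] ℝ) hi
      hfr).toContinuousLinearEquiv, by ext; rfl⟩
  have hR : contactOp a y (reeb a y) = a y := hinv.self_apply_inverse _
  have hRne : a y (reeb a y) ≠ 0 := by
    intro h0
    have h1 : reeb a y = 0 := by
      refine hnd _ h0 fun v hv => ?_
      have := DFunLike.congr_fun hR v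
      rwa [contactOp_apply, h0, zero_mul, zero_add, hv] at this
    rw [h1, map_zero] at hR
    exact hne hR.symm
  have h1 : ∀ᶠ z in 𝓝 y, (contactOp a z).IsInvertible := by
    obtain ⟨e, he⟩ := hinv
    have h2 := ContinuousLinearEquiv.nhds e
    rw [he] at h2
    exact (contDiffAt_contactOp hay).continuousAt h2
  have h2 : ∀ᶠ z in 𝓝 y, a z (reeb a z) ≠ 0 :=
    (hay.continuousAt.clm_apply (contDiffAt_reeb hay hinv).continuousAt).eventually_ne hRne
  obtain ⟨V, hV, hVo, hyV⟩ := _root_.eventually_nhds_iff.1 ((h1.and h2).and (hU.mem_nhds hy))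
  exact ⟨V, fun z hz => (hV z hz).2, hyV, hVo, ha.mono fun z hz => (hV z hz).2,
    fun z hz => (hV z hz).1.1, fun z hz => (hV z hz).1.2⟩

namespace IsContactOn

variable (h : IsContactOn a V)

include h

theorem contDiffAt (hy : y ∈ V) : ContDiffAt ℝ ∞ a y :=
  h.contDiffOn.contDiffAt (h.isOpen.mem_nhds hy)

theorem apply_reeb (hy : y ∈ V) : a y (reeb a y) = 1 := by
  have := DFunLike.congr_fun ((h.isInvertible y hy).self_apply_inverse (a y)) (reeb a y)
  change contactOp a y (reeb a y) (reeb a y) = _ at this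
  rw [contactOp_apply, formDeriv_apply, sub_self, add_zero] at this
  exact mul_right_cancel₀ (h.reeb_ne y hy) (by rw [this, one_mul])

theorem formDeriv_reeb (hy : y ∈ V) (v : E) : formDeriv a y (reeb a y) v = 0 := by
  have := DFunLike.congr_fun ((h.isInvertible y hy).self_apply_inverse (a y)) v
  change contactOp a y (reeb a y) v = _ at this
  rw [contactOp_apply, h.apply_reeb hy, one_mul] at this
  linarith

theorem contactOp_contactField (H : E → ℝ) (hy : y ∈ V) (v : E) :
    contactOp a y (contactField a H y) v
      = H y * a y v + fderiv ℝ H y (reeb a y) * a y v - fderiv ℝ H y v :=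
  DFunLike.congr_fun ((h.isInvertible y hy).self_apply_inverse _) v

theorem apply_contactField (H : E → ℝ) (hy : y ∈ V) : a y (contactField a H y) = H y := by
  have h1 := h.contactOp_contactField H hy (reeb a y)
  have h2 := h.formDeriv_reeb hy (contactField a H y)
  rw [contactOp_apply, h.apply_reeb hy] at h1
  rw [formDeriv_apply] at h1 h2
  linarith

theorem formDeriv_contactField (H : E → ℝ) (hy : y ∈ V) (v : E) :
    formDeriv a y (contactField a H y) v = fderiv ℝ H y (reeb a y) * a y v - fderiv ℝ H y v := by
  have h1 := h.contactOp_contactField H hy v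
  rw [contactOp_apply, h.apply_contactField H hy] at h1
  linarith

/-- Every vector is a value of a contact vector field: it suffices to prescribe the 1-jet of the
Hamiltonian. -/
theorem contactField_eq (H : E → ℝ) (hy : y ∈ V) {v : E} (hH : H y = a y v)
    (hdH : ∀ w, fderiv ℝ H y w = -formDeriv a y v w) : contactField a H y = v := by
  refine (h.isInvertible y hy).injective (ContinuousLinearMap.ext fun w => ?_)
  have h2 := h.formDeriv_reeb hy v
  rw [h.contactOp_contactField H hy, contactOp_apply, hH, hdH, hdH]
  rw [formDeriv_apply] at h2 ⊢
  linear_combination a y w * h2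

variable {H : E → ℝ}

theorem contDiffAt_contactField [CompleteSpace E] (hH : ContDiff ℝ ∞ H) (hy : y ∈ V) :
    ContDiffAt ℝ ∞ (contactField a H) y := by
  have ha := h.contDiffAt hy
  have hi := h.isInvertible y hy
  have hdH : ContDiffAt ℝ ∞ (fderiv ℝ H) y := hH.contDiffAt.fderiv_right (by simp)
  exact (hi.contDiffAt_map_inverse.comp y (contDiffAt_contactOp ha)).clm_apply
    (((hH.contDiffAt.smul ha).add
      ((hdH.clm_apply (contDiffAt_reeb ha hi)).smul ha)).sub hdH)

omit h in
theorem eventually_zero_of_notMem_tsupport (hy : y ∉ tsupport H) :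
    ∀ᶠ z in 𝓝 y, H z = 0 ∧ fderiv ℝ H z = 0 := by
  have h1 : H =ᶠ[𝓝 y] fun _ => 0 := notMem_tsupport_iff_eventuallyEq.1 hy
  have h2 : fderiv ℝ H =ᶠ[𝓝 y] fderiv ℝ (fun _ => (0 : ℝ)) := h1.fderiv
  filter_upwards [h1, h2] with z hz hz2
  exact ⟨hz, by rw [hz2, fderiv_fun_const]; rfl⟩

omit h in
theorem contactField_eq_zero (hy : y ∉ tsupport H) : contactField a H y = 0 := by
  obtain ⟨h1, h2⟩ := (eventually_zero_of_notMem_tsupport hy).self_of_nhds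
  simp [contactField, h1, h2]

theorem contDiff_contactField [CompleteSpace E] (hH : ContDiff ℝ ∞ H) (hs : tsupport H ⊆ V) :
    ContDiff ℝ ∞ (contactField a H) := by
  rw [contDiff_iff_contDiffAt]
  intro y
  by_cases hy : y ∈ tsupport H
  · exact h.contDiffAt_contactField hH (hs hy)
  · refine contDiffAt_const (c := (0 : E)) |>.congr_of_eventuallyEq ?_
    filter_upwards [(isClosed_tsupport H).isOpen_compl.mem_nhds hy] with z hz
    exact contactField_eq_zero hz

/-- The conformal rate `dH(R)`, by which the contact vector field of `H` scales `a`, is smooth. -/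
theorem contDiff_rate [CompleteSpace E] (hH : ContDiff ℝ ∞ H) (hs : tsupport H ⊆ V) :
    ContDiff ℝ ∞ (fun y => fderiv ℝ H y (reeb a y)) := by
  rw [contDiff_iff_contDiffAt]
  intro y
  by_cases hy : y ∈ tsupport H
  · exact (hH.contDiffAt.fderiv_right (by simp)).clm_apply
      (contDiffAt_reeb (h.contDiffAt (hs hy)) (h.isInvertible y (hs hy)))
  · refine contDiffAt_const (c := (0 : ℝ)) |>.congr_of_eventuallyEq ?_
    filter_upwards [eventually_zero_of_notMem_tsupport hy] with z hz
    simp [hz.2]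

/-- Cartan's formula for the Lie derivative, `L_X a = da(X, ·) + d(a(X)) = dH(R) a`. -/
theorem lieDeriv_contactField [CompleteSpace E] (hH : ContDiff ℝ ∞ H) (hy : y ∈ V) (v : E) :
    fderiv ℝ a y (contactField a H y) v + a y (fderiv ℝ (contactField a H) y v)
      = fderiv ℝ H y (reeb a y) * a y v := by
  have h1 : HasFDerivAt (fun z => a z (contactField a H z)) _ y :=
    ((h.contDiffAt hy).differentiableAt (by simp)).hasFDerivAt.clm_apply
      ((h.contDiffAt_contactField hH hy).differentiableAt (by simp)).hasFDerivAt
  have h2 : (fun z => a z (contactField a H z)) =ᶠ[𝓝 y] H := by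
    filter_upwards [h.isOpen.mem_nhds hy] with z hz
    exact h.apply_contactField H hz
  have h3 := h1.fderiv
  rw [h2.fderiv_eq] at h3
  have h4 := DFunLike.congr_fun h3 v
  simp only [add_apply, ContinuousLinearMap.comp_apply,
    ContinuousLinearMap.flip_apply] at h4
  have h5 := h.formDeriv_contactField H hy v
  rw [formDeriv_apply] at h5
  linarith

end IsContactOn

/-- The flow of a compactly supported contact vector field scales `a`. -/
theorem form_fderiv_localFlow [CompleteSpace E] (h : IsContactOn a V) {H : E → ℝ}
    (hH : ContDiff ℝ ∞ H) {X : C(E, E)} (hXH : ∀ y, X y = contactField a H y)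
    (hX : ContDiff ℝ ∞ X) (hL : LipschitzWith (1 / 4) X) {μ : C(E, ℝ)}
    (hμH : ∀ y, μ y = fderiv ℝ H y (reeb a y)) {y : E}
    (hV : ∀ t, |t| < 2 → localFlow X t y ∈ V) (v : E) {t : ℝ} (ht : |t| < 2) :
    a (localFlow X t y) (fderiv ℝ (localFlow X t) y v)
      = Real.exp (∫ r in (0 : ℝ)..t, μ (localFlow X r y)) * a y v := by
  set Ψ : ℝ × E → E := fun p => localFlow X p.1 p.2 with hΨ
  set g : ℝ → ℝ := fun t => ∫ r in (0 : ℝ)..t, μ (localFlow X r y) with hg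
  have hsm : ∀ p : ℝ × E, |p.1| < 2 → ContDiffAt ℝ ∞ Ψ p := fun p hp =>
    contDiffAt_localFlow hX hL hp
  have hslice : ∀ s, |s| < 2 → ∀ z w, fderiv ℝ (localFlow X s) z w = fderiv ℝ Ψ (s, z) (0, w) := by
    intro s hs z w
    have h1 : HasFDerivAt (localFlow X s)
        (fderiv ℝ Ψ (s, z) ∘L ContinuousLinearMap.inr ℝ ℝ E) z :=
      HasFDerivAt.comp (f := fun z : E => ((s, z) : ℝ × E)) z
        ((hsm (s, z) hs).differentiableAt (by simp)).hasFDerivAt (hasFDerivAt_prodMk_right s z)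
    rw [h1.fderiv]
    rfl
  have htime : ∀ q : ℝ × E, |q.1| < 2 → fderiv ℝ Ψ q (1, 0) = X (Ψ q) := by
    intro q hq
    have h1 : HasDerivAt (fun s => Ψ (s, q.2)) (fderiv ℝ Ψ q (1, 0)) q.1 :=
      HasFDerivAt.comp_hasDerivAt (f := fun s : ℝ => ((s, q.2) : ℝ × E)) q.1
        ((hsm q hq).differentiableAt (by simp)).hasFDerivAt
        ((hasDerivAt_id q.1).prodMk (hasDerivAt_const q.1 q.2))
    exact h1.unique (hasDerivAt_localFlow hX hL hq q.2)
  -- the derivative of the flow solves the variational equation, by symmetry of second derivatives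
  have hvar : ∀ s, |s| < 2 → HasDerivAt (fun s => fderiv ℝ Ψ (s, y) (0, v))
      (fderiv ℝ X (Ψ (s, y)) (fderiv ℝ Ψ (s, y) (0, v))) s := by
    intro s hs
    have hp := hsm (s, y) hs
    have hd2 : DifferentiableAt ℝ (fderiv ℝ Ψ) (s, y) :=
      (hp.fderiv_right (m := ∞) (by simp)).differentiableAt (by simp)
    have h1 : HasDerivAt (fun r : ℝ => fderiv ℝ Ψ (r, y))
        (fderiv ℝ (fderiv ℝ Ψ) (s, y) (1, 0)) s :=
      HasFDerivAt.comp_hasDerivAt (f := fun r : ℝ => ((r, y) : ℝ × E)) s hd2.hasFDerivAt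
        ((hasDerivAt_id s).prodMk (hasDerivAt_const s y))
    have h2 : HasDerivAt (fun r : ℝ => fderiv ℝ Ψ (r, y) (0, v))
        (fderiv ℝ (fderiv ℝ Ψ) (s, y) (1, 0) (0, v)) s := by
      simpa using h1.clm_apply (hasDerivAt_const s ((0, v) : ℝ × E))
    have hsymm : fderiv ℝ (fderiv ℝ Ψ) (s, y) (1, 0) (0, v)
        = fderiv ℝ (fderiv ℝ Ψ) (s, y) (0, v) (1, 0) :=
      (hp.isSymmSndFDerivAt
        (by rw [minSmoothness_of_isRCLikeNormedField]; exact ENat.LEInfty.out)).eq _ _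
    have h3 : fderiv ℝ (fun q => fderiv ℝ Ψ q (1, 0)) (s, y) (0, v)
        = fderiv ℝ (fderiv ℝ Ψ) (s, y) (0, v) (1, 0) := by
      rw [fderiv_clm_apply hd2 (differentiableAt_const _)]
      simp
    have h4 : (fun q => fderiv ℝ Ψ q (1, 0)) =ᶠ[nhds (s, y)] fun q => X (Ψ q) := by
      have : ∀ᶠ q : ℝ × E in nhds (s, y), |q.1| < 2 :=
        (continuous_fst.abs.continuousAt).eventually_lt continuousAt_const hs
      filter_upwards [this] with q hq using htime q hq
    have h5 : HasFDerivAt (fun q => X (Ψ q)) (fderiv ℝ X (Ψ (s, y)) ∘L fderiv ℝ Ψ (s, y)) (s, y) :=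
      (hX.differentiable (by simp) _).hasFDerivAt.comp _
        (hp.differentiableAt (by simp)).hasFDerivAt
    rw [h4.fderiv_eq, h5.fderiv] at h3
    rw [hsymm, ← h3] at h2
    exact h2
  have hw : ∀ s, |s| < 2 → HasDerivAt (fun s => a (Ψ (s, y)) (fderiv ℝ Ψ (s, y) (0, v)))
      (μ (Ψ (s, y)) * a (Ψ (s, y)) (fderiv ℝ Ψ (s, y) (0, v))) s := by
    intro s hs
    have h1 : HasDerivAt (fun s => a (Ψ (s, y))) (fderiv ℝ a (Ψ (s, y)) (X (Ψ (s, y)))) s :=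
      HasFDerivAt.comp_hasDerivAt (f := fun s : ℝ => Ψ (s, y)) s
        ((h.contDiffAt (hV s hs)).differentiableAt (by simp)).hasFDerivAt
        (hasDerivAt_localFlow hX hL hs y)
    have h2 := h1.clm_apply (hvar s hs)
    have h3 := h.lieDeriv_contactField hH (hV s hs) (fderiv ℝ Ψ (s, y) (0, v))
    have hXf : (X : E → E) = contactField a H := funext hXH
    rw [hμH]
    rw [← hXf] at h3
    rwa [← h3]
  have hgd : ∀ s, |s| < 2 → HasDerivAt g (μ (Ψ (s, y))) s := fun s hs =>
    hasDerivAt_integral_localFlow hX hL μ.continuous hs y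
  have hu : ∀ s ∈ ball (0 : ℝ) 2,
      HasDerivAt (fun s => Real.exp (-g s) * a (Ψ (s, y)) (fderiv ℝ Ψ (s, y) (0, v))) 0 s := by
    intro s hs
    have hs : |s| < 2 := by simpa using hs
    convert! (hgd s hs).neg.exp.mul (hw s hs) using 1
    ring
  have hconst := (convex_ball (0 : ℝ) 2).is_const_of_fderivWithin_eq_zero (𝕜 := ℝ)
    (f := fun s => Real.exp (-g s) * a (Ψ (s, y)) (fderiv ℝ Ψ (s, y) (0, v)))
    (fun s hs => (hu s hs).differentiableAt.differentiableWithinAt)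
    (fun s hs => by
      have h1 := (hu s hs).hasFDerivAt.hasFDerivWithinAt.fderivWithin (s := ball (0 : ℝ) 2)
        (isOpen_ball.uniqueDiffWithinAt hs)
      rw [h1]
      ext
      simp)
    (show t ∈ ball (0 : ℝ) 2 by simpa using ht) (mem_ball_self two_pos)
  have h0 : fderiv ℝ Ψ (0, y) (0, v) = v := by
    rw [← hslice 0 (by simp), show localFlow X 0 = id from funext (localFlow_zero hL), fderiv_id]
    rfl
  have hg0 : g 0 = 0 := intervalIntegral.integral_same
  have hΨ0 : Ψ (0, y) = y := localFlow_zero hL y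
  rw [h0, hg0, hΨ0, neg_zero, Real.exp_zero, one_mul] at hconst
  rw [hslice t ht, ← hconst, ← mul_assoc, ← Real.exp_add, add_neg_cancel, Real.exp_zero, one_mul]

theorem contactField_const_smul {H : E → ℝ} (hH : ContDiff ℝ ∞ H) (c : ℝ) (y : E) :
    contactField a (fun z => c * H z) y = c • contactField a H y := by
  have h1 : fderiv ℝ (fun z => c * H z) y = c • fderiv ℝ H y :=
    fderiv_const_mul (hH.differentiable (by simp) y) c
  rw [contactField, contactField, h1, ← map_smul]
  congr 1
  simp only [smul_apply, smul_sub, smul_add, smul_smul, smul_eq_mul]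

/-- The flow of the contact vector field of a compactly supported Hamiltonian `H` on a contact
domain, run at a speed `c` for which it exists as a smooth map on `(-2, 2) × E`. -/
structure IsContactFlow (a : E → E →L[ℝ] ℝ) (V : Set E) (H : E → ℝ) (c : ℝ) (Φ : ℝ → E → E)
    (g : ℝ → E → ℝ) : Prop where
  pos : 0 < c
  contDiffAt : ∀ p : ℝ × E, |p.1| < 2 → ContDiffAt ℝ ∞ (fun p : ℝ × E => Φ p.1 p.2) p
  contDiffAt_factor : ∀ p : ℝ × E, |p.1| < 2 → ContDiffAt ℝ ∞ (fun p : ℝ × E => g p.1 p.2) p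
  map_zero : ∀ y, Φ 0 y = y
  neg_apply : ∀ t, |t| < 2 → ∀ y, Φ (-t) (Φ t y) = y
  eq_self : ∀ t, |t| < 2 → ∀ y ∉ tsupport H, Φ t y = y
  factor_eq_zero : ∀ t, |t| < 2 → ∀ y ∉ tsupport H, g t y = 0
  mem : ∀ t, |t| < 2 → ∀ y ∈ V, Φ t y ∈ V
  hasDerivAt : ∀ t, |t| < 2 → ∀ y,
    HasDerivAt (fun t => Φ t y) (c • contactField a H (Φ t y)) t
  form_fderiv : ∀ t, |t| < 2 → ∀ y ∈ V, ∀ v,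
    a (Φ t y) (fderiv ℝ (Φ t) y v) = Real.exp (g t y) * a y v

theorem exists_isContactFlow [CompleteSpace E] (h : IsContactOn a V) {H : E → ℝ}
    (hH : ContDiff ℝ ∞ H) (hc : HasCompactSupport H) (hs : tsupport H ⊆ V) :
    ∃ c Φ g, IsContactFlow a V H c Φ g := by
  have hX0 : ContDiff ℝ ∞ (contactField a H) := h.contDiff_contactField hH hs
  have hXc : HasCompactSupport (contactField a H) :=
    hc.mono' fun y hy => by
      by_contra hy2
      exact hy (IsContactOn.contactField_eq_zero hy2)
  obtain ⟨C, hC⟩ := ContDiff.lipschitzWith_of_hasCompactSupport hXc hX0 (by simp)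
  set c : ℝ := 1 / (4 * (C + 1)) with hcdef
  have hcpos : 0 < c := by positivity
  set H' : E → ℝ := fun z => c * H z with hH'
  have hH's : ContDiff ℝ ∞ H' := contDiff_const.mul hH
  have hsub : tsupport H' ⊆ tsupport H := closure_mono fun z hz => by
    rw [Function.mem_support] at hz ⊢
    exact right_ne_zero_of_mul hz
  have hX : ContDiff ℝ ∞ (contactField a H') := h.contDiff_contactField hH's (hsub.trans hs)
  have hL : LipschitzWith (1 / 4) (contactField a H') := by
    have h1 : contactField a H' = fun y => c • contactField a H y :=
      funext fun y => contactField_const_smul hH c y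
    rw [h1]
    refine ((lipschitzWith_smul c).comp hC).weaken ?_
    rw [← NNReal.coe_le_coe]
    push_cast
    rw [Real.norm_eq_abs, abs_of_pos hcpos, hcdef]
    have : (0 : ℝ) ≤ C := C.2
    rw [div_mul_eq_mul_div, one_mul, div_le_div_iff₀ (by positivity) (by positivity)]
    linarith
  have hμ := h.contDiff_rate hH's (hsub.trans hs)
  let X : C(E, E) := ⟨contactField a H', hX.continuous⟩
  let μ : C(E, ℝ) := ⟨_, hμ.continuous⟩
  have hXz : ∀ y, y ∉ tsupport H → X y = 0 := fun y hy =>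
    IsContactOn.contactField_eq_zero fun hy2 => hy (hsub hy2)
  have hself : ∀ t, |t| < 2 → ∀ y ∉ tsupport H, localFlow X t y = y := fun t ht y hy =>
    localFlow_eq_self hL ht (hXz y hy)
  have hmem : ∀ t, |t| < 2 → ∀ y ∈ V, localFlow X t y ∈ V := by
    intro t ht y hy
    by_contra hn
    -- a flow line cannot reach the fixed points outside the support
    have h1 := hself (-t) (by rwa [abs_neg]) _ (fun hz => hn (hs hz))
    rw [localFlow_neg_localFlow hX hL ht] at h1
    exact hn (h1 ▸ hy)
  refine ⟨c, localFlow X, fun t y => ∫ r in (0 : ℝ)..t, μ (localFlow X r y), hcpos,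
    fun p hp => contDiffAt_localFlow hX hL hp,
    fun p hp => contDiffAt_integral_localFlow hX hL hμ hp, localFlow_zero hL,
    fun t ht y => localFlow_neg_localFlow hX hL ht y, hself, ?_, hmem, ?_, ?_⟩
  · intro t ht y hy
    rw [intervalIntegral.integral_congr (g := fun _ => (0 : ℝ)), intervalIntegral.integral_zero]
    intro r hr
    have hr2 : |r| < 2 := by
      have h0 : (0 : ℝ) ∈ Ioo (-2 : ℝ) 2 := by norm_num
      exact abs_lt.2 (ordConnected_Ioo.uIcc_subset h0 (abs_lt.1 ht) hr)
    change μ (localFlow X r y) = 0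
    rw [hself r hr2 y hy]
    change fderiv ℝ H' y _ = 0
    rw [(IsContactOn.eventually_zero_of_notMem_tsupport
      (fun hy2 => hy (hsub hy2))).self_of_nhds.2]
    rfl
  · intro t ht y
    rw [← contactField_const_smul hH]
    exact hasDerivAt_localFlow (X := X) hX hL ht y
  · intro t ht y hy v
    exact form_fderiv_localFlow h hH's (fun _ => rfl) hX hL (μ := μ) (fun _ => rfl)
      (fun s hs => hmem s hs y hy) v ht

end LocalContact

/-! ### Hamiltonians of families of contactomorphisms -/

section Hamiltonian

variable {n : ℕ} {M : Type*} [TopologicalSpace M] [ChartedSpace (Model n) M]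

theorem uniqueMDiffWithinAt_Icc {t : ℝ} (ht : t ∈ Icc (0 : ℝ) 1) :
    UniqueMDiffWithinAt 𝓘(ℝ, ℝ) (Icc (0 : ℝ) 1) t :=
  (uniqueDiffOn_Icc zero_lt_one t ht).uniqueMDiffWithinAt

theorem uniqueMDiffOn_cylinder [IsManifold (𝓡 (2 * n + 1)) ∞ M] :
    UniqueMDiffOn (𝓘(ℝ, ℝ).prod (𝓡 (2 * n + 1))) (Icc (0 : ℝ) 1 ×ˢ (univ : Set M)) := by
  have h : UniqueMDiffOn 𝓘(ℝ, ℝ) (Icc (0 : ℝ) 1) := fun t ht => uniqueMDiffWithinAt_Icc ht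
  exact h.prod uniqueMDiffOn_univ

section Curves

variable {E' H' N : Type*} [NormedAddCommGroup E'] [NormedSpace ℝ E'] [TopologicalSpace H']
  {J : ModelWithCorners ℝ E' H'} [TopologicalSpace N] [ChartedSpace H' N]
  {F : ℝ × M → N} {t : ℝ} {x : M}
  {F' : TangentSpace (𝓘(ℝ, ℝ).prod (𝓡 (2 * n + 1))) (t, x) →L[ℝ] TangentSpace J (F (t, x))}

/-- The chain rule for a time-dependent map along a curve. -/
theorem hasMFDerivWithinAt_along {c : ℝ → M} (hc : c t = x)
    (hF : HasMFDerivWithinAt (𝓘(ℝ, ℝ).prod (𝓡 (2 * n + 1))) J F (Icc (0 : ℝ) 1 ×ˢ univ) (t, x) F')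
    {c' : ℝ →L[ℝ] Model n}
    (hc' : HasMFDerivWithinAt 𝓘(ℝ, ℝ) (𝓡 (2 * n + 1)) c (Icc (0 : ℝ) 1) t c') :
    HasMFDerivWithinAt 𝓘(ℝ, ℝ) J (fun s => F (s, c s)) (Icc (0 : ℝ) 1) t
      (F'.comp ((ContinuousLinearMap.id ℝ ℝ).prod c')) := by
  subst hc
  have h1 : HasMFDerivWithinAt 𝓘(ℝ, ℝ) (𝓘(ℝ, ℝ).prod (𝓡 (2 * n + 1))) (fun s => (s, c s))
      (Icc (0 : ℝ) 1) t ((ContinuousLinearMap.id ℝ ℝ).prod c') :=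
    (hasMFDerivWithinAt_id _ t).prodMk hc'
  exact HasMFDerivWithinAt.comp (f := fun s : ℝ => (s, c s)) t hF h1
    (fun s hs => ⟨hs, mem_univ _⟩)

theorem hasMFDerivWithinAt_time
    (hF : HasMFDerivWithinAt (𝓘(ℝ, ℝ).prod (𝓡 (2 * n + 1))) J F (Icc (0 : ℝ) 1 ×ˢ univ) (t, x)
      F') :
    HasMFDerivWithinAt 𝓘(ℝ, ℝ) J (fun s => F (s, x)) (Icc (0 : ℝ) 1) t
      (F'.comp ((ContinuousLinearMap.id ℝ ℝ).prod (0 : ℝ →L[ℝ] Model n))) :=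
  hasMFDerivWithinAt_along (c := fun _ => x) rfl hF (hasMFDerivWithinAt_const x _ t)

theorem hasMFDerivAt_space (ht : t ∈ Icc (0 : ℝ) 1)
    (hF : HasMFDerivWithinAt (𝓘(ℝ, ℝ).prod (𝓡 (2 * n + 1))) J F (Icc (0 : ℝ) 1 ×ˢ univ) (t, x)
      F') :
    HasMFDerivAt (𝓡 (2 * n + 1)) J (fun y => F (t, y)) x
      (F'.comp ((0 : Model n →L[ℝ] ℝ).prod (ContinuousLinearMap.id ℝ (Model n)))) := by
  have h1 : HasMFDerivWithinAt (𝓡 (2 * n + 1)) (𝓘(ℝ, ℝ).prod (𝓡 (2 * n + 1))) (fun y => (t, y))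
      univ x ((0 : Model n →L[ℝ] ℝ).prod (ContinuousLinearMap.id ℝ (Model n))) :=
    (hasMFDerivWithinAt_const t _ x).prodMk (hasMFDerivWithinAt_id _ x)
  exact hasMFDerivWithinAt_univ.1 (HasMFDerivWithinAt.comp (f := fun y : M => (t, y)) x hF h1
    (fun s _ => ⟨ht, mem_univ _⟩))

end Curves

variable {α : ∀ x : M, TangentSpace (𝓡 (2 * n + 1)) x →L[ℝ] ℝ}

namespace ContactFamily

/-- The velocity `d/dt φ_t(x)` of a family over `[0,1]`. -/
def vel (φ : ContactFamily α (Icc (0 : ℝ) 1)) (t : ℝ) (x : M) :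
    TangentSpace (𝓡 (2 * n + 1)) (φ.toFun t x) :=
  mfderivWithin 𝓘(ℝ, ℝ) (𝓡 (2 * n + 1)) (fun s : ℝ => φ.toFun s x) (Icc (0 : ℝ) 1) t (1 : ℝ)

/-- The contact Hamiltonian of a family over `[0,1]`, as a function of the time and of the
initial point: `α (d/dt φ_t(x))`. -/
def ham (φ : ContactFamily α (Icc (0 : ℝ) 1)) (t : ℝ) (x : M) : ℝ :=
  α (φ.toFun t x) (φ.vel t x)

variable (φ ψ : ContactFamily α (Icc (0 : ℝ) 1)) {t : ℝ}

theorem hasMFDerivWithinAt (ht : t ∈ Icc (0 : ℝ) 1) (x : M) :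
    HasMFDerivWithinAt (𝓘(ℝ, ℝ).prod (𝓡 (2 * n + 1))) (𝓡 (2 * n + 1))
      (fun z : ℝ × M => φ.toFun z.1 z.2) (Icc (0 : ℝ) 1 ×ˢ univ) (t, x)
      (mfderivWithin (𝓘(ℝ, ℝ).prod (𝓡 (2 * n + 1))) (𝓡 (2 * n + 1))
      (fun z : ℝ × M => φ.toFun z.1 z.2) (Icc (0 : ℝ) 1 ×ˢ univ) (t, x)) :=
  ((φ.smooth_toFun (t, x) ⟨ht, mem_univ _⟩).mdifferentiableWithinAt
    (by simp)).hasMFDerivWithinAt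

theorem vel_eq (ht : t ∈ Icc (0 : ℝ) 1) (x : M) :
    φ.vel t x = mfderivWithin (𝓘(ℝ, ℝ).prod (𝓡 (2 * n + 1))) (𝓡 (2 * n + 1))
      (fun z : ℝ × M => φ.toFun z.1 z.2) (Icc (0 : ℝ) 1 ×ˢ univ) (t, x) ((1 : ℝ), (0 : Model n)) :=
  DFunLike.congr_fun ((hasMFDerivWithinAt_time (φ.hasMFDerivWithinAt ht x)).mfderivWithin
    (uniqueMDiffWithinAt_Icc ht)) (1 : ℝ)

theorem mfderiv_toFun (ht : t ∈ Icc (0 : ℝ) 1) (x : M) (w : Model n) :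
    mfderiv (𝓡 (2 * n + 1)) (𝓡 (2 * n + 1)) (φ.toFun t) x w
      = mfderivWithin (𝓘(ℝ, ℝ).prod (𝓡 (2 * n + 1))) (𝓡 (2 * n + 1))
      (fun z : ℝ × M => φ.toFun z.1 z.2) (Icc (0 : ℝ) 1 ×ˢ univ) (t, x) ((0 : ℝ), w) :=
  DFunLike.congr_fun (hasMFDerivAt_space ht (φ.hasMFDerivWithinAt ht x)).mfderiv w

theorem hasMFDerivWithinAt_curve (ht : t ∈ Icc (0 : ℝ) 1) (x : M) :
    HasMFDerivWithinAt 𝓘(ℝ, ℝ) (𝓡 (2 * n + 1)) (fun s => φ.toFun s x) (Icc (0 : ℝ) 1) t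
      (mfderivWithin 𝓘(ℝ, ℝ) (𝓡 (2 * n + 1)) (fun s : ℝ => φ.toFun s x) (Icc (0 : ℝ) 1) t) :=
  (hasMFDerivWithinAt_time (φ.hasMFDerivWithinAt ht x)).mdifferentiableWithinAt.hasMFDerivWithinAt

/-- The velocity of a composition, `d/dt (φ_t ∘ ψ_t) = (d/dt φ_t) ∘ ψ_t + Dφ_t (d/dt ψ_t)`. -/
theorem vel_mul (ht : t ∈ Icc (0 : ℝ) 1) (x : M) :
    (φ.mul ψ).vel t x = (φ.vel t (ψ.toFun t x)
      + mfderiv (𝓡 (2 * n + 1)) (𝓡 (2 * n + 1)) (φ.toFun t) (ψ.toFun t x) (ψ.vel t x) :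
      Model n) := by
  have h1 := hasMFDerivWithinAt_along (c := fun s => ψ.toFun s x) rfl
    (φ.hasMFDerivWithinAt ht (ψ.toFun t x)) (ψ.hasMFDerivWithinAt_curve ht x)
  have h2 := DFunLike.congr_fun (h1.mfderivWithin (uniqueMDiffWithinAt_Icc ht)) (1 : ℝ)
  refine h2.trans ?_
  let L : ℝ × Model n →L[ℝ] Model n := mfderivWithin (𝓘(ℝ, ℝ).prod (𝓡 (2 * n + 1)))
    (𝓡 (2 * n + 1)) (fun z : ℝ × M => φ.toFun z.1 z.2) (Icc (0 : ℝ) 1 ×ˢ univ) (t, ψ.toFun t x)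
  let w : Model n := ψ.vel t x
  refine Eq.trans ?_ (congrArg₂ (fun a b : Model n => a + b) (φ.vel_eq ht (ψ.toFun t x)).symm
    (φ.mfderiv_toFun ht (ψ.toFun t x) w).symm)
  change L (1, w) = L (1, 0) + L (0, w)
  rw [← L.map_add, Prod.mk_add_mk, add_zero, zero_add]

theorem ham_mul (ht : t ∈ Icc (0 : ℝ) 1) (x : M) :
    (φ.mul ψ).ham t x
      = φ.ham t (ψ.toFun t x) + Real.exp (φ.factor t (ψ.toFun t x)) * ψ.ham t x := by
  have h := congrArg (α (φ.toFun t (ψ.toFun t x))) (φ.vel_mul ψ ht x)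
  refine h.trans (((α (φ.toFun t (ψ.toFun t x))).map_add _ _).trans ?_)
  rw [φ.pullback_eq t ht]
  rfl

theorem ham_eq_zero {φ : ContactFamily α (Icc (0 : ℝ) 1)} {y : M} (ht : t ∈ Icc (0 : ℝ) 1) {x : M}
    (h : ∀ s ∈ Icc (0 : ℝ) 1, φ.toFun s x = y) : φ.ham t x = 0 := by
  have h1 : mfderivWithin 𝓘(ℝ, ℝ) (𝓡 (2 * n + 1)) (fun s : ℝ => φ.toFun s x) (Icc (0 : ℝ) 1) t
      = (0 : ℝ →L[ℝ] Model n) :=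
    (((hasMFDerivWithinAt_const y (Icc (0 : ℝ) 1) t).congr_of_eventuallyEq
      (Filter.eventually_of_mem self_mem_nhdsWithin h) (h t ht)).mfderivWithin
      (uniqueMDiffWithinAt_Icc ht))
  rw [ham, vel]
  refine (congrArg (α (φ.toFun t x)) (DFunLike.congr_fun h1 (1 : ℝ))).trans ?_
  exact (α (φ.toFun t x)).map_zero

theorem ham_inv (ht : t ∈ Icc (0 : ℝ) 1) (x : M) :
    φ.inv.ham t x
      = -(Real.exp (-φ.factor t (φ.invFun t x)) * φ.ham t (φ.invFun t x)) := by
  have h1 := φ.ham_mul φ.inv ht x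
  rw [ham_eq_zero (y := x) ht (fun s hs => φ.right_inv s hs x)] at h1
  change 0 = φ.ham t (φ.invFun t x) + Real.exp (φ.factor t (φ.invFun t x)) * φ.inv.ham t x at h1
  rw [Real.exp_neg]
  have h2 := Real.exp_pos (φ.factor t (φ.invFun t x))
  field_simp
  linarith

/-- Pulling back a family along a smooth map of parameters. -/
def comap {P Q : Type} [NormedAddCommGroup P] [NormedSpace ℝ P] [NormedAddCommGroup Q]
    [NormedSpace ℝ Q] {S : Set P} {T : Set Q} (φ : ContactFamily α S) (u : Q → P)
    (hu : ContDiff ℝ ∞ u) (hm : MapsTo u T S) : ContactFamily α T :=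
  have hc : ContMDiffOn (𝓘(ℝ, Q).prod (𝓡 (2 * n + 1))) (𝓘(ℝ, P).prod (𝓡 (2 * n + 1))) ∞
      (fun z : Q × M => (u z.1, z.2)) (T ×ˢ univ) :=
    ((hu.contMDiff.comp contMDiff_fst).prodMk contMDiff_snd).contMDiffOn
  { toFun := fun q => φ.toFun (u q)
    invFun := fun q => φ.invFun (u q)
    factor := fun q => φ.factor (u q)
    smooth_toFun := φ.smooth_toFun.comp hc (fun _ hz => ⟨hm hz.1, mem_univ _⟩)
    smooth_invFun := φ.smooth_invFun.comp hc (fun _ hz => ⟨hm hz.1, mem_univ _⟩)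
    smooth_factor := φ.smooth_factor.comp hc (fun _ hz => ⟨hm hz.1, mem_univ _⟩)
    left_inv := fun q hq => φ.left_inv (u q) (hm hq)
    right_inv := fun q hq => φ.right_inv (u q) (hm hq)
    pullback_eq := fun q hq => φ.pullback_eq (u q) (hm hq) }

theorem ham_comap {u : ℝ → ℝ} (hu : ContDiff ℝ ∞ u)
    (hm : MapsTo u (Icc (0 : ℝ) 1) (Icc (0 : ℝ) 1)) (ht : t ∈ Icc (0 : ℝ) 1) (x : M) :
    (φ.comap u hu hm).ham t x = deriv u t * φ.ham (u t) x := by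
  have h0 : HasFDerivWithinAt u (ContinuousLinearMap.toSpanSingleton ℝ (deriv u t))
      (Icc (0 : ℝ) 1) t :=
    ((hu.differentiable (by simp) t).hasDerivAt.hasFDerivAt).hasFDerivWithinAt
  have h1 : HasMFDerivWithinAt 𝓘(ℝ, ℝ) 𝓘(ℝ, ℝ) u (Icc (0 : ℝ) 1) t _ :=
    h0.hasMFDerivWithinAt
  have h2 := (HasMFDerivWithinAt.comp (f := u) t (φ.hasMFDerivWithinAt_curve (hm ht) x) h1
    hm).mfderivWithin (uniqueMDiffWithinAt_Icc ht)
  have h3 := DFunLike.congr_fun h2 (1 : ℝ)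
  rw [ham, ham, vel, vel]
  refine (congrArg (α (φ.toFun (u t) x)) h3).trans ?_
  have key : ∀ (A : Model n →L[ℝ] ℝ) (L : ℝ →L[ℝ] Model n) (d : ℝ),
      A (L ((1 : ℝ) • d)) = d * A (L 1) := by
    intro A L d
    rw [one_smul, ← smul_eq_mul d, ← A.map_smul, ← L.map_smul, smul_eq_mul, mul_one]
  exact key _ _ _

section Continuity

variable [IsManifold (𝓡 (2 * n + 1)) ∞ M]

/-- The velocity is continuous as a map to the tangent bundle. -/
theorem continuousOn_vel :
    ContinuousOn (fun z : ℝ × M =>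
      (⟨φ.toFun z.1 z.2, φ.vel z.1 z.2⟩ : TangentBundle (𝓡 (2 * n + 1)) M))
      (Icc (0 : ℝ) 1 ×ˢ univ) := by
  have : IsManifold (𝓡 (2 * n + 1)) 1 M := IsManifold.of_le (n := ∞) (by simp)
  have h1 := φ.smooth_toFun.continuousOn_tangentMapWithin (by simp) uniqueMDiffOn_cylinder
  have h2 : Continuous (fun t : ℝ => (⟨t, (1 : ℝ)⟩ : TangentBundle 𝓘(ℝ, ℝ) ℝ)) :=
    (tangentBundleModelSpaceHomeomorph 𝓘(ℝ, ℝ)).symm.continuous.comp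
      (continuous_id.prodMk continuous_const)
  have h3 : Continuous (fun x : M => (⟨x, 0⟩ : TangentBundle (𝓡 (2 * n + 1)) M)) :=
    (Bundle.contMDiff_zeroSection (n := 0) (IB := 𝓡 (2 * n + 1)) ℝ
      (TangentSpace (𝓡 (2 * n + 1)) : M → Type _)).continuous
  have h4 : Continuous (equivTangentBundleProd 𝓘(ℝ, ℝ) ℝ (𝓡 (2 * n + 1)) M).symm :=
    (contMDiff_equivTangentBundleProd_symm (n := 0)).continuous
  have h5 := h4.comp ((h2.comp continuous_fst).prodMk (h3.comp continuous_snd))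
  refine (h1.comp (h5.continuousOn (s := Icc (0 : ℝ) 1 ×ˢ univ)) fun z hz => hz).congr
    fun z hz => ?_
  exact congrArg (fun v => (⟨φ.toFun z.1 z.2, v⟩ : TangentBundle (𝓡 (2 * n + 1)) M))
    (φ.vel_eq hz.1 z.2)

theorem continuousOn_ham (hα : IsContactForm α) :
    ContinuousOn (fun z : ℝ × M => φ.ham z.1 z.2) (Icc (0 : ℝ) 1 ×ˢ univ) :=
  hα.smooth.continuous.comp_continuousOn φ.continuousOn_vel

end Continuity

end ContactFamily

end Hamiltonian

/-! ### Contact isotopies supported in charts -/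

section Charts

open Topology

variable {n : ℕ} {M : Type*} [TopologicalSpace M] [ChartedSpace (Model n) M]
  (α : ∀ x : M, TangentSpace (𝓡 (2 * n + 1)) x →L[ℝ] ℝ) (x₀ : M)

/-- The expression of the 1-form `α` in the chart at `x₀`. -/
def localForm (y : Model n) : Model n →L[ℝ] ℝ :=
  (α ((extChartAt (𝓡 (2 * n + 1)) x₀).symm y)).comp
    (mfderiv (𝓡 (2 * n + 1)) (𝓡 (2 * n + 1)) (extChartAt (𝓡 (2 * n + 1)) x₀).symm y)

variable {α x₀}

theorem localForm_apply (y w : Model n) :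
    localForm α x₀ y w = α ((extChartAt (𝓡 (2 * n + 1)) x₀).symm y)
      (mfderiv (𝓡 (2 * n + 1)) (𝓡 (2 * n + 1)) (extChartAt (𝓡 (2 * n + 1)) x₀).symm y w) := rfl

variable [IsManifold (𝓡 (2 * n + 1)) ∞ M]

theorem isManifold_one : IsManifold (𝓡 (2 * n + 1)) 1 M := IsManifold.of_le (n := ∞) (by simp)

theorem hasMFDerivAt_extChartAt_symm {y : Model n}
    (hy : y ∈ (extChartAt (𝓡 (2 * n + 1)) x₀).target) :
    HasMFDerivAt (𝓡 (2 * n + 1)) (𝓡 (2 * n + 1)) (extChartAt (𝓡 (2 * n + 1)) x₀).symm y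
      (mfderiv (𝓡 (2 * n + 1)) (𝓡 (2 * n + 1)) (extChartAt (𝓡 (2 * n + 1)) x₀).symm y) :=
  (((contMDiffOn_extChartAt_symm (n := ∞) x₀).contMDiffAt
    ((isOpen_extChartAt_target x₀).mem_nhds hy)).mdifferentiableAt (by simp)).hasMFDerivAt

theorem hasMFDerivAt_extChartAt {x : M} (hx : x ∈ (extChartAt (𝓡 (2 * n + 1)) x₀).source) :
    HasMFDerivAt (𝓡 (2 * n + 1)) (𝓡 (2 * n + 1)) (extChartAt (𝓡 (2 * n + 1)) x₀) x
      (mfderiv (𝓡 (2 * n + 1)) (𝓡 (2 * n + 1)) (extChartAt (𝓡 (2 * n + 1)) x₀) x) := by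
  rw [extChartAt_source] at hx
  exact ((contMDiffAt_extChartAt' (n := ∞) hx).mdifferentiableAt (by simp)).hasMFDerivAt

theorem contDiffOn_localForm (hα : IsContactForm α) :
    ContDiffOn ℝ ∞ (localForm α x₀) (extChartAt (𝓡 (2 * n + 1)) x₀).target := by
  have := isManifold_one (n := n) (M := M)
  set U := (extChartAt (𝓡 (2 * n + 1)) x₀).target with hUdef
  have hU : IsOpen U := isOpen_extChartAt_target x₀
  rw [contDiffOn_clm_apply]
  intro w
  rw [← contMDiffOn_iff_contDiffOn]
  have h1 := (contMDiffOn_extChartAt_symm (I := 𝓡 (2 * n + 1)) (n := ∞)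
    x₀).contMDiffOn_tangentMapWithin (m := ∞) (by simp) hU.uniqueMDiffOn
  have h2 : ContMDiff (𝓡 (2 * n + 1)) (𝓡 (2 * n + 1)).tangent ∞
      (fun y : Model n => (⟨y, w⟩ : TangentBundle (𝓡 (2 * n + 1)) (Model n))) := by
    exact contMDiff_vectorSpace_iff_contDiff.2 contDiff_const
  have h4 := hα.smooth.comp_contMDiffOn (h1.comp (h2.contMDiffOn (s := U)) fun y hy => hy)
  refine h4.congr fun y hy => ?_
  rw [localForm_apply]
  have h5 := mfderivWithin_of_isOpen (I := 𝓡 (2 * n + 1)) (I' := 𝓡 (2 * n + 1))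
    (f := (extChartAt (𝓡 (2 * n + 1)) x₀).symm) hU hy
  exact congrArg (fun L : Model n →L[ℝ] Model n =>
    α ((extChartAt (𝓡 (2 * n + 1)) x₀).symm y) (L w)) h5.symm

theorem localForm_self (v : Model n) :
    localForm α x₀ (extChartAt (𝓡 (2 * n + 1)) x₀ x₀) v = α x₀ v := by
  have := isManifold_one (n := n) (M := M)
  have h1 := mfderivWithin_range_extChartAt_symm (I := 𝓡 (2 * n + 1)) (x := x₀)
  rw [ModelWithCorners.range_eq_univ, mfderivWithin_univ] at h1
  let A : M → Model n → ℝ := fun x v => α x v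
  have h2 : ∀ L : Model n →L[ℝ] Model n, L = ContinuousLinearMap.id ℝ _ →
      A ((extChartAt (𝓡 (2 * n + 1)) x₀).symm (extChartAt (𝓡 (2 * n + 1)) x₀ x₀)) (L v)
        = A x₀ v := by
    rintro L rfl
    rw [extChartAt_to_inv]
    rfl
  exact h2 _ h1

/-- Around each point there is a chart domain on which the local expression of a contact form is a
contact form in the sense of `IsContactOn`. -/
theorem exists_isContactOn_localForm (hα : IsContactForm α) (x₀ : M) :
    ∃ V ⊆ (extChartAt (𝓡 (2 * n + 1)) x₀).target, extChartAt (𝓡 (2 * n + 1)) x₀ x₀ ∈ V ∧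
      IsContactOn (localForm α x₀) V := by
  refine exists_isContactOn (isOpen_extChartAt_target x₀) (contDiffOn_localForm hα)
    (mem_extChartAt_target x₀) (fun h => ?_) fun u hu hv => ?_
  · exact hα.ne_zero x₀ (ContinuousLinearMap.ext fun v =>
      (localForm_self v).symm.trans (DFunLike.congr_fun h v))
  · rw [localForm_self] at hu
    exact hα.nondegenerate x₀ u hu fun v hv2 => hv v ((localForm_self v).trans hv2)

section Extension

open Classical in
/-- The self-map of `M` given by `f` in the chart at `x₀` and by the identity elsewhere. -/
def chartExtend (x₀ : M) (f : Model n → Model n) (x : M) : M :=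
  if x ∈ (extChartAt (𝓡 (2 * n + 1)) x₀).source then
    (extChartAt (𝓡 (2 * n + 1)) x₀).symm (f (extChartAt (𝓡 (2 * n + 1)) x₀ x)) else x

open Classical in
/-- The function on `M` given by `f` in the chart at `x₀` and by zero elsewhere. -/
def chartExtendZero (x₀ : M) (f : Model n → ℝ) (x : M) : ℝ :=
  if x ∈ (extChartAt (𝓡 (2 * n + 1)) x₀).source then f (extChartAt (𝓡 (2 * n + 1)) x₀ x) else 0

omit [IsManifold (𝓡 (2 * n + 1)) ∞ M]

variable {f : Model n → Model n} {x : M} {K : Set (Model n)}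

theorem chartExtend_of_mem (hx : x ∈ (extChartAt (𝓡 (2 * n + 1)) x₀).source) :
    chartExtend x₀ f x
      = (extChartAt (𝓡 (2 * n + 1)) x₀).symm (f (extChartAt (𝓡 (2 * n + 1)) x₀ x)) := if_pos hx

theorem chartExtend_of_notMem (hf : ∀ y ∉ K, f y = y)
    (hx : x ∉ (extChartAt (𝓡 (2 * n + 1)) x₀).symm '' K) : chartExtend x₀ f x = x := by
  by_cases h : x ∈ (extChartAt (𝓡 (2 * n + 1)) x₀).source
  · have h1 := (extChartAt (𝓡 (2 * n + 1)) x₀).left_inv h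
    rw [chartExtend_of_mem h, hf _ fun hK => hx ⟨_, hK, h1⟩, h1]
  · exact if_neg h

theorem chartExtend_chartExtend {g : Model n → Model n}
    (hf : MapsTo f (extChartAt (𝓡 (2 * n + 1)) x₀).target (extChartAt (𝓡 (2 * n + 1)) x₀).target)
    (hgf : ∀ y, g (f y) = y) (x : M) : chartExtend x₀ g (chartExtend x₀ f x) = x := by
  by_cases h : x ∈ (extChartAt (𝓡 (2 * n + 1)) x₀).source
  · have h1 := hf ((extChartAt (𝓡 (2 * n + 1)) x₀).map_source h)
    rw [chartExtend_of_mem h, chartExtend_of_mem ((extChartAt (𝓡 (2 * n + 1)) x₀).map_target h1),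
      (extChartAt (𝓡 (2 * n + 1)) x₀).right_inv h1, hgf,
      (extChartAt (𝓡 (2 * n + 1)) x₀).left_inv h]
  · rw [show chartExtend x₀ f x = x from if_neg h]
    exact if_neg h

theorem chartExtendZero_of_mem {f : Model n → ℝ}
    (hx : x ∈ (extChartAt (𝓡 (2 * n + 1)) x₀).source) :
    chartExtendZero x₀ f x = f (extChartAt (𝓡 (2 * n + 1)) x₀ x) := if_pos hx

theorem chartExtendZero_of_notMem {f : Model n → ℝ} (hf : ∀ y ∉ K, f y = 0)
    (hx : x ∉ (extChartAt (𝓡 (2 * n + 1)) x₀).symm '' K) : chartExtendZero x₀ f x = 0 := by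
  by_cases h : x ∈ (extChartAt (𝓡 (2 * n + 1)) x₀).source
  · rw [chartExtendZero_of_mem h,
      hf _ fun hK => hx ⟨_, hK, (extChartAt (𝓡 (2 * n + 1)) x₀).left_inv h⟩]
  · exact if_neg h

theorem isClosed_image_extChartAt_symm [T2Space M] (hK : IsCompact K)
    (hKt : K ⊆ (extChartAt (𝓡 (2 * n + 1)) x₀).target) :
    IsClosed ((extChartAt (𝓡 (2 * n + 1)) x₀).symm '' K) :=
  (hK.image_of_continuousOn ((continuousOn_extChartAt_symm x₀).mono hKt)).isClosed

variable [IsManifold (𝓡 (2 * n + 1)) ∞ M] [T2Space M]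

theorem contMDiffOn_chartExtend {Φ : ℝ → Model n → Model n} {S : Set ℝ} (hK : IsCompact K)
    (hKt : K ⊆ (extChartAt (𝓡 (2 * n + 1)) x₀).target)
    (hΦ : ∀ p : ℝ × Model n, p.1 ∈ S → ContDiffAt ℝ ∞ (fun p : ℝ × Model n => Φ p.1 p.2) p)
    (hmaps : ∀ t ∈ S, MapsTo (Φ t) (extChartAt (𝓡 (2 * n + 1)) x₀).target
      (extChartAt (𝓡 (2 * n + 1)) x₀).target)
    (hself : ∀ t ∈ S, ∀ y ∉ K, Φ t y = y) :
    ContMDiffOn (𝓘(ℝ, ℝ).prod (𝓡 (2 * n + 1))) (𝓡 (2 * n + 1)) ∞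
      (fun z : ℝ × M => chartExtend x₀ (Φ z.1) z.2) (S ×ˢ univ) := by
  rintro ⟨t, x⟩ ⟨ht, -⟩
  by_cases hx : x ∈ (extChartAt (𝓡 (2 * n + 1)) x₀).source
  · have hx' : x ∈ (chartAt (Model n) x₀).source := by rwa [← extChartAt_source (𝓡 (2 * n + 1))]
    have h1 : ContMDiffAt (𝓘(ℝ, ℝ).prod (𝓡 (2 * n + 1))) 𝓘(ℝ, ℝ × Model n) ∞
        (fun z : ℝ × M => (z.1, extChartAt (𝓡 (2 * n + 1)) x₀ z.2)) (t, x) :=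
      contMDiffAt_fst.prodMk_space
        ((contMDiffAt_extChartAt' (n := ∞) hx').comp (t, x) contMDiffAt_snd)
    have h2 := ((hΦ (t, extChartAt (𝓡 (2 * n + 1)) x₀ x) ht).contMDiffAt).comp (t, x) h1
    have h3 : ContMDiffAt (𝓡 (2 * n + 1)) (𝓡 (2 * n + 1)) ∞
        (extChartAt (𝓡 (2 * n + 1)) x₀).symm (Φ t (extChartAt (𝓡 (2 * n + 1)) x₀ x)) :=
      (contMDiffOn_extChartAt_symm (n := ∞) x₀).contMDiffAt
        ((isOpen_extChartAt_target x₀).mem_nhds (hmaps t ht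
          ((extChartAt (𝓡 (2 * n + 1)) x₀).map_source hx)))
    refine ((h3.comp (t, x) h2).congr_of_eventuallyEq ?_).contMDiffWithinAt
    have h4 : ∀ᶠ z : ℝ × M in 𝓝 (t, x), z.2 ∈ (extChartAt (𝓡 (2 * n + 1)) x₀).source :=
      continuous_snd.continuousAt.eventually_mem ((isOpen_extChartAt_source x₀).mem_nhds hx)
    filter_upwards [h4] with z hz using chartExtend_of_mem hz
  · have hx2 : x ∉ (extChartAt (𝓡 (2 * n + 1)) x₀).symm '' K := by
      rintro ⟨y, hy, rfl⟩
      exact hx ((extChartAt (𝓡 (2 * n + 1)) x₀).map_target (hKt hy))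
    have h4 : ∀ᶠ z : ℝ × M in 𝓝 (t, x), z.2 ∉ (extChartAt (𝓡 (2 * n + 1)) x₀).symm '' K :=
      continuous_snd.continuousAt.eventually_mem
        (IsOpen.mem_nhds (isClosed_image_extChartAt_symm hK hKt).isOpen_compl
          (show (t, x).2 ∈ _ from hx2))
    refine contMDiffWithinAt_snd.congr_of_eventuallyEq_of_mem ?_ ⟨ht, mem_univ _⟩
    filter_upwards [nhdsWithin_le_nhds h4, self_mem_nhdsWithin] with z hz hzS
    exact chartExtend_of_notMem (hself z.1 hzS.1) hz

theorem contMDiffOn_chartExtendZero {g : ℝ → Model n → ℝ} {S : Set ℝ} (hK : IsCompact K)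
    (hKt : K ⊆ (extChartAt (𝓡 (2 * n + 1)) x₀).target)
    (hg : ∀ p : ℝ × Model n, p.1 ∈ S → ContDiffAt ℝ ∞ (fun p : ℝ × Model n => g p.1 p.2) p)
    (hself : ∀ t ∈ S, ∀ y ∉ K, g t y = 0) :
    ContMDiffOn (𝓘(ℝ, ℝ).prod (𝓡 (2 * n + 1))) 𝓘(ℝ, ℝ) ∞
      (fun z : ℝ × M => chartExtendZero x₀ (g z.1) z.2) (S ×ˢ univ) := by
  rintro ⟨t, x⟩ ⟨ht, -⟩
  by_cases hx : x ∈ (extChartAt (𝓡 (2 * n + 1)) x₀).source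
  · have hx' : x ∈ (chartAt (Model n) x₀).source := by rwa [← extChartAt_source (𝓡 (2 * n + 1))]
    have h1 : ContMDiffAt (𝓘(ℝ, ℝ).prod (𝓡 (2 * n + 1))) 𝓘(ℝ, ℝ × Model n) ∞
        (fun z : ℝ × M => (z.1, extChartAt (𝓡 (2 * n + 1)) x₀ z.2)) (t, x) :=
      contMDiffAt_fst.prodMk_space
        ((contMDiffAt_extChartAt' (n := ∞) hx').comp (t, x) contMDiffAt_snd)
    have h2 := ((hg (t, extChartAt (𝓡 (2 * n + 1)) x₀ x) ht).contMDiffAt).comp (t, x) h1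
    refine (h2.congr_of_eventuallyEq ?_).contMDiffWithinAt
    have h4 : ∀ᶠ z : ℝ × M in 𝓝 (t, x), z.2 ∈ (extChartAt (𝓡 (2 * n + 1)) x₀).source :=
      continuous_snd.continuousAt.eventually_mem ((isOpen_extChartAt_source x₀).mem_nhds hx)
    filter_upwards [h4] with z hz using chartExtendZero_of_mem hz
  · have hx2 : x ∉ (extChartAt (𝓡 (2 * n + 1)) x₀).symm '' K := by
      rintro ⟨y, hy, rfl⟩
      exact hx ((extChartAt (𝓡 (2 * n + 1)) x₀).map_target (hKt hy))
    have h4 : ∀ᶠ z : ℝ × M in 𝓝 (t, x), z.2 ∉ (extChartAt (𝓡 (2 * n + 1)) x₀).symm '' K :=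
      continuous_snd.continuousAt.eventually_mem
        (IsOpen.mem_nhds (isClosed_image_extChartAt_symm hK hKt).isOpen_compl
          (show (t, x).2 ∈ _ from hx2))
    refine (contMDiffWithinAt_const (c := (0 : ℝ))).congr_of_eventuallyEq_of_mem ?_
      ⟨ht, mem_univ _⟩
    filter_upwards [nhdsWithin_le_nhds h4, self_mem_nhdsWithin] with z hz hzS
    exact chartExtendZero_of_notMem (hself z.1 hzS.1) hz

end Extension

section LocalIsotopy

variable [T2Space M]

theorem pullback_chartExtend {V K : Set (Model n)} (hK : IsCompact K) (hKV : K ⊆ V)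
    (hVt : V ⊆ (extChartAt (𝓡 (2 * n + 1)) x₀).target) {f : Model n → Model n} {g : Model n → ℝ}
    (hf : ∀ y, DifferentiableAt ℝ f y) (hfV : MapsTo f V V) (hself : ∀ y ∉ K, f y = y)
    (hg : ∀ y ∉ K, g y = 0)
    (hform : ∀ y ∈ V, ∀ v, localForm α x₀ (f y) (fderiv ℝ f y v)
      = Real.exp (g y) * localForm α x₀ y v) (x : M) (v : TangentSpace (𝓡 (2 * n + 1)) x) :
    α (chartExtend x₀ f x)
        (mfderiv (𝓡 (2 * n + 1)) (𝓡 (2 * n + 1)) (chartExtend x₀ f) x v)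
      = Real.exp (chartExtendZero x₀ g x) * α x v := by
  have := isManifold_one (n := n) (M := M)
  let A : M → Model n → ℝ := fun x v => α x v
  by_cases hx : x ∈ (extChartAt (𝓡 (2 * n + 1)) x₀).symm '' K
  · obtain ⟨hxs, hxK⟩ : x ∈ (extChartAt (𝓡 (2 * n + 1)) x₀).source ∧
        extChartAt (𝓡 (2 * n + 1)) x₀ x ∈ K := by
      obtain ⟨y, hy, rfl⟩ := hx
      refine ⟨(extChartAt (𝓡 (2 * n + 1)) x₀).map_target (hVt (hKV hy)), ?_⟩
      rwa [(extChartAt (𝓡 (2 * n + 1)) x₀).right_inv (hVt (hKV hy))]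
    set y := extChartAt (𝓡 (2 * n + 1)) x₀ x with hy
    have h1 := hasMFDerivAt_extChartAt hxs
    have h2 : HasMFDerivAt (𝓡 (2 * n + 1)) (𝓡 (2 * n + 1)) f y (fderiv ℝ f y) :=
      (hf y).hasFDerivAt.hasMFDerivAt
    have h3 := hasMFDerivAt_extChartAt_symm (x₀ := x₀) (hVt (hfV (hKV hxK)))
    have h4 : chartExtend x₀ f =ᶠ[𝓝 x] ((extChartAt (𝓡 (2 * n + 1)) x₀).symm ∘ f) ∘
        extChartAt (𝓡 (2 * n + 1)) x₀ := by
      filter_upwards [(isOpen_extChartAt_source (I := 𝓡 (2 * n + 1)) x₀).mem_nhds hxs] with z hz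
      exact chartExtend_of_mem hz
    have h5 := (((h3.comp y h2).comp x h1).congr_of_eventuallyEq h4).mfderiv
    have h6 := mfderivWithin_extChartAt_symm_comp_mfderiv_extChartAt' (I := 𝓡 (2 * n + 1)) hxs
    rw [ModelWithCorners.range_eq_univ, mfderivWithin_univ] at h6
    let w : Model n := mfderiv (𝓡 (2 * n + 1)) (𝓡 (2 * n + 1)) (extChartAt (𝓡 (2 * n + 1)) x₀) x v
    have h7 : A (chartExtend x₀ f x)
        (mfderiv (𝓡 (2 * n + 1)) (𝓡 (2 * n + 1)) (chartExtend x₀ f) x v)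
        = localForm α x₀ (f y) (fderiv ℝ f y w) := by
      refine (congrArg (A (chartExtend x₀ f x)) (DFunLike.congr_fun h5 v)).trans ?_
      rw [chartExtend_of_mem hxs]
      rfl
    have h8 : localForm α x₀ y w = A x v := by
      refine Eq.trans ?_ (congrArg (A x) (DFunLike.congr_fun h6 v))
      have h9 : (extChartAt (𝓡 (2 * n + 1)) x₀).symm y = x :=
        (extChartAt (𝓡 (2 * n + 1)) x₀).left_inv hxs
      exact congrArg (fun z => A z (mfderiv (𝓡 (2 * n + 1)) (𝓡 (2 * n + 1))
        (extChartAt (𝓡 (2 * n + 1)) x₀).symm y w)) h9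
    refine h7.trans ?_
    rw [hform y (hKV hxK), chartExtendZero_of_mem hxs, h8]
  · have h4 : chartExtend x₀ f =ᶠ[𝓝 x] id := by
      filter_upwards [(isClosed_image_extChartAt_symm hK (hKV.trans hVt)).isOpen_compl.mem_nhds hx]
        with z hz
      exact chartExtend_of_notMem hself hz
    have h5 := ((hasMFDerivAt_id (I := 𝓡 (2 * n + 1)) x).congr_of_eventuallyEq h4).mfderiv
    rw [chartExtendZero_of_notMem hg hx, Real.exp_zero, one_mul]
    refine (congrArg (A (chartExtend x₀ f x)) (DFunLike.congr_fun h5 v)).trans ?_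
    rw [chartExtend_of_notMem hself hx]
    rfl

theorem abs_lt_two_of_mem {t : ℝ} (ht : t ∈ Icc (0 : ℝ) 1) : |t| < 2 := by
  rw [abs_of_nonneg ht.1]
  linarith [ht.2]

variable {V : Set (Model n)} {H : Model n → ℝ} {c : ℝ} {Φ : ℝ → Model n → Model n}
  {g : ℝ → Model n → ℝ}

omit [IsManifold (𝓡 (2 * n + 1)) ∞ M] [T2Space M] in
theorem IsContactFlow.mapsTo_target (hF : IsContactFlow (localForm α x₀) V H c Φ g)
    (hs : tsupport H ⊆ V) (hVt : V ⊆ (extChartAt (𝓡 (2 * n + 1)) x₀).target) {t : ℝ}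
    (ht : |t| < 2) : MapsTo (Φ t) (extChartAt (𝓡 (2 * n + 1)) x₀).target
      (extChartAt (𝓡 (2 * n + 1)) x₀).target := by
  intro y hy
  by_cases hyV : y ∈ V
  · exact hVt (hF.mem t ht y hyV)
  · rwa [hF.eq_self t ht y fun h => hyV (hs h)]

/-- The contact isotopy of `M` defined by a contact flow supported in a chart. -/
def chartIsotopy (hF : IsContactFlow (localForm α x₀) V H c Φ g) (hc : HasCompactSupport H)
    (hs : tsupport H ⊆ V) (hVt : V ⊆ (extChartAt (𝓡 (2 * n + 1)) x₀).target) :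
    ContactIsotopy α where
  family :=
    { toFun := fun t => chartExtend x₀ (Φ t)
      invFun := fun t => chartExtend x₀ (Φ (-t))
      factor := fun t => chartExtendZero x₀ (g t)
      smooth_toFun := contMDiffOn_chartExtend hc (hs.trans hVt)
        (fun p hp => hF.contDiffAt p (abs_lt_two_of_mem hp))
        (fun t ht => hF.mapsTo_target hs hVt (abs_lt_two_of_mem ht))
        (fun t ht => hF.eq_self t (abs_lt_two_of_mem ht))
      smooth_invFun := contMDiffOn_chartExtend (Φ := fun t => Φ (-t)) hc (hs.trans hVt)
        (fun p hp => (hF.contDiffAt (-p.1, p.2) (by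
          rw [abs_neg]
          exact abs_lt_two_of_mem hp)).comp p (f := fun p : ℝ × Model n => (-p.1, p.2))
            (contDiff_fst.neg.prodMk contDiff_snd).contDiffAt)
        (fun t ht => hF.mapsTo_target hs hVt (by rw [abs_neg]; exact abs_lt_two_of_mem ht))
        (fun t ht => hF.eq_self _ (by rw [abs_neg]; exact abs_lt_two_of_mem ht))
      smooth_factor := contMDiffOn_chartExtendZero hc (hs.trans hVt)
        (fun p hp => hF.contDiffAt_factor p (abs_lt_two_of_mem hp))
        (fun t ht => hF.factor_eq_zero t (abs_lt_two_of_mem ht))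
      left_inv := fun t ht => chartExtend_chartExtend
        (hF.mapsTo_target hs hVt (abs_lt_two_of_mem ht)) (hF.neg_apply t (abs_lt_two_of_mem ht))
      right_inv := fun t ht => chartExtend_chartExtend
        (hF.mapsTo_target hs hVt (by rw [abs_neg]; exact abs_lt_two_of_mem ht)) (fun y => by
          have := hF.neg_apply (-t) (by rw [abs_neg]; exact abs_lt_two_of_mem ht) y
          rwa [neg_neg] at this)
      pullback_eq := fun t ht => pullback_chartExtend hc hs hVt
        (fun y => ((hF.contDiffAt (t, y) (abs_lt_two_of_mem ht)).comp y
          (f := fun y : Model n => (t, y))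
          (contDiff_const.prodMk contDiff_id).contDiffAt).differentiableAt (by simp))
        (hF.mem t (abs_lt_two_of_mem ht)) (hF.eq_self t (abs_lt_two_of_mem ht))
        (hF.factor_eq_zero t (abs_lt_two_of_mem ht)) (hF.form_fderiv t (abs_lt_two_of_mem ht)) }
  map_zero := fun x => chartExtend_of_notMem (K := ∅) (fun y _ => hF.map_zero y) (by simp)

theorem chartIsotopy_ham_of_notMem (hF : IsContactFlow (localForm α x₀) V H c Φ g)
    (hc : HasCompactSupport H) (hs : tsupport H ⊆ V)
    (hVt : V ⊆ (extChartAt (𝓡 (2 * n + 1)) x₀).target) {x : M}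
    (hx : x ∉ (extChartAt (𝓡 (2 * n + 1)) x₀).symm '' tsupport H) :
    (chartIsotopy hF hc hs hVt).family.ham 0 x = 0 :=
  ContactFamily.ham_eq_zero ⟨le_rfl, zero_le_one⟩ (y := x) fun t ht =>
    chartExtend_of_notMem (hF.eq_self t (abs_lt_two_of_mem ht)) hx

theorem chartIsotopy_ham (hα : IsContactOn (localForm α x₀) V)
    (hF : IsContactFlow (localForm α x₀) V H c Φ g)
    (hc : HasCompactSupport H) (hs : tsupport H ⊆ V)
    (hVt : V ⊆ (extChartAt (𝓡 (2 * n + 1)) x₀).target) {y : Model n} (hy : y ∈ V) :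
    (chartIsotopy hF hc hs hVt).family.ham 0 ((extChartAt (𝓡 (2 * n + 1)) x₀).symm y)
      = c * H y := by
  let A : M → Model n → ℝ := fun x v => α x v
  have h0 : (0 : ℝ) ∈ Icc (0 : ℝ) 1 := ⟨le_rfl, zero_le_one⟩
  set x := (extChartAt (𝓡 (2 * n + 1)) x₀).symm y with hx
  have hxs : x ∈ (extChartAt (𝓡 (2 * n + 1)) x₀).source :=
    (extChartAt (𝓡 (2 * n + 1)) x₀).map_target (hVt hy)
  have hxy : extChartAt (𝓡 (2 * n + 1)) x₀ x = y :=
    (extChartAt (𝓡 (2 * n + 1)) x₀).right_inv (hVt hy)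
  have h1 : HasMFDerivWithinAt 𝓘(ℝ, ℝ) (𝓡 (2 * n + 1)) (fun t => Φ t y) (Icc (0 : ℝ) 1) 0 _ :=
    (hF.hasDerivAt 0 (by simp) y).hasFDerivAt.hasFDerivWithinAt.hasMFDerivWithinAt
  have h2 := hasMFDerivAt_extChartAt_symm (x₀ := x₀) (hVt (hF.mem 0 (by simp) y hy))
  have h3 := HasMFDerivAt.comp_hasMFDerivWithinAt (f := fun t => Φ t y) (0 : ℝ) h2 h1
  have h4 : ∀ t ∈ Icc (0 : ℝ) 1, (chartIsotopy hF hc hs hVt).family.toFun t x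
      = ((extChartAt (𝓡 (2 * n + 1)) x₀).symm ∘ fun t => Φ t y) t := fun t _ => by
    rw [Function.comp_apply, ← hxy]
    exact chartExtend_of_mem hxs
  have h5 := ((h3.congr_of_eventuallyEq (Filter.eventually_of_mem self_mem_nhdsWithin h4)
    (h4 0 h0)).mfderivWithin (uniqueMDiffWithinAt_Icc h0))
  have h6 := DFunLike.congr_fun h5 (1 : ℝ)
  refine (congrArg (A ((chartIsotopy hF hc hs hVt).family.toFun 0 x)) h6).trans ?_
  rw [h4 0 h0]
  change localForm α x₀ (Φ 0 y) ((1 : ℝ) • (c • contactField (localForm α x₀) H (Φ 0 y))) = _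
  rw [hF.map_zero, one_smul, map_smul, hα.apply_contactField H hy, smul_eq_mul]

/-- Around each point there are contact isotopies that start in a positive direction there and in
no negative direction anywhere. -/
theorem exists_isotopy_ham_pos (hα : IsContactForm α) (x₀ : M) :
    ∃ ψ : ContactIsotopy α, (∀ x, 0 ≤ ψ.family.ham 0 x) ∧ 0 < ψ.family.ham 0 x₀ := by
  obtain ⟨V, hVt, hxV, hV⟩ := exists_isContactOn_localForm hα x₀
  obtain ⟨H, hs, hc, hH, hr, h1⟩ :=
    exists_contDiff_tsupport_subset (n := ⊤) (hV.isOpen.mem_nhds hxV)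
  obtain ⟨c, Φ, g, hF⟩ := exists_isContactFlow hV hH hc hs
  refine ⟨chartIsotopy hF hc hs hVt, fun x => ?_, ?_⟩
  · by_cases hx : x ∈ (extChartAt (𝓡 (2 * n + 1)) x₀).symm '' tsupport H
    · obtain ⟨y, hy, rfl⟩ := hx
      rw [chartIsotopy_ham hV hF hc hs hVt (hs hy)]
      exact mul_nonneg hF.pos.le (hr ⟨y, rfl⟩).1
    · exact (chartIsotopy_ham_of_notMem hF hc hs hVt hx).ge
  · have h2 := chartIsotopy_ham hV hF hc hs hVt hxV
    rw [extChartAt_to_inv, h1, mul_one] at h2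
    rw [h2]
    exact hF.pos

/-- Contact isotopies move the points near `x₀` in every direction. -/
theorem exists_isotopy_direction (hα : IsContactForm α) (x₀ : M) :
    ∃ V ⊆ (extChartAt (𝓡 (2 * n + 1)) x₀).target, IsOpen V ∧
      extChartAt (𝓡 (2 * n + 1)) x₀ x₀ ∈ V ∧ ∀ y ∈ V, ∀ v : Model n,
      ∃ (ψ : ContactIsotopy α) (γ : ℝ → Model n) (c : ℝ), 0 < c ∧ γ 0 = y ∧
        HasDerivAt γ (c • v) 0 ∧
        (∀ t ∈ Icc (0 : ℝ) 1, γ t ∈ V) ∧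
        ∀ t ∈ Icc (0 : ℝ) 1, ψ.family.toFun t ((extChartAt (𝓡 (2 * n + 1)) x₀).symm y)
          = (extChartAt (𝓡 (2 * n + 1)) x₀).symm (γ t) := by
  obtain ⟨V, hVt, hxV, hV⟩ := exists_isContactOn_localForm hα x₀
  refine ⟨V, hVt, hV.isOpen, hxV, fun y hy v => ?_⟩
  obtain ⟨β, hβs, hβc, hβ, hβr, hβ1⟩ :=
    exists_contDiff_tsupport_subset (n := ⊤) (hV.isOpen.mem_nhds hy)
  -- `β` is maximal at `y`, so that multiplication by `β` does not change the 1-jet of `ℓ` there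
  have hdβ : fderiv ℝ β y = 0 := IsLocalMax.fderiv_eq_zero
    (Filter.Eventually.of_forall fun z => hβ1 ▸ (hβr ⟨z, rfl⟩).2)
  let a := localForm α x₀
  let ℓ : Model n → ℝ := fun z => a y v - formDeriv a y v (z - y)
  have hℓ : ContDiff ℝ ∞ ℓ :=
    contDiff_const.sub ((formDeriv a y v).contDiff.comp (contDiff_id.sub contDiff_const))
  have hℓd : HasFDerivAt ℓ (-formDeriv a y v) y := by
    have h1 : HasFDerivAt (fun z => formDeriv a y v (z - y)) (formDeriv a y v) y :=
      HasFDerivAt.comp (f := fun z => z - y) y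
        ((formDeriv a y v).hasFDerivAt (x := y - y)) ((hasFDerivAt_id y).sub_const y)
    exact h1.const_sub (a y v)
  let H : Model n → ℝ := fun z => β z * ℓ z
  have hH : ContDiff ℝ ∞ H := hβ.mul hℓ
  have hsub : tsupport H ⊆ tsupport β := tsupport_mul_subset_left
  have hc : HasCompactSupport H := hβc.mul_right
  obtain ⟨c, Φ, g, hF⟩ := exists_isContactFlow hV hH hc (hsub.trans hβs)
  refine ⟨chartIsotopy hF hc (hsub.trans hβs) hVt, fun t => Φ t y, c, hF.pos, hF.map_zero y, ?_,
    fun t ht => hF.mem t (abs_lt_two_of_mem ht) y hy, fun t ht => ?_⟩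
  · have h1 := hF.hasDerivAt 0 (by simp) y
    rw [hF.map_zero, hV.contactField_eq H hy (v := v)] at h1
    · exact h1
    · change β y * (a y v - formDeriv a y v (y - y)) = a y v
      rw [hβ1, sub_self, map_zero, sub_zero, one_mul]
    · intro w
      have h2 := ((hβ.differentiable (by simp) y).hasFDerivAt.mul hℓd).fderiv
      have h3 : fderiv ℝ H y w = -formDeriv a y v w := by
        refine (DFunLike.congr_fun h2 w).trans ?_
        simp [hβ1, hdβ]
      exact h3
  · have h1 := (extChartAt (𝓡 (2 * n + 1)) x₀).map_target (hVt hy)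
    have h2 := (extChartAt (𝓡 (2 * n + 1)) x₀).right_inv (hVt hy)
    have h3 := chartExtend_of_mem (f := Φ t) h1
    rw [h2] at h3
    exact h3

end LocalIsotopy

end Charts

/-! ### Positive and non-negative classes -/

section Classes

open Topology

variable {n : ℕ} {M : Type*} [TopologicalSpace M] [ChartedSpace (Model n) M]
  {α : ∀ x : M, TangentSpace (𝓡 (2 * n + 1)) x →L[ℝ] ℝ}

theorem add_mul_sub_mem_Icc {a b t : ℝ} (ha : a ∈ Icc (0 : ℝ) 1) (hb : b ∈ Icc (0 : ℝ) 1)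
    (ht : t ∈ Icc (0 : ℝ) 1) : a + t * (b - a) ∈ Icc (0 : ℝ) 1 := by
  have := (convex_Icc (0 : ℝ) 1).add_smul_sub_mem ha hb ht
  rwa [smul_eq_mul] at this

namespace ContactIsotopy

/-- The isotopy `t ↦ ψ_1 ∘ φ_t ∘ ψ_1⁻¹`. -/
def conj (ψ φ : ContactIsotopy α) : ContactIsotopy α where
  family := ((ψ.family.comap (T := Icc (0 : ℝ) 1) (fun _ : ℝ => (1 : ℝ)) contDiff_const
    (fun _ _ => right_mem_Icc.2 zero_le_one)).mul φ.family).mul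
      (ψ.family.comap (fun _ : ℝ => (1 : ℝ)) contDiff_const
        (fun _ _ => right_mem_Icc.2 zero_le_one)).inv
  map_zero x := by
    change ψ.family.toFun 1 (φ.family.toFun 0 (ψ.family.invFun 1 x)) = x
    rw [φ.map_zero, ψ.family.right_inv 1 (right_mem_Icc.2 zero_le_one)]

/-- The part of an isotopy between the times `a` and `b`, reparametrized by `[0,1]` and moved to
start at the identity: `t ↦ φ_(a + t (b - a)) ∘ φ_a⁻¹`. -/
def piece (φ : ContactIsotopy α) {a b : ℝ} (ha : a ∈ Icc (0 : ℝ) 1) (hb : b ∈ Icc (0 : ℝ) 1) :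
    ContactIsotopy α where
  family := (φ.family.comap (T := Icc (0 : ℝ) 1) (fun t : ℝ => a + t * (b - a)) (by fun_prop)
    (fun _ ht => add_mul_sub_mem_Icc ha hb ht)).mul
      (φ.family.comap (fun _ : ℝ => a) contDiff_const (fun _ _ => ha)).inv
  map_zero x := by
    change φ.family.toFun (a + 0 * (b - a)) (φ.family.invFun a x) = x
    rw [zero_mul, add_zero, φ.family.right_inv a ha]

theorem piece_toFun (φ : ContactIsotopy α) {a b : ℝ} (ha : a ∈ Icc (0 : ℝ) 1)
    (hb : b ∈ Icc (0 : ℝ) 1) (t : ℝ) (x : M) : (φ.piece ha hb).family.toFun t x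
      = φ.family.toFun (a + t * (b - a)) (φ.family.invFun a x) := rfl

theorem invFun_zero (φ : ContactIsotopy α) (x : M) : φ.family.invFun 0 x = x := by
  have h := φ.family.left_inv 0 (left_mem_Icc.2 zero_le_one) x
  rwa [φ.map_zero] at h

theorem ham_conj (ψ φ : ContactIsotopy α) {t : ℝ} (ht : t ∈ Icc (0 : ℝ) 1) (x : M) :
    (conj ψ φ).family.ham t x
      = Real.exp (ψ.family.factor 1 (φ.family.toFun t (ψ.family.invFun 1 x)))
        * φ.family.ham t (ψ.family.invFun 1 x) := by
  refine (ContactFamily.ham_mul _ _ ht x).trans ?_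
  rw [ContactFamily.ham_eq_zero (y := ψ.family.invFun 1 x) (x := x) ht (fun _ _ => rfl), mul_zero,
    add_zero]
  refine (ContactFamily.ham_mul _ _ ht _).trans ?_
  rw [ContactFamily.ham_eq_zero
    (y := ψ.family.toFun 1 (φ.family.toFun t (ψ.family.invFun 1 x))) ht, zero_add]
  · rfl
  · exact fun _ _ => rfl

theorem ham_piece (φ : ContactIsotopy α) {a b : ℝ} (ha : a ∈ Icc (0 : ℝ) 1)
    (hb : b ∈ Icc (0 : ℝ) 1) {t : ℝ} (ht : t ∈ Icc (0 : ℝ) 1) (x : M) :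
    (φ.piece ha hb).family.ham t x
      = (b - a) * φ.family.ham (a + t * (b - a)) (φ.family.invFun a x) := by
  refine (ContactFamily.ham_mul _ _ ht x).trans ?_
  rw [ContactFamily.ham_eq_zero (y := φ.family.invFun a x) (x := x) ht (fun _ _ => rfl), mul_zero,
    add_zero]
  refine (ContactFamily.ham_comap φ.family (u := fun t => a + t * (b - a)) (by fun_prop)
    (fun _ ht => add_mul_sub_mem_Icc ha hb ht) ht _).trans ?_
  have h : HasDerivAt (fun t : ℝ => a + t * (b - a)) (b - a) t := by
    simpa using ((hasDerivAt_id t).mul_const (b - a)).const_add a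
  rw [h.deriv]
  rfl

theorem ham_mul_zero (φ ψ : ContactIsotopy α) (x : M) :
    (φ.mul ψ).family.ham 0 x
      = φ.family.ham 0 x + Real.exp (φ.family.factor 0 x) * ψ.family.ham 0 x := by
  refine (ContactFamily.ham_mul _ _ (left_mem_Icc.2 zero_le_one) x).trans ?_
  rw [ψ.map_zero]

end ContactIsotopy

namespace UniversalCover

theorem mk_mul (φ ψ : ContactIsotopy α) : mk (φ.mul ψ) = mk φ * mk ψ := rfl

theorem mk_one : mk (ContactIsotopy.one α) = 1 := rfl

theorem mk_eq_of_eqOn {φ ψ : ContactIsotopy α}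
    (h : ∀ t ∈ Icc (0 : ℝ) 1, ∀ x, φ.family.toFun t x = ψ.family.toFun t x) : mk φ = mk ψ :=
  Quot.sound (homotopic_of_eqOn h)

/-- Conjugating by the time-one map represents conjugation in the universal cover, through
`ψ_u ∘ φ_t ∘ ψ_u⁻¹` with `u = t + s (1 - t)`. -/
theorem mk_conj (ψ φ : ContactIsotopy α) :
    mk (ContactIsotopy.conj ψ φ) = mk ψ * mk φ * (mk ψ)⁻¹ := by
  have h0 : (0 : ℝ) ∈ Icc (0 : ℝ) 1 := left_mem_Icc.2 zero_le_one
  have h1 : (1 : ℝ) ∈ Icc (0 : ℝ) 1 := right_mem_Icc.2 zero_le_one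
  let ψ' : ContactFamily α (Icc (0 : ℝ) 1 ×ˢ Icc (0 : ℝ) 1) :=
    ψ.family.comap (fun p : ℝ × ℝ => p.2 + p.1 * (1 - p.2)) (by fun_prop)
      (fun p hp => add_mul_sub_mem_Icc hp.2 h1 hp.1)
  refine (Quot.sound (r := Homotopic) (a := (ψ.mul φ).mul ψ.inv) (b := ContactIsotopy.conj ψ φ)
    ⟨(ψ'.mul (φ.family.comap (fun p : ℝ × ℝ => p.2) (by fun_prop)
      (fun p hp => hp.2))).mul ψ'.inv, ?_, ?_, ?_, ?_⟩).symm
  · intro t ht x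
    change ψ.family.toFun (t + 0 * (1 - t)) (φ.family.toFun t
      (ψ.family.invFun (t + 0 * (1 - t)) x))
      = ψ.family.toFun t (φ.family.toFun t (ψ.family.invFun t x))
    rw [zero_mul, add_zero]
  · intro t ht x
    change ψ.family.toFun (t + 1 * (1 - t)) (φ.family.toFun t
      (ψ.family.invFun (t + 1 * (1 - t)) x))
      = ψ.family.toFun 1 (φ.family.toFun t (ψ.family.invFun 1 x))
    rw [one_mul, add_sub_cancel]
  · intro s hs x
    change ψ.family.toFun (0 + s * (1 - 0)) (φ.family.toFun 0
      (ψ.family.invFun (0 + s * (1 - 0)) x)) = x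
    rw [φ.map_zero, ψ.family.right_inv _ (add_mul_sub_mem_Icc h0 h1 hs)]
  · intro s hs x
    change ψ.family.toFun (1 + s * (1 - 1)) (φ.family.toFun 1
      (ψ.family.invFun (1 + s * (1 - 1)) x))
      = ψ.family.toFun 1 (φ.family.toFun 1 (ψ.family.invFun 1 x))
    rw [sub_self, mul_zero, add_zero]

/-- Consecutive parts of an isotopy multiply in the universal cover. The homotopy is
`φ_u ∘ φ_v⁻¹ ∘ φ_(a + t (b - a)) ∘ φ_a⁻¹`, where `(u, v)` moves affinely from
`(a + t (c - a), a + t (b - a))` to `(b + t (c - b), b)`. -/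
theorem mk_piece_mul (φ : ContactIsotopy α) {a b c : ℝ} (ha : a ∈ Icc (0 : ℝ) 1)
    (hb : b ∈ Icc (0 : ℝ) 1) (hc : c ∈ Icc (0 : ℝ) 1) :
    mk (φ.piece hb hc) * mk (φ.piece ha hb) = mk (φ.piece ha hc) := by
  let u : ℝ × ℝ → ℝ := fun p =>
    (a + p.2 * (c - a)) + p.1 * ((b + p.2 * (c - b)) - (a + p.2 * (c - a)))
  let v : ℝ × ℝ → ℝ := fun p => (a + p.2 * (b - a)) + p.1 * (b - (a + p.2 * (b - a)))
  have hu : MapsTo u (Icc (0 : ℝ) 1 ×ˢ Icc (0 : ℝ) 1) (Icc (0 : ℝ) 1) := fun p hp =>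
    add_mul_sub_mem_Icc (add_mul_sub_mem_Icc ha hc hp.2) (add_mul_sub_mem_Icc hb hc hp.2) hp.1
  have hv : MapsTo v (Icc (0 : ℝ) 1 ×ˢ Icc (0 : ℝ) 1) (Icc (0 : ℝ) 1) := fun p hp =>
    add_mul_sub_mem_Icc (add_mul_sub_mem_Icc ha hb hp.2) hb hp.1
  refine (Quot.sound (r := Homotopic) (a := φ.piece ha hc)
    (b := (φ.piece hb hc).mul (φ.piece ha hb))
    ⟨((φ.family.comap u (by fun_prop) hu).mul (φ.family.comap v (by fun_prop) hv).inv).mul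
      ((φ.piece ha hb).family.comap (fun p : ℝ × ℝ => p.2) (by fun_prop) (fun p hp => hp.2)),
      ?_, ?_, ?_, ?_⟩).symm
  · intro t ht x
    change φ.family.toFun (u (0, t)) (φ.family.invFun (v (0, t))
      (φ.family.toFun (a + t * (b - a)) (φ.family.invFun a x)))
      = φ.family.toFun (a + t * (c - a)) (φ.family.invFun a x)
    rw [show u (0, t) = a + t * (c - a) by simp [u], show v (0, t) = a + t * (b - a) by simp [v],
      φ.family.left_inv _ (add_mul_sub_mem_Icc ha hb ht)]
  · intro t ht x
    change φ.family.toFun (u (1, t)) (φ.family.invFun (v (1, t))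
      (φ.family.toFun (a + t * (b - a)) (φ.family.invFun a x)))
      = φ.family.toFun (b + t * (c - b)) (φ.family.invFun b
      (φ.family.toFun (a + t * (b - a)) (φ.family.invFun a x)))
    rw [show u (1, t) = b + t * (c - b) by simp [u], show v (1, t) = b by simp [v]]
  · intro s hs x
    have h0 : (0 : ℝ) ∈ Icc (0 : ℝ) 1 := left_mem_Icc.2 zero_le_one
    change φ.family.toFun (u (s, 0)) (φ.family.invFun (v (s, 0))
      ((φ.piece ha hb).family.toFun 0 x)) = x
    rw [(φ.piece ha hb).map_zero, show u (s, 0) = v (s, 0) by simp [u, v],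
      φ.family.right_inv _ (hv (show (s, (0 : ℝ)) ∈ _ from ⟨hs, h0⟩))]
  · intro s hs x
    change φ.family.toFun (u (s, 1)) (φ.family.invFun (v (s, 1))
      (φ.family.toFun (a + 1 * (b - a)) (φ.family.invFun a x)))
      = φ.family.toFun (a + 1 * (c - a)) (φ.family.invFun a x)
    rw [show u (s, 1) = c by simp [u], show v (s, 1) = b by simp [v], one_mul, one_mul,
      add_sub_cancel, add_sub_cancel, φ.family.left_inv b hb]

theorem mk_piece_self (φ : ContactIsotopy α) {a : ℝ} (ha : a ∈ Icc (0 : ℝ) 1) :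
    mk (φ.piece ha ha) = 1 := by
  refine mk_eq_of_eqOn (ψ := ContactIsotopy.one α) fun t _ x => ?_
  change φ.family.toFun (a + t * (a - a)) (φ.family.invFun a x) = x
  rw [sub_self, mul_zero, add_zero, φ.family.right_inv a ha]

theorem mk_piece_zero_one (φ : ContactIsotopy α) :
    mk (φ.piece (left_mem_Icc.2 zero_le_one) (right_mem_Icc.2 zero_le_one)) = mk φ := by
  refine mk_eq_of_eqOn fun t _ x => ?_
  rw [ContactIsotopy.piece_toFun, φ.invFun_zero, sub_zero, mul_one, zero_add]

/-- A submonoid that contains the classes of all short parts of an isotopy contains its class. -/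
theorem mk_mem_of_short_pieces (S : Submonoid (UniversalCover α)) (φ : ContactIsotopy α) {δ : ℝ}
    (hδ : 0 < δ) (h : ∀ (a b : ℝ) (ha : a ∈ Icc (0 : ℝ) 1) (hb : b ∈ Icc (0 : ℝ) 1), a < b →
      b - a < δ → mk (φ.piece ha hb) ∈ S) : mk φ ∈ S := by
  obtain ⟨N, hN⟩ := exists_nat_one_div_lt hδ
  have hN0 : (0 : ℝ) < N + 1 := by positivity
  have h0 : (0 : ℝ) ∈ Icc (0 : ℝ) 1 := left_mem_Icc.2 zero_le_one
  have key : ∀ (k : ℕ) (hk : (k / (N + 1) : ℝ) ∈ Icc (0 : ℝ) 1), mk (φ.piece h0 hk) ∈ S := by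
    intro k
    induction k with
    | zero =>
      intro hk
      have h2 : mk (φ.piece h0 hk) = mk (φ.piece h0 h0) := by
        congr 2
        simp
      rw [h2, mk_piece_self]
      exact S.one_mem
    | succ k ih =>
      intro hk
      have hlt : (k / (N + 1) : ℝ) < ((k + 1 : ℕ) / (N + 1) : ℝ) := by
        push_cast
        gcongr
        linarith
      have hk' : (k / (N + 1) : ℝ) ∈ Icc (0 : ℝ) 1 := ⟨by positivity, hlt.le.trans hk.2⟩
      rw [← mk_piece_mul φ h0 hk' hk]
      refine S.mul_mem (h _ _ hk' hk hlt ?_) (ih hk')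
      refine lt_of_eq_of_lt ?_ hN
      push_cast
      field_simp
      ring
  have h1 : ((N + 1 : ℕ) / (N + 1) : ℝ) = 1 := by
    push_cast
    exact div_self hN0.ne'
  have h2 := key (N + 1) (by rw [h1]; exact right_mem_Icc.2 zero_le_one)
  rw [← mk_piece_zero_one]
  have h3 : ∀ (b : ℝ) (hb : b ∈ Icc (0 : ℝ) 1), b = 1 → mk (φ.piece h0 hb) ∈ S →
      mk (φ.piece h0 (right_mem_Icc.2 zero_le_one)) ∈ S := by
    rintro b hb rfl h
    exact h
  exact h3 _ _ h1 h2

end UniversalCover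

/-- Classes represented by a positive isotopy. -/
def positiveClasses (α : ∀ x : M, TangentSpace (𝓡 (2 * n + 1)) x →L[ℝ] ℝ) :
    Set (UniversalCover α) :=
  {c | ∃ φ : ContactIsotopy α, UniversalCover.mk φ = c ∧ φ.IsPositive}

/-- Classes represented by a non-negative isotopy. -/
def nonnegClasses (α : ∀ x : M, TangentSpace (𝓡 (2 * n + 1)) x →L[ℝ] ℝ) :
    Submonoid (UniversalCover α) where
  carrier := {c | ∃ φ : ContactIsotopy α, UniversalCover.mk φ = c ∧ φ.IsNonneg}
  one_mem' := ⟨ContactIsotopy.one α, rfl, fun t ht x =>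
    (ContactFamily.ham_eq_zero (φ := ContactFamily.one α _) (y := x) ht fun _ _ => rfl).ge⟩
  mul_mem' := by
    rintro _ _ ⟨φ, rfl, hφ⟩ ⟨ψ, rfl, hψ⟩
    refine ⟨φ.mul ψ, rfl, fun t ht x => ?_⟩
    refine le_of_le_of_eq ?_ (φ.family.ham_mul ψ.family ht x).symm
    exact add_nonneg (hφ t ht _) (mul_nonneg (Real.exp_pos _).le (hψ t ht x))

theorem mk_mem_nonnegClasses {φ : ContactIsotopy α} (h : φ.IsNonneg) :
    UniversalCover.mk φ ∈ nonnegClasses α := ⟨φ, rfl, h⟩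

theorem mul_mem_positiveClasses {a b : UniversalCover α} (ha : a ∈ nonnegClasses α)
    (hb : b ∈ positiveClasses α) : a * b ∈ positiveClasses α := by
  obtain ⟨φ, rfl, hφ⟩ := ha
  obtain ⟨ψ, rfl, hψ⟩ := hb
  refine ⟨φ.mul ψ, rfl, fun t ht x => ?_⟩
  refine lt_of_lt_of_eq ?_ (φ.family.ham_mul ψ.family ht x).symm
  exact add_pos_of_nonneg_of_pos (hφ t ht _) (mul_pos (Real.exp_pos _) (hψ t ht x))

theorem mul_mem_positiveClasses' {a b : UniversalCover α} (ha : a ∈ positiveClasses α)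
    (hb : b ∈ nonnegClasses α) : a * b ∈ positiveClasses α := by
  obtain ⟨φ, rfl, hφ⟩ := ha
  obtain ⟨ψ, rfl, hψ⟩ := hb
  refine ⟨φ.mul ψ, rfl, fun t ht x => ?_⟩
  refine lt_of_lt_of_eq ?_ (φ.family.ham_mul ψ.family ht x).symm
  exact add_pos_of_pos_of_nonneg (hφ t ht _) (mul_nonneg (Real.exp_pos _).le (hψ t ht x))

theorem ContactIsotopy.IsNonneg.conj {φ : ContactIsotopy α} (h : φ.IsNonneg)
    (ψ : ContactIsotopy α) : (ContactIsotopy.conj ψ φ).IsNonneg := fun t ht x =>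
  le_of_le_of_eq (mul_nonneg (Real.exp_pos _).le (h t ht _)) (ContactIsotopy.ham_conj ψ φ ht x).symm

theorem conj_mem_nonnegClasses {c : UniversalCover α} (h : c ∈ nonnegClasses α)
    (ψ : ContactIsotopy α) :
    UniversalCover.mk ψ * c * (UniversalCover.mk ψ)⁻¹ ∈ nonnegClasses α := by
  obtain ⟨φ, rfl, hφ⟩ := h
  exact ⟨_, UniversalCover.mk_conj ψ φ, hφ.conj ψ⟩

theorem ContactIsotopy.IsNonneg.piece {φ : ContactIsotopy α} (h : φ.IsNonneg) {a b : ℝ}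
    (ha : a ∈ Icc (0 : ℝ) 1) (hb : b ∈ Icc (0 : ℝ) 1) (hab : a ≤ b) :
    (φ.piece ha hb).IsNonneg := fun _ ht x =>
  le_of_le_of_eq (mul_nonneg (sub_nonneg.2 hab) (h _ (add_mul_sub_mem_Icc ha hb ht) _))
    (φ.ham_piece ha hb ht x).symm

/-! ### Embedded isotopies -/

section Embedded

variable [IsManifold (𝓡 (2 * n + 1)) ∞ M]

/-- An isotopy that is transverse to the contact distribution is embedded once no point returns to
an earlier position with the same conformal factor: the immersion condition is automatic. -/
theorem ContactIsotopy.isEmbedded_of_injective {φ : ContactIsotopy α}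
    (hinj : ∀ t ∈ Icc (0 : ℝ) 1, ∀ s ∈ Icc (0 : ℝ) 1, ∀ q,
      φ.family.toFun t q = φ.family.toFun s q → φ.family.factor t q = φ.family.factor s q → t = s)
    (hham : ∀ t ∈ Icc (0 : ℝ) 1, ∀ q, φ.family.ham t q ≠ 0) : φ.IsEmbedded := by
  refine ⟨?_, ?_⟩
  · rintro ⟨t, q⟩ ⟨ht, -⟩ ⟨s, q'⟩ ⟨hs, -⟩ h
    obtain ⟨h1, h2, h3⟩ : q = q' ∧ φ.family.toFun t q = φ.family.toFun s q' ∧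
        φ.family.factor t q = φ.family.factor s q' := by
      simpa [ContactIsotopy.graphMap, Prod.ext_iff] using h
    subst h1
    rw [hinj t ht s hs q h2 h3]
  · rintro ⟨t, q⟩ ⟨ht, -⟩
    have hu := uniqueMDiffOn_cylinder (n := n) (M := M) (t, q) ⟨ht, mem_univ _⟩
    have h1 := hasMFDerivWithinAt_snd (I := 𝓘(ℝ, ℝ)) (I' := 𝓡 (2 * n + 1))
      (Icc (0 : ℝ) 1 ×ˢ (univ : Set M)) (t, q)
    have h2 := φ.family.hasMFDerivWithinAt ht q
    have h3 := ((φ.family.smooth_factor (t, q) ⟨ht, mem_univ _⟩).mdifferentiableWithinAt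
      (by simp)).hasMFDerivWithinAt
    have h4 := (h1.prodMk (h2.prodMk h3)).mfderivWithin hu
    have key : ∀ w : ℝ × Model n, mfderivWithin (𝓘(ℝ, ℝ).prod (𝓡 (2 * n + 1)))
        ((𝓡 (2 * n + 1)).prod ((𝓡 (2 * n + 1)).prod 𝓘(ℝ, ℝ)))
        φ.graphMap (Icc (0 : ℝ) 1 ×ˢ (univ : Set M)) (t, q) w = 0 → w = 0 := by
      rintro ⟨τ, v⟩ hw
      have h5 := (DFunLike.congr_fun h4 (τ, v)).symm.trans hw
      let L : ℝ × Model n →L[ℝ] Model n := mfderivWithin (𝓘(ℝ, ℝ).prod (𝓡 (2 * n + 1)))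
        (𝓡 (2 * n + 1)) (fun z : ℝ × M => φ.family.toFun z.1 z.2)
        (Icc (0 : ℝ) 1 ×ˢ univ) (t, q)
      have h6 : v = 0 := congrArg Prod.fst h5
      have h7 : L (τ, v) = 0 := congrArg (fun z : Model n × Model n × ℝ => z.2.1) h5
      rw [h6] at h7
      have h8 : L (τ, 0) = τ • (φ.family.vel t q : Model n) := by
        refine Eq.trans ?_ (congrArg (fun z : Model n => τ • z) (φ.family.vel_eq ht q).symm)
        change L (τ, 0) = τ • L (1, 0)
        rw [← L.map_smul]
        simp
      rw [h8] at h7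
      have h9 := congrArg (α (φ.family.toFun t q)) h7
      have h10 : τ * φ.family.ham t q = 0 :=
        ((α (φ.family.toFun t q)).map_smul τ (φ.family.vel t q)).symm.trans
          (h9.trans (α (φ.family.toFun t q)).map_zero)
      rw [h6, (mul_eq_zero.1 h10).resolve_right (hham t ht q)]
      rfl
    intro w w' hww
    have h5 := key (w - w') (((mfderivWithin (𝓘(ℝ, ℝ).prod (𝓡 (2 * n + 1)))
        ((𝓡 (2 * n + 1)).prod ((𝓡 (2 * n + 1)).prod 𝓘(ℝ, ℝ)))
        φ.graphMap (Icc (0 : ℝ) 1 ×ˢ (univ : Set M)) (t, q)).map_sub w w').trans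
          (sub_eq_zero.2 hww))
    exact sub_eq_zero.1 h5

theorem conj_mem_positivePieces {c : UniversalCover α} (h : c ∈ positivePieces α)
    (ψ : ContactIsotopy α) :
    UniversalCover.mk ψ * c * (UniversalCover.mk ψ)⁻¹ ∈ positivePieces α := by
  obtain ⟨φ, rfl, he, hp⟩ := h
  have hpos : (ContactIsotopy.conj ψ φ).IsPositive := fun t ht x =>
    lt_of_lt_of_eq (mul_pos (Real.exp_pos _) (hp t ht _)) (ContactIsotopy.ham_conj ψ φ ht x).symm
  refine ⟨_, UniversalCover.mk_conj ψ φ,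
    ContactIsotopy.isEmbedded_of_injective ?_ fun t ht q => (hpos t ht q).ne', hpos⟩
  intro t ht s hs q h1 h2
  change ψ.family.toFun 1 (φ.family.toFun t (ψ.family.invFun 1 q))
    = ψ.family.toFun 1 (φ.family.toFun s (ψ.family.invFun 1 q)) at h1
  change (ψ.family.factor 1 (φ.family.toFun t (ψ.family.invFun 1 q))
    + φ.family.factor t (ψ.family.invFun 1 q)) + _ = (ψ.family.factor 1 (φ.family.toFun s
      (ψ.family.invFun 1 q)) + φ.family.factor s (ψ.family.invFun 1 q)) + _ at h2
  have h3 := congrArg (ψ.family.invFun 1) h1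
  rw [ψ.family.left_inv 1 (right_mem_Icc.2 zero_le_one),
    ψ.family.left_inv 1 (right_mem_Icc.2 zero_le_one)] at h3
  rw [h3] at h2
  have h4 := add_left_cancel (add_right_cancel h2)
  have h5 : ((t, ψ.family.invFun 1 q) : ℝ × M) = (s, ψ.family.invFun 1 q) :=
    he.1 ⟨ht, mem_univ _⟩ ⟨hs, mem_univ _⟩
      (congrArg₂ (fun (y : M) (r : ℝ) => (ψ.family.invFun 1 q, y, r)) h3 h4)
  exact congrArg Prod.fst h5

theorem ContactIsotopy.IsEmbedded.inv {φ : ContactIsotopy α} (he : φ.IsEmbedded)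
    (hham : ∀ t ∈ Icc (0 : ℝ) 1, ∀ q, φ.family.ham t q ≠ 0) : φ.inv.IsEmbedded := by
  refine ContactIsotopy.isEmbedded_of_injective ?_ fun t ht q => ?_
  · intro t ht s hs q h1 h2
    change φ.family.invFun t q = φ.family.invFun s q at h1
    change -φ.family.factor t (φ.family.invFun t q) = -φ.family.factor s (φ.family.invFun s q) at h2
    have h3 := φ.family.right_inv t ht q
    have h4 := φ.family.right_inv s hs q
    rw [← h1] at h4 h2
    have h5 : ((t, φ.family.invFun t q) : ℝ × M) = (s, φ.family.invFun t q) :=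
      he.1 ⟨ht, mem_univ _⟩ ⟨hs, mem_univ _⟩
        (congrArg₂ (fun (y : M) (r : ℝ) => (φ.family.invFun t q, y, r)) (h3.trans h4.symm)
          (neg_inj.1 h2))
    exact congrArg Prod.fst h5
  · have h1 := φ.family.ham_inv ht q
    change φ.family.inv.ham t q ≠ 0
    rw [h1]
    exact neg_ne_zero.2 (mul_ne_zero (Real.exp_pos _).ne' (hham t ht _))

theorem inv_mem_negativePieces {c : UniversalCover α} (h : c ∈ positivePieces α) :
    c⁻¹ ∈ negativePieces α := by
  obtain ⟨φ, rfl, he, hp⟩ := h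
  refine ⟨φ.inv, rfl, he.inv fun t ht q => (hp t ht q).ne', fun t ht x => ?_⟩
  refine lt_of_eq_of_lt (φ.family.ham_inv ht x) ?_
  exact neg_neg_of_pos (mul_pos (Real.exp_pos _) (hp t ht _))

theorem inv_mem_positivePieces {c : UniversalCover α} (h : c ∈ negativePieces α) :
    c⁻¹ ∈ positivePieces α := by
  obtain ⟨φ, rfl, he, hp⟩ := h
  refine ⟨φ.inv, rfl, he.inv fun t ht q => (hp t ht q).ne, fun t ht x => ?_⟩
  refine lt_of_lt_of_eq ?_ (φ.family.ham_inv ht x).symm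
  exact neg_pos_of_neg (mul_neg_of_pos_of_neg (Real.exp_pos _) (hp t ht _))

theorem conj_mem_negativePieces {c : UniversalCover α} (h : c ∈ negativePieces α)
    (ψ : ContactIsotopy α) :
    UniversalCover.mk ψ * c * (UniversalCover.mk ψ)⁻¹ ∈ negativePieces α := by
  have h1 := inv_mem_negativePieces (conj_mem_positivePieces (inv_mem_positivePieces h) ψ)
  rwa [mul_inv_rev, mul_inv_rev, inv_inv, inv_inv, ← mul_assoc] at h1

end Embedded

end Classes

/-! ### Existence of decompositions -/

section Pieces

open Topology

variable {n : ℕ} {M : Type*} [TopologicalSpace M] [ChartedSpace (Model n) M]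
  {α : ∀ x : M, TangentSpace (𝓡 (2 * n + 1)) x →L[ℝ] ℝ} [IsManifold (𝓡 (2 * n + 1)) ∞ M]

/-- The velocity of a family, in the chart at `z₀`. -/
def ContactFamily.chartVel (φ : ContactFamily α (Icc (0 : ℝ) 1)) (z₀ : M) (t : ℝ) (x : M) :
    Model n :=
  mfderiv (𝓡 (2 * n + 1)) (𝓡 (2 * n + 1)) (extChartAt (𝓡 (2 * n + 1)) z₀) (φ.toFun t x)
    (φ.vel t x)

theorem ContactFamily.hasDerivWithinAt_chart (φ : ContactFamily α (Icc (0 : ℝ) 1)) {z₀ : M} {t : ℝ}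
    (ht : t ∈ Icc (0 : ℝ) 1) {x : M}
    (hx : φ.toFun t x ∈ (extChartAt (𝓡 (2 * n + 1)) z₀).source) :
    HasDerivWithinAt (fun s => extChartAt (𝓡 (2 * n + 1)) z₀ (φ.toFun s x)) (φ.chartVel z₀ t x)
      (Icc (0 : ℝ) 1) t := by
  let L : ℝ →L[ℝ] Model n :=
    (mfderiv (𝓡 (2 * n + 1)) (𝓡 (2 * n + 1)) (extChartAt (𝓡 (2 * n + 1)) z₀) (φ.toFun t x)).comp
    (mfderivWithin 𝓘(ℝ, ℝ) (𝓡 (2 * n + 1)) (fun s : ℝ => φ.toFun s x) (Icc (0 : ℝ) 1) t)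
  have h : HasFDerivWithinAt (fun s => extChartAt (𝓡 (2 * n + 1)) z₀ (φ.toFun s x)) L
      (Icc (0 : ℝ) 1) t :=
    (HasMFDerivAt.comp_hasMFDerivWithinAt (f := fun s => φ.toFun s x) t
      (hasMFDerivAt_extChartAt hx) (φ.hasMFDerivWithinAt_curve ht x)).hasFDerivWithinAt
  exact h.hasDerivWithinAt

theorem ContactFamily.continuousWithinAt_chartVel (φ : ContactFamily α (Icc (0 : ℝ) 1)) {z₀ : M}
    {t : ℝ} (ht : t ∈ Icc (0 : ℝ) 1) {x : M}
    (hx : φ.toFun t x ∈ (extChartAt (𝓡 (2 * n + 1)) z₀).source) :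
    ContinuousWithinAt (fun z : ℝ × M => φ.chartVel z₀ z.1 z.2) (Icc (0 : ℝ) 1 ×ˢ univ) (t, x) := by
  have := isManifold_one (n := n) (M := M)
  let e := trivializationAt (Model n) (TangentSpace (𝓡 (2 * n + 1)) (M := M)) z₀
  have hbase : e.baseSet = (extChartAt (𝓡 (2 * n + 1)) z₀).source := by
    rw [extChartAt_source]
    rfl
  have h1 := φ.continuousOn_vel (t, x) ⟨ht, mem_univ _⟩
  have h2 : (⟨φ.toFun t x, φ.vel t x⟩ : TangentBundle (𝓡 (2 * n + 1)) M) ∈ e.source :=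
    e.mem_source.2 (hbase ▸ hx)
  have h3 : ContinuousWithinAt (fun z : ℝ × M =>
      (e (⟨φ.toFun z.1 z.2, φ.vel z.1 z.2⟩ : TangentBundle (𝓡 (2 * n + 1)) M)).2)
      (Icc (0 : ℝ) 1 ×ˢ univ) (t, x) :=
    continuous_snd.continuousAt.comp_continuousWithinAt
      ((e.continuousAt h2).comp_continuousWithinAt (f := fun z : ℝ × M =>
        (⟨φ.toFun z.1 z.2, φ.vel z.1 z.2⟩ : TangentBundle (𝓡 (2 * n + 1)) M)) h1)
  have h4 : ∀ z : ℝ × M, φ.toFun z.1 z.2 ∈ (extChartAt (𝓡 (2 * n + 1)) z₀).source →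
      φ.chartVel z₀ z.1 z.2
      = (e (⟨φ.toFun z.1 z.2, φ.vel z.1 z.2⟩ : TangentBundle (𝓡 (2 * n + 1)) M)).2 := by
    intro z hz
    have h5 := TangentBundle.continuousLinearMapAt_trivializationAt (I := 𝓡 (2 * n + 1))
      (x₀ := z₀) (x := φ.toFun z.1 z.2) (by rwa [extChartAt_source] at hz)
    refine (DFunLike.congr_fun h5 (φ.vel z.1 z.2)).symm.trans ?_
    exact e.continuousLinearMapAt_apply_of_mem ℝ (hbase.symm.subset hz) _
  refine h3.congr_of_eventuallyEq ?_ (h4 (t, x) hx)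
  have h6 := (φ.smooth_toFun (t, x) ⟨ht, mem_univ _⟩).continuousWithinAt.eventually
    ((isOpen_extChartAt_source (I := 𝓡 (2 * n + 1)) z₀).mem_nhds hx)
  filter_upwards [h6] with z hz using h4 z hz

/-- Locally in space and time, a positive isotopy moves every point along an injective curve. -/
theorem ContactIsotopy.IsPositive.eventually_injective {φ : ContactIsotopy α} (h : φ.IsPositive)
    {t₀ : ℝ} (ht₀ : t₀ ∈ Icc (0 : ℝ) 1) (q₀ : M) :
    ∃ ε > 0, ∀ᶠ q in 𝓝 q₀, ∀ t ∈ Icc (0 : ℝ) 1 ∩ Metric.ball t₀ ε,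
      ∀ s ∈ Icc (0 : ℝ) 1 ∩ Metric.ball t₀ ε,
      φ.family.toFun t q = φ.family.toFun s q → t = s := by
  set z₀ := φ.family.toFun t₀ q₀ with hz₀
  let ℓ : Model n →L[ℝ] ℝ := α z₀
  have hsrc : z₀ ∈ (extChartAt (𝓡 (2 * n + 1)) z₀).source := mem_extChartAt_source z₀
  have h1 : 0 < ℓ (φ.family.chartVel z₀ t₀ q₀) := by
    refine lt_of_lt_of_eq (h t₀ ht₀ q₀) ?_
    have := isManifold_one (n := n) (M := M)
    exact congrArg ℓ (DFunLike.congr_fun (mfderiv_extChartAt_self (I := 𝓡 (2 * n + 1)) (x := z₀))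
      (φ.family.vel t₀ q₀)).symm
  have h2 : ∀ᶠ z in 𝓝[Icc (0 : ℝ) 1 ×ˢ univ] (t₀, q₀),
      φ.family.toFun z.1 z.2 ∈ (extChartAt (𝓡 (2 * n + 1)) z₀).source ∧
      0 < ℓ (φ.family.chartVel z₀ z.1 z.2) := by
    refine ((φ.family.smooth_toFun (t₀, q₀) ⟨ht₀, mem_univ _⟩).continuousWithinAt.eventually
      ((isOpen_extChartAt_source (I := 𝓡 (2 * n + 1)) z₀).mem_nhds hsrc)).and ?_
    exact (ℓ.continuous.continuousAt.comp_continuousWithinAt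
      (φ.family.continuousWithinAt_chartVel ht₀ hsrc)).eventually (lt_mem_nhds h1)
  rw [nhdsWithin_prod_eq, nhdsWithin_univ, Filter.eventually_prod_iff] at h2
  obtain ⟨p, hp, r, hr, hpr⟩ := h2
  obtain ⟨ε, hε, hεp⟩ := Metric.mem_nhdsWithin_iff.1 hp
  refine ⟨ε, hε, ?_⟩
  filter_upwards [hr] with q hq
  have h3 : ∀ t ∈ Icc (0 : ℝ) 1 ∩ Metric.ball t₀ ε,
      HasDerivWithinAt (fun s => ℓ (extChartAt (𝓡 (2 * n + 1)) z₀ (φ.family.toFun s q)))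
      (ℓ (φ.family.chartVel z₀ t q)) (Icc (0 : ℝ) 1) t := fun t ht =>
    ℓ.hasFDerivAt.comp_hasDerivWithinAt t (φ.family.hasDerivWithinAt_chart ht.1
      (hpr (hεp ⟨ht.2, ht.1⟩) hq).1)
  have h4 : StrictMonoOn (fun s => ℓ (extChartAt (𝓡 (2 * n + 1)) z₀ (φ.family.toFun s q)))
      (Icc (0 : ℝ) 1 ∩ Metric.ball t₀ ε) := by
    refine strictMonoOn_of_hasDerivWithinAt_pos ((convex_Icc _ _).inter (convex_ball _ _))
      (fun t ht => ((h3 t ht).mono inter_subset_left).continuousWithinAt)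
      (fun t ht => (h3 t (interior_subset ht)).mono (interior_subset.trans inter_subset_left))
      fun t ht => ?_
    have ht' := interior_subset ht
    exact (hpr (hεp ⟨ht'.2, ht'.1⟩) hq).2
  intro t ht s hs hts
  exact h4.injOn ht hs (by simp only [hts])

theorem ContactIsotopy.IsPositive.exists_injective [CompactSpace M] {φ : ContactIsotopy α}
    (h : φ.IsPositive) : ∃ δ > 0, ∀ t ∈ Icc (0 : ℝ) 1, ∀ s ∈ Icc (0 : ℝ) 1, |s - t| < δ →
      ∀ q, φ.family.toFun t q = φ.family.toFun s q → t = s := by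
  have h1 := (isCompact_Icc (a := (0 : ℝ)) (b := 1)).prod (isCompact_univ (X := M))
  have h2 := h1.eventually_forall_of_forall_eventually (x₀ := (0 : ℝ))
    (P := fun r z => z.1 ∈ Icc (0 : ℝ) 1 → z.1 + r ∈ Icc (0 : ℝ) 1 →
      φ.family.toFun z.1 z.2 = φ.family.toFun (z.1 + r) z.2 → z.1 = z.1 + r) ?_
  · obtain ⟨δ, hδ, h3⟩ := Metric.eventually_nhds_iff.1 h2
    refine ⟨δ, hδ, fun t ht s hs hts q hq => ?_⟩
    have h4 := h3 (y := s - t) (by rwa [Real.dist_0_eq_abs]) (t, q) ⟨ht, mem_univ _⟩ ht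
    simp only [add_sub_cancel] at h4
    exact h4 hs hq
  · rintro ⟨t₀, q₀⟩ ⟨ht₀, -⟩
    obtain ⟨ε, hε, h3⟩ := h.eventually_injective ht₀ q₀
    have c1 : Filter.Tendsto (fun z : ℝ × ℝ × M => z.2.2) (𝓝 (0, t₀, q₀)) (𝓝 q₀) :=
      (continuous_snd.comp continuous_snd).tendsto' _ _ rfl
    have c2 : Filter.Tendsto (fun z : ℝ × ℝ × M => z.2.1) (𝓝 (0, t₀, q₀)) (𝓝 t₀) :=
      (continuous_fst.comp continuous_snd).tendsto' _ _ rfl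
    have c3 : Filter.Tendsto (fun z : ℝ × ℝ × M => z.2.1 + z.1) (𝓝 (0, t₀, q₀)) (𝓝 t₀) :=
      ((continuous_fst.comp continuous_snd).add continuous_fst).tendsto' _ _ (add_zero _)
    filter_upwards [c1.eventually h3, c2.eventually (Metric.ball_mem_nhds t₀ hε),
      c3.eventually (Metric.ball_mem_nhds t₀ hε)] with z hz1 hz2 hz3 hz4 hz5 hz6
    exact hz1 _ ⟨hz4, hz2⟩ _ ⟨hz5, hz3⟩ hz6

/-- Short parts of a positive isotopy are embedded. -/
theorem ContactIsotopy.IsPositive.mk_mem_closure [CompactSpace M] {φ : ContactIsotopy α}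
    (h : φ.IsPositive) : UniversalCover.mk φ ∈ Submonoid.closure (positivePieces α) := by
  obtain ⟨δ, hδ, hinj⟩ := h.exists_injective
  refine UniversalCover.mk_mem_of_short_pieces _ φ hδ fun a b ha hb hab hlt =>
    Submonoid.subset_closure ?_
  have hpos : (φ.piece ha hb).IsPositive := fun t ht x =>
    lt_of_lt_of_eq (mul_pos (sub_pos.2 hab) (h _ (add_mul_sub_mem_Icc ha hb ht) _))
      (φ.ham_piece ha hb ht x).symm
  refine ⟨_, rfl, ContactIsotopy.isEmbedded_of_injective ?_ fun t ht q => (hpos t ht q).ne', hpos⟩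
  intro t ht s hs q hts _
  rw [ContactIsotopy.piece_toFun, ContactIsotopy.piece_toFun] at hts
  have h1 := hinj _ (add_mul_sub_mem_Icc ha hb ht) _ (add_mul_sub_mem_Icc ha hb hs) ?_ _ hts
  · exact mul_right_cancel₀ (sub_pos.2 hab).ne' (add_left_cancel h1)
  · have h2 : |s - t| ≤ 1 := abs_le.2 ⟨by linarith [ht.2, hs.1], by linarith [ht.1, hs.2]⟩
    have h3 : a + s * (b - a) - (a + t * (b - a)) = (s - t) * (b - a) := by ring
    rw [h3, abs_mul, abs_of_pos (sub_pos.2 hab)]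
    nlinarith [sub_pos.2 hab]

omit [IsManifold (𝓡 (2 * n + 1)) ∞ M] in
theorem closure_positivePieces_le :
    Submonoid.closure (positivePieces α) ≤ nonnegClasses α := by
  rw [Submonoid.closure_le]
  rintro _ ⟨φ, rfl, -, hφ⟩
  exact ⟨φ, rfl, fun t ht x => (hφ t ht x).le⟩

theorem inv_mem_closure_negativePieces {c : UniversalCover α}
    (h : c ∈ Submonoid.closure (positivePieces α)) :
    c⁻¹ ∈ Submonoid.closure (negativePieces α) := by
  induction h using Submonoid.closure_induction with
  | mem x hx => exact Submonoid.subset_closure (inv_mem_negativePieces hx)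
  | one => rw [inv_one]; exact Submonoid.one_mem _
  | mul x y _ _ hx hy => rw [mul_inv_rev]; exact Submonoid.mul_mem _ hy hx

theorem inv_mem_closure_positivePieces {c : UniversalCover α}
    (h : c ∈ Submonoid.closure (negativePieces α)) :
    c⁻¹ ∈ Submonoid.closure (positivePieces α) := by
  induction h using Submonoid.closure_induction with
  | mem x hx => exact Submonoid.subset_closure (inv_mem_positivePieces hx)
  | one => rw [inv_one]; exact Submonoid.one_mem _
  | mul x y _ _ hx hy => rw [mul_inv_rev]; exact Submonoid.mul_mem _ hy hx

/-- Isotopies that start in positive directions near the points of `M`, and in negative directions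
nowhere, compose to one that starts in positive directions everywhere. -/
theorem exists_ham_pos_of_local [CompactSpace M] (hα : IsContactForm α)
    {C : ContactIsotopy α → Prop} (hone : C (ContactIsotopy.one α))
    (hmul : ∀ φ ψ, C φ → C ψ → C (φ.mul ψ))
    (h : ∀ x, ∃ ψ, C ψ ∧ (∀ x, 0 ≤ ψ.family.ham 0 x) ∧ 0 < ψ.family.ham 0 x) :
    ∃ ψ, C ψ ∧ ∀ x, 0 < ψ.family.ham 0 x := by
  have h0 : (0 : ℝ) ∈ Icc (0 : ℝ) 1 := left_mem_Icc.2 zero_le_one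
  have key : ∃ ψ, C ψ ∧ (∀ x, 0 ≤ ψ.family.ham 0 x) ∧ ∀ x ∈ univ, 0 < ψ.family.ham 0 x := by
    refine (isCompact_univ (X := M)).induction_on (p := fun s => ∃ ψ, C ψ ∧
      (∀ x, 0 ≤ ψ.family.ham 0 x) ∧ ∀ x ∈ s, 0 < ψ.family.ham 0 x) ?_ ?_ ?_ ?_
    · exact ⟨_, hone, fun x => (ContactFamily.ham_eq_zero (φ := ContactFamily.one α _) (y := x) h0
        fun _ _ => rfl).ge, by simp⟩
    · rintro s t hst ⟨ψ, h1, h2, h3⟩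
      exact ⟨ψ, h1, h2, fun x hx => h3 x (hst hx)⟩
    · rintro s t ⟨ψ, h1, h2, h3⟩ ⟨ψ', h1', h2', h3'⟩
      refine ⟨ψ.mul ψ', hmul _ _ h1 h1', fun x => ?_, fun x hx => ?_⟩
      · rw [ContactIsotopy.ham_mul_zero]
        exact add_nonneg (h2 x) (mul_nonneg (Real.exp_pos _).le (h2' x))
      · rw [ContactIsotopy.ham_mul_zero]
        rcases hx with hx | hx
        · exact add_pos_of_pos_of_nonneg (h3 x hx) (mul_nonneg (Real.exp_pos _).le (h2' x))
        · exact add_pos_of_nonneg_of_pos (h2 x) (mul_pos (Real.exp_pos _) (h3' x hx))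
    · intro x _
      obtain ⟨ψ, h1, h2, h3⟩ := h x
      have h4 : Continuous fun y => ψ.family.ham 0 y :=
        continuousOn_univ.1 ((ψ.family.continuousOn_ham hα).comp (by fun_prop)
          (s := univ) (f := fun y : M => ((0 : ℝ), y)) fun y _ => ⟨h0, mem_univ _⟩)
      exact ⟨{y | 0 < ψ.family.ham 0 y},
        mem_nhdsWithin_of_mem_nhds ((isOpen_lt continuous_const h4).mem_nhds h3), ψ, h1, h2,
        fun y hy => hy⟩
  obtain ⟨ψ, h1, -, h3⟩ := key
  exact ⟨ψ, h1, fun x => h3 x (mem_univ x)⟩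

/-- An isotopy that starts in positive directions is positive for a short time. -/
theorem exists_isPositive_piece [CompactSpace M] (hα : IsContactForm α) {ψ : ContactIsotopy α}
    (h : ∀ x, 0 < ψ.family.ham 0 x) : ∃ (δ : ℝ) (hδ : δ ∈ Icc (0 : ℝ) 1),
      (ψ.piece (left_mem_Icc.2 zero_le_one) hδ).IsPositive := by
  have h0 : (0 : ℝ) ∈ Icc (0 : ℝ) 1 := left_mem_Icc.2 zero_le_one
  have h1 : ∀ᶠ t in 𝓝 (0 : ℝ), ∀ y ∈ (univ : Set M), t ∈ Icc (0 : ℝ) 1 → 0 < ψ.family.ham t y := by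
    refine isCompact_univ.eventually_forall_of_forall_eventually fun y _ => ?_
    have h2 := (ψ.family.continuousOn_ham hα (0, y) ⟨h0, mem_univ _⟩).eventually
      (lt_mem_nhds (h y))
    filter_upwards [eventually_nhdsWithin_iff.1 h2] with z hz hzt using hz ⟨hzt, mem_univ _⟩
  obtain ⟨ε, hε, h2⟩ := Metric.eventually_nhds_iff.1 h1
  have hδ : min (ε / 2) 1 ∈ Icc (0 : ℝ) 1 := ⟨by positivity, min_le_right _ _⟩
  refine ⟨_, hδ, fun t ht x => ?_⟩
  have h3 : 0 < min (ε / 2) 1 := by positivity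
  refine lt_of_lt_of_eq (mul_pos (by linarith) (h2 ?_ _ (mem_univ _)
    (add_mul_sub_mem_Icc h0 hδ ht))) (ψ.ham_piece h0 hδ ht x).symm
  have h4 : min (ε / 2) 1 ≤ ε / 2 := min_le_left _ _
  rw [Real.dist_0_eq_abs, zero_add, sub_zero, abs_of_nonneg (mul_nonneg ht.1 h3.le)]
  nlinarith [ht.2]

theorem exists_isPositive [T2Space M] [CompactSpace M] (hα : IsContactForm α) :
    ∃ φ : ContactIsotopy α, φ.IsPositive := by
  obtain ⟨ψ, -, h⟩ := exists_ham_pos_of_local hα (C := fun _ => True) trivial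
    (fun _ _ _ _ => trivial) fun x => by simpa using exists_isotopy_ham_pos hα x
  obtain ⟨δ, hδ, h1⟩ := exists_isPositive_piece hα h
  exact ⟨_, h1⟩

/-- Composing a positive isotopy with a sufficiently short part of another isotopy leaves it
positive. -/
theorem exists_isPositive_mul_piece [CompactSpace M] (hα : IsContactForm α)
    {π : ContactIsotopy α} (hπ : π.IsPositive) (φ : ContactIsotopy α) :
    ∃ δ > 0, ∀ (a b : ℝ) (ha : a ∈ Icc (0 : ℝ) 1) (hb : b ∈ Icc (0 : ℝ) 1), a < b → b - a < δ →
      (π.mul (φ.piece ha hb)).IsPositive := by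
  have hK := (isCompact_Icc (a := (0 : ℝ)) (b := 1)).prod (isCompact_univ (X := M))
  have c1 := π.family.continuousOn_ham hα
  have c2 : ContinuousOn (fun z : ℝ × M => Real.exp (π.family.factor z.1 z.2))
      (Icc (0 : ℝ) 1 ×ˢ univ) :=
    Real.continuous_exp.comp_continuousOn π.family.smooth_factor.continuousOn
  have c3 := φ.family.continuousOn_ham hα
  obtain ⟨m, hm, h1⟩ : ∃ m > 0, ∀ z ∈ Icc (0 : ℝ) 1 ×ˢ (univ : Set M),
      m ≤ π.family.ham z.1 z.2 := by
    rcases (Icc (0 : ℝ) 1 ×ˢ (univ : Set M)).eq_empty_or_nonempty with he | hne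
    · exact ⟨1, one_pos, by simp [he]⟩
    · obtain ⟨z, hz, h⟩ := hK.exists_isMinOn hne c1
      exact ⟨_, hπ z.1 hz.1 z.2, h⟩
  obtain ⟨A, hA⟩ := hK.exists_bound_of_continuousOn c2
  obtain ⟨B, hB⟩ := hK.exists_bound_of_continuousOn c3
  have hAB : 0 < |A| * |B| + 1 := by positivity
  refine ⟨m / (|A| * |B| + 1), by positivity, fun a b ha hb hab hlt t ht x => ?_⟩
  refine lt_of_lt_of_eq ?_ (π.family.ham_mul (φ.piece ha hb).family ht x).symm
  rw [φ.ham_piece ha hb ht]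
  set y := (φ.piece ha hb).family.toFun t x
  have e1 := h1 (t, y) ⟨ht, mem_univ _⟩
  have e2 := (hA (t, y) ⟨ht, mem_univ _⟩).trans (le_abs_self A)
  have e3 := (hB (a + t * (b - a), φ.family.invFun a x)
    ⟨add_mul_sub_mem_Icc ha hb ht, mem_univ _⟩).trans (le_abs_self B)
  rw [lt_div_iff₀ hAB] at hlt
  have e4 := mul_le_mul e2 e3 (norm_nonneg _) (abs_nonneg A)
  rw [← norm_mul, Real.norm_eq_abs] at e4
  have e5 := (abs_le.1 e4).1
  simp only at e1 e5
  nlinarith [sub_pos.2 hab]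

/-- Every class is a product of positive and negative pieces: with `π` positive, a short part
`c` of an isotopy is `π⁻¹ (π c)`, where `π c` is positive. -/
theorem mem_closure_pieces [T2Space M] [CompactSpace M] (hα : IsContactForm α)
    (c : UniversalCover α) :
    c ∈ Submonoid.closure (positivePieces α ∪ negativePieces α) := by
  obtain ⟨φ⟩ := c
  obtain ⟨π, hπ⟩ := exists_isPositive (α := α) hα
  obtain ⟨δ, hδ, h⟩ := exists_isPositive_mul_piece hα hπ φ
  refine UniversalCover.mk_mem_of_short_pieces _ φ hδ fun a b ha hb hab hlt => ?_
  have h1 := (h a b ha hb hab hlt).mk_mem_closure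
  rw [UniversalCover.mk_mul] at h1
  rw [← inv_mul_cancel_left (UniversalCover.mk π) (UniversalCover.mk (φ.piece ha hb))]
  exact Submonoid.mul_mem _
    (Submonoid.closure_mono subset_union_right (inv_mem_closure_negativePieces hπ.mk_mem_closure))
    (Submonoid.closure_mono subset_union_left h1)

end Pieces

/-! ### Isotopies with vanishing Hamiltonian -/

section Rigidity

open Topology

section Euclidean

variable {P E : Type} [NormedAddCommGroup P] [NormedSpace ℝ P] [NormedAddCommGroup E]
  [NormedSpace ℝ E] {a : E → E →L[ℝ] ℝ} {Ψ : P → E} {p₀ : P}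

/-- The derivative along `u` of the function `p ↦ a (Ψ p) (DΨ(p) w)`, where it vanishes. -/
theorem fderiv_form_apply_eq_zero (hΨ : ContDiffAt ℝ 2 Ψ p₀) (ha : DifferentiableAt ℝ a (Ψ p₀))
    (u w : P) (h : ∀ᶠ s in 𝓝 (0 : ℝ), a (Ψ (p₀ + s • u)) (fderiv ℝ Ψ (p₀ + s • u) w) = 0) :
    (fderiv ℝ a (Ψ p₀) (fderiv ℝ Ψ p₀ u)) (fderiv ℝ Ψ p₀ w)
      + a (Ψ p₀) (fderiv ℝ (fderiv ℝ Ψ) p₀ u w) = 0 := by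
  have h1 : HasFDerivAt Ψ (fderiv ℝ Ψ p₀) p₀ := (hΨ.differentiableAt (by simp)).hasFDerivAt
  have h2 : HasFDerivAt (fderiv ℝ Ψ) (fderiv ℝ (fderiv ℝ Ψ) p₀) p₀ :=
    ((hΨ.fderiv_right (m := 1) (by norm_num)).differentiableAt (by simp)).hasFDerivAt
  have h3 := (ha.hasFDerivAt.comp p₀ h1).clm_apply (h2.clm_apply (hasFDerivAt_const w p₀))
  have h4 : HasDerivAt (fun s : ℝ => p₀ + s • u) u 0 := by
    simpa using ((hasDerivAt_id (0 : ℝ)).smul_const u).const_add p₀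
  have h5 := HasFDerivAt.comp_hasDerivAt_of_eq (0 : ℝ) h3 h4 (by simp)
  have h6 := h5.unique ((hasDerivAt_const (0 : ℝ) (0 : ℝ)).congr_of_eventuallyEq h)
  simp at h6
  rw [add_comm]
  exact h6

/-- If `a` vanishes on the velocity of the maps `Ψ (t, ·)`, and these preserve the kernel of `a`,
then the velocity lies in the kernel of the restriction of `da` to the kernel of `a`. -/
theorem formDeriv_velocity_eq_zero {Ψ : ℝ × E → E} {t₀ : ℝ} {y₀ : E}
    (hΨ : ContDiffAt ℝ 2 Ψ (t₀, y₀)) (ha : DifferentiableAt ℝ a y₀)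
    (hid : Ψ (t₀, y₀) = y₀) (hid' : ∀ v, fderiv ℝ Ψ (t₀, y₀) (0, v) = v)
    (hvel : ∀ᶠ p in 𝓝 (t₀, y₀), a (Ψ p) (fderiv ℝ Ψ p (1, 0)) = 0)
    {v : E} (hker : ∀ᶠ p in 𝓝 (t₀, y₀), a p.2 v = 0 → a (Ψ p) (fderiv ℝ Ψ p (0, v)) = 0)
    (hv : a y₀ v = 0) : formDeriv a y₀ (fderiv ℝ Ψ (t₀, y₀) (1, 0)) v = 0 := by
  have hl : ∀ u : ℝ × E, Filter.Tendsto (fun s : ℝ => (t₀, y₀) + s • u) (𝓝 0) (𝓝 (t₀, y₀)) :=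
    fun u => Continuous.tendsto' (by fun_prop) _ _ (by simp)
  rw [← hid] at ha
  have h1 := fderiv_form_apply_eq_zero hΨ ha (0, v) (1, 0) ((hl _).eventually hvel)
  have h2 := fderiv_form_apply_eq_zero hΨ ha (1, 0) (0, v) (by
    filter_upwards [(hl (1, 0)).eventually hker] with s hs
    exact hs (by simpa using hv))
  have h3 := hΨ.isSymmSndFDerivAt (by simp) (0, v) (1, 0)
  rw [hid, hid'] at h1 h2
  rw [h3] at h1
  rw [formDeriv_apply]
  linarith

end Euclidean

variable {n : ℕ} {M : Type*} [TopologicalSpace M] [ChartedSpace (Model n) M]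
  {α : ∀ x : M, TangentSpace (𝓡 (2 * n + 1)) x →L[ℝ] ℝ} [IsManifold (𝓡 (2 * n + 1)) ∞ M]

theorem localForm_mfderiv_extChartAt {z₀ x : M}
    (hx : x ∈ (extChartAt (𝓡 (2 * n + 1)) z₀).source) (v : TangentSpace (𝓡 (2 * n + 1)) x) :
    localForm α z₀ (extChartAt (𝓡 (2 * n + 1)) z₀ x)
      (mfderiv (𝓡 (2 * n + 1)) (𝓡 (2 * n + 1)) (extChartAt (𝓡 (2 * n + 1)) z₀) x v) = α x v := by
  have := isManifold_one (n := n) (M := M)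
  let A : M → Model n → ℝ := fun x v => α x v
  have h6 := mfderivWithin_extChartAt_symm_comp_mfderiv_extChartAt' (I := 𝓡 (2 * n + 1)) hx
  rw [ModelWithCorners.range_eq_univ, mfderivWithin_univ] at h6
  refine Eq.trans ?_ (congrArg (A x) (DFunLike.congr_fun h6 v))
  exact congrArg (fun z => A z (mfderiv (𝓡 (2 * n + 1)) (𝓡 (2 * n + 1))
    (extChartAt (𝓡 (2 * n + 1)) z₀).symm (extChartAt (𝓡 (2 * n + 1)) z₀ x)
      (mfderiv (𝓡 (2 * n + 1)) (𝓡 (2 * n + 1)) (extChartAt (𝓡 (2 * n + 1)) z₀) x v)))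
    ((extChartAt (𝓡 (2 * n + 1)) z₀).left_inv hx)

namespace ContactFamily

variable (θ : ContactFamily α (Icc (0 : ℝ) 1)) (z₀ : M)

/-- A family in the chart at `z₀`, as a function of the time and of the initial point. -/
def chartMap (p : ℝ × Model n) : Model n :=
  extChartAt (𝓡 (2 * n + 1)) z₀ (θ.toFun p.1 ((extChartAt (𝓡 (2 * n + 1)) z₀).symm p.2))

variable {θ z₀} {p : ℝ × Model n} (hp : p.1 ∈ Ioo (0 : ℝ) 1)
  (hpt : p.2 ∈ (extChartAt (𝓡 (2 * n + 1)) z₀).target)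
  (hps : θ.toFun p.1 ((extChartAt (𝓡 (2 * n + 1)) z₀).symm p.2)
    ∈ (extChartAt (𝓡 (2 * n + 1)) z₀).source)

include hp hpt hps

theorem contDiffAt_chartMap : ContDiffAt ℝ ∞ (θ.chartMap z₀) p := by
  rw [← contMDiffAt_iff_contDiffAt]
  have h1 : ContMDiffAt 𝓘(ℝ, ℝ × Model n) 𝓘(ℝ, ℝ) ∞ (fun p : ℝ × Model n => p.1) p :=
    contDiffAt_fst.contMDiffAt
  have h2 : ContMDiffAt 𝓘(ℝ, ℝ × Model n) (𝓡 (2 * n + 1)) ∞ (fun p : ℝ × Model n => p.2) p :=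
    contDiffAt_snd.contMDiffAt
  have h3 := (contMDiffOn_extChartAt_symm (I := 𝓡 (2 * n + 1)) (n := ∞) z₀).contMDiffAt
    ((isOpen_extChartAt_target z₀).mem_nhds hpt)
  have h4 : ContMDiffAt (𝓘(ℝ, ℝ).prod (𝓡 (2 * n + 1))) (𝓡 (2 * n + 1)) ∞
      (fun z : ℝ × M => θ.toFun z.1 z.2) (p.1, (extChartAt (𝓡 (2 * n + 1)) z₀).symm p.2) :=
    θ.smooth_toFun.contMDiffAt (prod_mem_nhds (Icc_mem_nhds hp.1 hp.2) Filter.univ_mem)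
  rw [extChartAt_source] at hps
  exact (contMDiffAt_extChartAt' (n := ∞) hps).comp p (h4.comp p (h1.prodMk (h3.comp p h2)))

theorem localForm_fderiv_chartMap (τ : ℝ) (v : Model n) :
    localForm α z₀ (θ.chartMap z₀ p) (fderiv ℝ (θ.chartMap z₀) p (τ, v))
      = τ * θ.ham p.1 ((extChartAt (𝓡 (2 * n + 1)) z₀).symm p.2)
        + Real.exp (θ.factor p.1 ((extChartAt (𝓡 (2 * n + 1)) z₀).symm p.2))
          * localForm α z₀ p.2 v := by
  have hpI : p.1 ∈ Icc (0 : ℝ) 1 := Ioo_subset_Icc_self hp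
  set x := (extChartAt (𝓡 (2 * n + 1)) z₀).symm p.2 with hx
  have h1 : HasMFDerivAt 𝓘(ℝ, ℝ × Model n) 𝓘(ℝ, ℝ) (fun p : ℝ × Model n => p.1) p
      (ContinuousLinearMap.fst ℝ ℝ (Model n)) := hasFDerivAt_fst.hasMFDerivAt
  have h2 : HasMFDerivAt 𝓘(ℝ, ℝ × Model n) (𝓡 (2 * n + 1)) (fun p : ℝ × Model n => p.2) p
      (ContinuousLinearMap.snd ℝ ℝ (Model n)) := hasFDerivAt_snd.hasMFDerivAt
  have h3 := hasMFDerivAt_extChartAt_symm hpt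
  have h4 := (θ.hasMFDerivWithinAt hpI x).hasMFDerivAt
    (prod_mem_nhds (Icc_mem_nhds hp.1 hp.2) Filter.univ_mem)
  have h5 := hasMFDerivAt_extChartAt hps
  let S : Model n →L[ℝ] Model n := mfderiv (𝓡 (2 * n + 1)) (𝓡 (2 * n + 1))
    (extChartAt (𝓡 (2 * n + 1)) z₀).symm p.2
  let D : Model n →L[ℝ] Model n := mfderiv (𝓡 (2 * n + 1)) (𝓡 (2 * n + 1))
    (extChartAt (𝓡 (2 * n + 1)) z₀) (θ.toFun p.1 x)
  let w : Model n := S v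
  let L : ℝ × Model n →L[ℝ] Model n := mfderivWithin (𝓘(ℝ, ℝ).prod (𝓡 (2 * n + 1)))
    (𝓡 (2 * n + 1)) (fun z : ℝ × M => θ.toFun z.1 z.2) (Icc (0 : ℝ) 1 ×ˢ univ) (p.1, x)
  have h56 := h5.comp p (h4.comp p (h1.prodMk (h3.comp p h2)))
  have h6 : HasFDerivAt (θ.chartMap z₀)
      (D.comp (L.comp ((ContinuousLinearMap.fst ℝ ℝ (Model n)).prod
        (S.comp (ContinuousLinearMap.snd ℝ ℝ (Model n)))))) p := h56.hasFDerivAt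
  have h7 := DFunLike.congr_fun h6.fderiv (τ, v)
  refine (congrArg (localForm α z₀ (θ.chartMap z₀ p)) h7).trans ?_
  refine (localForm_mfderiv_extChartAt hps (L (τ, w))).trans ?_
  have h8 : L (τ, w) = τ • (θ.vel p.1 x : Model n)
      + mfderiv (𝓡 (2 * n + 1)) (𝓡 (2 * n + 1)) (θ.toFun p.1) x w := by
    refine Eq.trans ?_ (congrArg₂ (fun a b : Model n => τ • a + b) (θ.vel_eq hpI x).symm
      (θ.mfderiv_toFun hpI x w).symm)
    change L (τ, w) = τ • L (1, 0) + L (0, w)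
    rw [← L.map_smul, ← L.map_add]
    simp
  refine (congrArg (α (θ.toFun p.1 x)) h8).trans ?_
  refine ((α (θ.toFun p.1 x)).map_add _ _).trans ?_
  refine congrArg₂ (· + ·) ((α (θ.toFun p.1 x)).map_smul τ _) ?_
  exact θ.pullback_eq p.1 hpI x w

end ContactFamily

/-- An isotopy whose Hamiltonian vanishes has velocity zero, since its velocity is tangent to the
contact distribution `ker α` and preserves it. -/
theorem ContactFamily.vel_eq_zero (hα : IsContactForm α) {φ : ContactFamily α (Icc (0 : ℝ) 1)}
    (h : ∀ t ∈ Ioo (0 : ℝ) 1, ∀ x, φ.ham t x = 0) {t₀ : ℝ} (ht₀ : t₀ ∈ Ioo (0 : ℝ) 1) (x₀ : M) :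
    φ.vel t₀ x₀ = 0 := by
  have ht₀' : t₀ ∈ Icc (0 : ℝ) 1 := Ioo_subset_Icc_self ht₀
  -- after composition with `φ_{t₀}⁻¹` the family passes through the identity at time `t₀`
  let θ : ContactFamily α (Icc (0 : ℝ) 1) :=
    φ.mul (φ.comap (fun _ : ℝ => t₀) contDiff_const (fun _ _ => ht₀')).inv
  have hθ : ∀ t x, θ.toFun t x = φ.toFun t (φ.invFun t₀ x) := fun _ _ => rfl
  have hθ0 : ∀ x, θ.toFun t₀ x = x := fun x => φ.right_inv t₀ ht₀' x
  have hham : ∀ t ∈ Ioo (0 : ℝ) 1, ∀ x, θ.ham t x = 0 := fun t ht x => h t ht (φ.invFun t₀ x)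
  set z₀ := φ.toFun t₀ x₀ with hz₀
  have hinv : φ.invFun t₀ z₀ = x₀ := φ.left_inv t₀ ht₀' x₀
  set χ := extChartAt (𝓡 (2 * n + 1)) z₀ with hχ
  have hχs : χ.symm (χ z₀) = z₀ := extChartAt_to_inv z₀
  have hid : θ.chartMap z₀ (t₀, χ z₀) = χ z₀ := by
    change χ (θ.toFun t₀ (χ.symm (χ z₀))) = χ z₀
    rw [hθ0, hχs]
  have hev : ∀ᶠ p : ℝ × Model n in 𝓝 (t₀, χ z₀), p.1 ∈ Ioo (0 : ℝ) 1 ∧ p.2 ∈ χ.target ∧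
      θ.toFun p.1 (χ.symm p.2) ∈ χ.source := by
    have e1 : ∀ᶠ p : ℝ × Model n in 𝓝 (t₀, χ z₀), p.1 ∈ Ioo (0 : ℝ) 1 :=
      continuous_fst.continuousAt.eventually_mem (isOpen_Ioo.mem_nhds ht₀)
    have e2 : ∀ᶠ p : ℝ × Model n in 𝓝 (t₀, χ z₀), p.2 ∈ χ.target :=
      continuous_snd.continuousAt.eventually_mem (IsOpen.mem_nhds (isOpen_extChartAt_target z₀)
        (show (t₀, χ z₀).2 ∈ _ from mem_extChartAt_target z₀))
    have c1 : ContinuousAt (fun z : ℝ × M => θ.toFun z.1 z.2) (t₀, χ.symm (χ z₀)) :=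
      (θ.smooth_toFun.contMDiffAt
        (prod_mem_nhds (Icc_mem_nhds ht₀.1 ht₀.2) Filter.univ_mem)).continuousAt
    have c2 : ContinuousAt (fun p : ℝ × Model n => (p.1, χ.symm p.2)) (t₀, χ z₀) :=
      continuousAt_fst.prodMk (ContinuousAt.comp (f := fun p : ℝ × Model n => p.2)
        (continuousAt_extChartAt_symm (I := 𝓡 (2 * n + 1)) z₀) continuousAt_snd)
    have e3 : ∀ᶠ p : ℝ × Model n in 𝓝 (t₀, χ z₀), θ.toFun p.1 (χ.symm p.2) ∈ χ.source := by
      refine (ContinuousAt.comp (f := fun p : ℝ × Model n => (p.1, χ.symm p.2)) c1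
        c2).eventually_mem ((isOpen_extChartAt_source (I := 𝓡 (2 * n + 1)) z₀).mem_nhds ?_)
      change θ.toFun t₀ (χ.symm (χ z₀)) ∈ χ.source
      rw [hθ0, hχs]
      exact mem_extChartAt_source z₀
    exact e1.and (e2.and e3)
  obtain ⟨hp1, hp2, hp3⟩ := hev.self_of_nhds
  have hcd := ContactFamily.contDiffAt_chartMap hp1 hp2 hp3
  have hd := (hcd.differentiableAt (by simp)).hasFDerivAt
  have hid' : ∀ v, fderiv ℝ (θ.chartMap z₀) (t₀, χ z₀) (0, v) = v := by
    intro v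
    have d1 : HasFDerivAt (fun y : Model n => (t₀, y)) (ContinuousLinearMap.inr ℝ ℝ (Model n))
        (χ z₀) := hasFDerivAt_prodMk_right t₀ (χ z₀)
    have d2 := hd.comp (χ z₀) d1
    have d3 : (fun y : Model n => θ.chartMap z₀ (t₀, y)) =ᶠ[𝓝 (χ z₀)] id := by
      filter_upwards [extChartAt_target_mem_nhds z₀] with y hy
      change χ (θ.toFun t₀ (χ.symm y)) = y
      rw [hθ0, χ.right_inv hy]
    exact DFunLike.congr_fun (d2.unique ((hasFDerivAt_id (χ z₀)).congr_of_eventuallyEq d3)) v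
  -- in the chart the velocity is the derivative in the direction of time
  have hvel : fderiv ℝ (θ.chartMap z₀) (t₀, χ z₀) (1, 0) = (φ.vel t₀ x₀ : Model n) := by
    have hsrc : φ.toFun t₀ x₀ ∈ (extChartAt (𝓡 (2 * n + 1)) z₀).source := mem_extChartAt_source z₀
    have d1 : HasDerivAt (fun t : ℝ => (t, χ z₀)) ((1 : ℝ), (0 : Model n)) t₀ :=
      (hasDerivAt_id t₀).prodMk (hasDerivAt_const t₀ (χ z₀))
    have d2 := hd.comp_hasDerivAt t₀ d1
    have d3 := (φ.hasDerivWithinAt_chart ht₀' hsrc).hasDerivAt (Icc_mem_nhds ht₀.1 ht₀.2)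
    have d4 : (fun t : ℝ => θ.chartMap z₀ (t, χ z₀)) = fun t => χ (φ.toFun t x₀) := by
      funext t
      change χ (θ.toFun t (χ.symm (χ z₀))) = _
      rw [hχs, hθ, hinv]
    refine (d2.unique (d4 ▸ d3)).trans ?_
    have := isManifold_one (n := n) (M := M)
    exact DFunLike.congr_fun (mfderiv_extChartAt_self (I := 𝓡 (2 * n + 1)) (x := z₀)) (φ.vel t₀ x₀)
  refine hα.nondegenerate z₀ (φ.vel t₀ x₀) (h t₀ ht₀ x₀) fun v hv => ?_
  have hfin := formDeriv_velocity_eq_zero (a := localForm α z₀) (Ψ := θ.chartMap z₀) (v := v)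
    (hcd.of_le ENat.LEInfty.out)
    (((contDiffOn_localForm hα).contDiffAt (extChartAt_target_mem_nhds z₀)).differentiableAt
      (by simp)) hid hid' ?_ ?_ ((localForm_self v).trans hv)
  · rw [hvel] at hfin
    exact hfin
  · filter_upwards [hev] with p hp
    rw [ContactFamily.localForm_fderiv_chartMap hp.1 hp.2.1 hp.2.2, hham _ hp.1, map_zero]
    simp
  · filter_upwards [hev] with p hp hv
    refine (ContactFamily.localForm_fderiv_chartMap hp.1 hp.2.1 hp.2.2 0 v).trans ?_
    rw [hv]
    simp

/-- An isotopy whose Hamiltonian vanishes is constant. -/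
theorem ContactIsotopy.mk_eq_one_of_ham_eq_zero [T2Space M] (hα : IsContactForm α)
    {φ : ContactIsotopy α} (h : ∀ t ∈ Ioo (0 : ℝ) 1, ∀ x, φ.family.ham t x = 0) :
    UniversalCover.mk φ = 1 := by
  refine UniversalCover.mk_eq_of_eqOn (ψ := ContactIsotopy.one α) fun t ht x => ?_
  change φ.family.toFun t x = x
  let γ : ℝ → M := fun t => φ.family.toFun t x
  have hγ : ContinuousOn γ (Icc 0 1) := fun t ht => (φ.family.hasMFDerivWithinAt_curve ht x).1
  have hloc : ∀ t ∈ Ioo (0 : ℝ) 1, ∀ᶠ s in 𝓝 t, γ s = γ t := by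
    intro t ht
    have hγt : ContinuousAt γ t := hγ.continuousAt (Icc_mem_nhds ht.1 ht.2)
    have h1 := (hγt.eventually_mem ((isOpen_extChartAt_source (I := 𝓡 (2 * n + 1)) (γ t)).mem_nhds
      (mem_extChartAt_source (γ t)))).and (isOpen_Ioo.mem_nhds ht)
    obtain ⟨ε, hε, hball⟩ := Metric.eventually_nhds_iff_ball.1 h1
    let F : ℝ → Model n := fun s => extChartAt (𝓡 (2 * n + 1)) (γ t) (γ s)
    have h2 : ∀ s ∈ Metric.ball t ε, HasDerivWithinAt F (0 : Model n) (Metric.ball t ε) s := by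
      intro s hs
      have h3 := (φ.family.hasDerivWithinAt_chart (Ioo_subset_Icc_self (hball s hs).2)
        (hball s hs).1).hasDerivAt (Icc_mem_nhds (hball s hs).2.1 (hball s hs).2.2)
      have h4 : φ.family.chartVel (γ t) s x = 0 := by
        let D : Model n →L[ℝ] Model n := mfderiv (𝓡 (2 * n + 1)) (𝓡 (2 * n + 1))
          (extChartAt (𝓡 (2 * n + 1)) (γ t)) (γ s)
        exact (congrArg D (ContactFamily.vel_eq_zero hα h (hball s hs).2 x)).trans D.map_zero
      rw [h4] at h3
      exact h3.hasDerivWithinAt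
    filter_upwards [Metric.ball_mem_nhds t hε] with s hs
    have h5 := (convex_ball t ε).norm_image_sub_le_of_norm_hasDerivWithin_le (C := 0) h2
      (fun _ _ => norm_zero.le) (Metric.mem_ball_self hε) hs
    rw [zero_mul, norm_le_zero_iff, sub_eq_zero] at h5
    exact (extChartAt (𝓡 (2 * n + 1)) (γ t)).injOn (hball s hs).1 (mem_extChartAt_source _) h5
  let u : Set ℝ := {s | s ∈ Ioo (0 : ℝ) 1 ∧ γ s = γ (1 / 2)}
  have hu : Ioo (0 : ℝ) 1 ⊆ u := by
    refine isPreconnected_Ioo.subset_of_closure_inter_subset ?_ ⟨1 / 2, by norm_num,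
      by norm_num, rfl⟩ ?_
    · rw [isOpen_iff_mem_nhds]
      rintro s ⟨hs, hs2⟩
      filter_upwards [isOpen_Ioo.mem_nhds hs, hloc s hs] with r hr hr2 using ⟨hr, hr2.trans hs2⟩
    · rintro s ⟨hs, hsI⟩
      obtain ⟨r, hr, hr2⟩ := mem_closure_iff_nhds.1 hs _ (hloc s hsI)
      exact ⟨hsI, (show γ r = γ s from hr).symm.trans hr2.2⟩
  have hcl : EqOn γ (fun _ => γ (1 / 2)) (Icc 0 1) :=
    EqOn.of_subset_closure (s := Ioo (0 : ℝ) 1) (fun s hs => (hu hs).2) hγ continuousOn_const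
      Ioo_subset_Icc_self (closure_Ioo zero_ne_one).symm.subset
  have h0 := hcl (left_mem_Icc.2 zero_le_one)
  exact (hcl ht).trans (h0.symm.trans (φ.map_zero x))

end Rigidity

/-! ### Positive contractible loops -/

section Orderability

open Topology

variable {n : ℕ} {M : Type*} [TopologicalSpace M] [ChartedSpace (Model n) M]
  {α : ∀ x : M, TangentSpace (𝓡 (2 * n + 1)) x →L[ℝ] ℝ}

theorem ContactIsotopy.IsNonneg.mul {φ ψ : ContactIsotopy α} (hφ : φ.IsNonneg)
    (hψ : ψ.IsNonneg) : (φ.mul ψ).IsNonneg := fun t ht x =>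
  le_of_le_of_eq (add_nonneg (hφ t ht _) (mul_nonneg (Real.exp_pos _).le (hψ t ht x)))
    (φ.family.ham_mul ψ.family ht x).symm

variable [IsManifold (𝓡 (2 * n + 1)) ∞ M]

/-- An open set that is invariant under contact isotopies is closed. Near a limit point outside of
the set, a point of the complement nearest, in a chart, to a given point `z` of the set could be
moved towards `z` by a contact isotopy. -/
theorem isClosed_of_invariant [T2Space M] (hα : IsContactForm α) {W : Set M} (hW : IsOpen W)
    (hinv : ∀ (f : ContactIsotopy α), ∀ t ∈ Icc (0 : ℝ) 1, ∀ y, f.family.toFun t y ∈ W → y ∈ W) :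
    IsClosed W := by
  refine isClosed_of_closure_subset fun x hx => ?_
  by_contra hxW
  obtain ⟨V, hVt, hV, hxV, hdir⟩ := exists_isotopy_direction hα x
  set χ := extChartAt (𝓡 (2 * n + 1)) x with hχ
  obtain ⟨r, hr, hrV⟩ := Metric.isOpen_iff.1 hV _ hxV
  -- a point of `W` near `x`
  obtain ⟨w, ⟨hwr, hws⟩, hwW⟩ := mem_closure_iff_nhds.1 hx
    ({w | χ w ∈ Metric.ball (χ x) (r / 2)} ∩ χ.source) (Filter.inter_mem
      ((continuousAt_extChartAt x).eventually_mem (Metric.ball_mem_nhds _ (half_pos hr)))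
      (extChartAt_source_mem_nhds x))
  let z : Model n := χ w
  have hwr' : dist z (χ x) < r / 2 := hwr
  have hball : Metric.closedBall z (r / 2) ⊆ V := by
    refine Subset.trans (fun y hy => ?_) hrV
    rw [Metric.mem_closedBall] at hy
    rw [Metric.mem_ball]
    linarith [dist_triangle y z (χ x)]
  have hcont : ContinuousOn χ.symm (Metric.closedBall z (r / 2)) :=
    (continuousOn_extChartAt_symm x).mono (hball.trans hVt)
  -- the points of the complement of `W` in a ball around `z`
  let K : Set (Model n) := Metric.closedBall z (r / 2) ∩ χ.symm ⁻¹' Wᶜ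
  have hK : IsCompact K := (isCompact_closedBall z (r / 2)).of_isClosed_subset
    (hcont.preimage_isClosed_of_isClosed Metric.isClosed_closedBall hW.isClosed_compl)
    inter_subset_left
  have hxK : χ x ∈ K := by
    refine ⟨Metric.mem_closedBall'.2 hwr'.le, ?_⟩
    change χ.symm (χ x) ∉ W
    rwa [hχ, extChartAt_to_inv]
  obtain ⟨y, ⟨hyb, hyW⟩, hmin⟩ := hK.exists_isMinOn ⟨_, hxK⟩
    (f := fun y => ‖y - z‖ ^ 2) (by fun_prop)
  have hyz : y ≠ z := by
    rintro rfl
    refine hyW ?_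
    change χ.symm (χ w) ∈ W
    rwa [χ.left_inv hws]
  obtain ⟨ψ, γ, c, hc, hγ0, hγ, hγV, hψ⟩ := hdir y (hball hyb) (z - y)
  have hd : HasDerivAt (fun t => ‖γ t - z‖ ^ 2) (2 * inner ℝ (γ 0 - z) (c • (z - y))) 0 :=
    (hγ.sub_const z).norm_sq
  have hneg : 2 * inner ℝ (γ 0 - z) (c • (z - y)) < 0 := by
    rw [hγ0, ← neg_sub y z, smul_neg, inner_neg_right, inner_smul_right,
      real_inner_self_eq_norm_sq]
    have : 0 < ‖y - z‖ := norm_pos_iff.2 (sub_ne_zero.2 hyz)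
    have : 0 < c * ‖y - z‖ ^ 2 := by positivity
    linarith
  have hev := (hd.tendsto_slope_zero_right.eventually (gt_mem_nhds hneg)).and
    (Ioo_mem_nhdsGT (zero_lt_one (α := ℝ)))
  obtain ⟨t, hlt, ht⟩ := hev.exists
  rw [zero_add, smul_eq_mul, hγ0] at hlt
  have hlt' : ‖γ t - z‖ ^ 2 < ‖y - z‖ ^ 2 := by
    by_contra hge
    exact absurd hlt (not_lt.2 (mul_nonneg (inv_nonneg.2 ht.1.le) (sub_nonneg.2 (not_lt.1 hge))))
  have htI : t ∈ Icc (0 : ℝ) 1 := Ioo_subset_Icc_self ht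
  refine absurd hlt' (not_lt.2 (hmin ⟨?_, fun hmem => hyW ?_⟩))
  · rw [mem_closedBall_iff_norm] at hyb ⊢
    exact ((pow_lt_pow_iff_left₀ (norm_nonneg _) (norm_nonneg _) two_ne_zero).1 hlt').le.trans hyb
  · refine hinv ψ t htI _ ?_
    rw [hψ t htI]
    exact hmem

/-- A non-trivial class that is non-negative together with its inverse gives rise to a positive
contractible loop. The points where some non-negative isotopy `ψ` with `[ψ]⁻¹` non-negative starts
in a positive direction form an invariant, open, and non-empty set, so that a composition of such
isotopies is positive for a short time. -/
theorem one_mem_positiveClasses [T2Space M] [CompactSpace M] [ConnectedSpace M]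
    (hα : IsContactForm α) {c : UniversalCover α} (hc : c ∈ nonnegClasses α)
    (hc' : c⁻¹ ∈ nonnegClasses α) (hne : c ≠ 1) : 1 ∈ positiveClasses α := by
  have h0 : (0 : ℝ) ∈ Icc (0 : ℝ) 1 := left_mem_Icc.2 zero_le_one
  have h1 : (1 : ℝ) ∈ Icc (0 : ℝ) 1 := right_mem_Icc.2 zero_le_one
  let C : ContactIsotopy α → Prop := fun ψ =>
    ψ.IsNonneg ∧ (UniversalCover.mk ψ)⁻¹ ∈ nonnegClasses α
  let W : Set M := {y | ∃ ψ, C ψ ∧ 0 < ψ.family.ham 0 y}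
  have hconj : ∀ (f : ContactIsotopy α) (y : M), y ∈ W → f.family.toFun 1 y ∈ W := by
    rintro f y ⟨ψ, ⟨hψ, hψ'⟩, hy⟩
    refine ⟨ContactIsotopy.conj f ψ, ⟨hψ.conj f, ?_⟩, ?_⟩
    · rw [UniversalCover.mk_conj, mul_inv_rev, mul_inv_rev, inv_inv, ← mul_assoc]
      exact conj_mem_nonnegClasses hψ' f
    · rw [ContactIsotopy.ham_conj f ψ h0, f.family.left_inv 1 h1]
      exact mul_pos (Real.exp_pos _) hy
  have hinv : ∀ (f : ContactIsotopy α), ∀ t ∈ Icc (0 : ℝ) 1, ∀ y,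
      f.family.toFun t y ∈ W → y ∈ W := by
    intro f t ht y hy
    have h2 := hconj (f.piece h0 ht).inv _ hy
    have h3 : (f.piece h0 ht).family.toFun 1 y = f.family.toFun t y := by
      rw [ContactIsotopy.piece_toFun, f.invFun_zero]
      simp
    change (f.piece h0 ht).family.invFun 1 (f.family.toFun t y) ∈ W at h2
    rwa [← h3, (f.piece h0 ht).family.left_inv 1 h1] at h2
  have hopen : IsOpen W := by
    rw [isOpen_iff_mem_nhds]
    rintro y ⟨ψ, hψ, hy⟩
    have h4 : Continuous fun y => ψ.family.ham 0 y :=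
      continuousOn_univ.1 ((ψ.family.continuousOn_ham hα).comp (by fun_prop)
        (s := univ) (f := fun y : M => ((0 : ℝ), y)) fun y _ => ⟨h0, mem_univ _⟩)
    filter_upwards [(isOpen_lt continuous_const h4).mem_nhds hy] with x hx using ⟨ψ, hψ, hx⟩
  have hnonempty : W.Nonempty := by
    obtain ⟨φ, rfl, hφ⟩ := hc
    by_contra hW
    refine hne (ContactIsotopy.mk_eq_one_of_ham_eq_zero hα fun t ht x => ?_)
    have htI : t ∈ Icc (0 : ℝ) 1 := Ioo_subset_Icc_self ht
    by_contra h2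
    refine hW ⟨φ.family.toFun t x, φ.piece htI h1, ⟨hφ.piece htI h1 ht.2.le, ?_⟩, ?_⟩
    · have h3 := UniversalCover.mk_piece_mul φ h0 htI h1
      rw [UniversalCover.mk_piece_zero_one] at h3
      rw [eq_mul_inv_of_mul_eq h3, mul_inv_rev, inv_inv]
      exact Submonoid.mul_mem _ (mk_mem_nonnegClasses (hφ.piece h0 htI ht.1.le)) hc'
    · rw [φ.ham_piece htI h1 h0, φ.family.left_inv t htI, zero_mul, add_zero]
      exact mul_pos (sub_pos.2 ht.2) (lt_of_le_of_ne (hφ t htI x) (Ne.symm h2))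
  have huniv : W = univ :=
    IsClopen.eq_univ ⟨isClosed_of_invariant hα hopen hinv, hopen⟩ hnonempty
  obtain ⟨ψ, ⟨hψ, hψ'⟩, hpos⟩ := exists_ham_pos_of_local hα (C := C)
    ⟨fun t ht x => (ContactFamily.ham_eq_zero (φ := ContactFamily.one α _) (y := x) ht
      fun _ _ => rfl).ge, by
        rw [UniversalCover.mk_one, inv_one]
        exact Submonoid.one_mem _⟩
    (fun φ ψ hφ hψ => ⟨hφ.1.mul hψ.1, by
      rw [UniversalCover.mk_mul, mul_inv_rev]
      exact Submonoid.mul_mem _ hψ.2 hφ.2⟩)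
    (fun x => by
      obtain ⟨ψ, hψ, hx⟩ : x ∈ W := huniv ▸ mem_univ x
      exact ⟨ψ, hψ, fun y => hψ.1 0 h0 y, hx⟩)
  obtain ⟨δ, hδ, hp⟩ := exists_isPositive_piece hα hpos
  have h2 : UniversalCover.mk ψ ∈ positiveClasses α := by
    rw [← UniversalCover.mk_piece_zero_one, ← UniversalCover.mk_piece_mul ψ h0 hδ h1]
    exact mul_mem_positiveClasses (mk_mem_nonnegClasses (hψ.piece hδ h1 hδ.2)) ⟨_, rfl, hp⟩
  rw [← mul_inv_cancel (UniversalCover.mk ψ)]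
  exact mul_mem_positiveClasses' h2 hψ'

theorem mem_closure_positivePieces [CompactSpace M] {c : UniversalCover α}
    (h : c ∈ positiveClasses α) : c ∈ Submonoid.closure (positivePieces α) := by
  obtain ⟨φ, rfl, hφ⟩ := h
  exact hφ.mk_mem_closure

end Orderability

/-! ### The oscillation pseudo-norm -/

section Decompositions

variable {n : ℕ} {M : Type*} [TopologicalSpace M] [ChartedSpace (Model n) M]
  {α : ∀ x : M, TangentSpace (𝓡 (2 * n + 1)) x →L[ℝ] ℝ} {c d : UniversalCover α}
  {l l' : List (Bool × UniversalCover α)}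

theorem exists_isDecomposition_of_mem_closure
    (h : c ∈ Submonoid.closure (positivePieces α ∪ negativePieces α)) :
    ∃ l, IsDecomposition l c := by
  classical
  obtain ⟨l, hl, rfl⟩ := Submonoid.exists_list_of_mem_closure h
  refine ⟨l.map fun a => (decide (a ∈ positivePieces α), a), ?_, ?_, ?_⟩
  · intro a ha
    have h1 : a ∈ l ∧ a ∈ positivePieces α := by simpa using ha
    exact h1.2
  · intro a ha
    obtain ⟨h1, h2⟩ : a ∈ l ∧ a ∉ positivePieces α := by simpa using ha
    exact (hl a h1).resolve_left h2
  · simp [Function.comp_def]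

theorem exists_isDecomposition_of_mem_closure_positivePieces
    (h : c ∈ Submonoid.closure (positivePieces α)) :
    ∃ l, IsDecomposition l c ∧ l.countP (fun p => !p.1) = 0 := by
  obtain ⟨l, hl, rfl⟩ := Submonoid.exists_list_of_mem_closure h
  refine ⟨l.map (Prod.mk true), ⟨?_, ?_, ?_⟩, ?_⟩
  · intro a ha
    exact hl a (by simpa using ha)
  · simp
  · simp [Function.comp_def]
  · simp

theorem exists_isDecomposition_of_mem_closure_negativePieces
    (h : c ∈ Submonoid.closure (negativePieces α)) :
    ∃ l, IsDecomposition l c ∧ l.countP (fun p => p.1) = 0 := by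
  obtain ⟨l, hl, rfl⟩ := Submonoid.exists_list_of_mem_closure h
  refine ⟨l.map (Prod.mk false), ⟨?_, ?_, ?_⟩, ?_⟩
  · simp
  · intro a ha
    exact hl a (by simpa using ha)
  · simp [Function.comp_def]
  · simp

namespace IsDecomposition

theorem mem_closure_positivePieces (h : IsDecomposition l c)
    (hl : l.countP (fun p => !p.1) = 0) : c ∈ Submonoid.closure (positivePieces α) := by
  rw [← h.2.2]
  refine Submonoid.list_prod_mem _ fun a ha => Submonoid.subset_closure ?_
  obtain ⟨⟨b, a⟩, hp, rfl⟩ := List.mem_map.1 ha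
  have h1 := List.countP_eq_zero.1 hl _ hp
  cases b
  · simp at h1
  · exact h.1 a hp

theorem mem_closure_negativePieces (h : IsDecomposition l c)
    (hl : l.countP (fun p => p.1) = 0) : c ∈ Submonoid.closure (negativePieces α) := by
  rw [← h.2.2]
  refine Submonoid.list_prod_mem _ fun a ha => Submonoid.subset_closure ?_
  obtain ⟨⟨b, a⟩, hp, rfl⟩ := List.mem_map.1 ha
  have h1 := List.countP_eq_zero.1 hl _ hp
  cases b
  · exact h.2.1 a hp
  · simp at h1

theorem nil : IsDecomposition [] (1 : UniversalCover α) := by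
  simp [IsDecomposition]

theorem append (h : IsDecomposition l c) (h' : IsDecomposition l' d) :
    IsDecomposition (l ++ l') (c * d) := by
  refine ⟨fun a ha => ?_, fun a ha => ?_, ?_⟩
  · exact (List.mem_append.1 ha).elim (h.1 a) (h'.1 a)
  · exact (List.mem_append.1 ha).elim (h.2.1 a) (h'.2.1 a)
  · rw [List.map_append, List.prod_append, h.2.2, h'.2.2]

variable [IsManifold (𝓡 (2 * n + 1)) ∞ M]

theorem conj (h : IsDecomposition l c) (g : UniversalCover α) :
    IsDecomposition (l.map (Prod.map id (MulAut.conj g))) (g * c * g⁻¹) := by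
  obtain ⟨ψ, rfl⟩ : ∃ ψ, UniversalCover.mk ψ = g := Quot.exists_rep g
  refine ⟨fun a ha => ?_, fun a ha => ?_, ?_⟩
  · obtain ⟨⟨b, a'⟩, hp, hpa⟩ := List.mem_map.1 ha
    obtain rfl : b = true := congrArg Prod.fst hpa
    obtain rfl := congrArg Prod.snd hpa
    exact conj_mem_positivePieces (h.1 a' hp) ψ
  · obtain ⟨⟨b, a'⟩, hp, hpa⟩ := List.mem_map.1 ha
    obtain rfl : b = false := congrArg Prod.fst hpa
    obtain rfl := congrArg Prod.snd hpa
    exact conj_mem_negativePieces (h.2.1 a' hp) ψ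
  · rw [← MulAut.conj_apply, ← h.2.2, map_list_prod, List.map_map, List.map_map]
    rfl

theorem inv (h : IsDecomposition l c) :
    IsDecomposition (l.map (Prod.map not (·⁻¹))).reverse c⁻¹ := by
  refine ⟨fun a ha => ?_, fun a ha => ?_, ?_⟩
  · obtain ⟨⟨b, a⟩, hp, hpa⟩ := List.mem_map.1 (List.mem_reverse.1 ha)
    obtain ⟨h1, rfl⟩ := Prod.ext_iff.1 hpa
    obtain rfl : b = false := by simpa using h1
    exact inv_mem_positivePieces (h.2.1 a hp)
  · obtain ⟨⟨b, a⟩, hp, hpa⟩ := List.mem_map.1 (List.mem_reverse.1 ha)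
    obtain ⟨h1, rfl⟩ := Prod.ext_iff.1 hpa
    obtain rfl : b = true := by simpa using h1
    exact inv_mem_negativePieces (h.1 a hp)
  · rw [← h.2.2, List.prod_inv_reverse, List.map_reverse, List.map_map, List.map_map]
    rfl

end IsDecomposition

theorem nuPlus_le (h : IsDecomposition l c) : nuPlus c ≤ l.countP (fun p => p.1) :=
  Int.ofNat_le.2 (Nat.sInf_le ⟨l, h, rfl⟩)

theorem neg_nuMinus_le (h : IsDecomposition l c) : -nuMinus c ≤ l.countP (fun p => !p.1) := by
  rw [nuMinus, neg_neg]
  exact Int.ofNat_le.2 (Nat.sInf_le ⟨l, h, rfl⟩)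

theorem nuPlus_nonneg : 0 ≤ nuPlus c := Int.natCast_nonneg _

theorem neg_nuMinus_nonneg : 0 ≤ -nuMinus c := by
  rw [nuMinus, neg_neg]
  exact Int.natCast_nonneg _

theorem exists_nuPlus_eq (h : ∃ l, IsDecomposition l c) :
    ∃ l, IsDecomposition l c ∧ l.countP (fun p => p.1) = nuPlus c := by
  obtain ⟨l, hl⟩ := h
  obtain ⟨l', hl', h1⟩ := Nat.sInf_mem (s := {k : ℕ | ∃ l : List (Bool × UniversalCover α),
    IsDecomposition l c ∧ l.countP (fun p => p.1) = k}) ⟨_, l, hl, rfl⟩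
  exact ⟨l', hl', congrArg Int.ofNat h1⟩

theorem exists_neg_nuMinus_eq (h : ∃ l, IsDecomposition l c) :
    ∃ l, IsDecomposition l c ∧ l.countP (fun p => !p.1) = -nuMinus c := by
  obtain ⟨l, hl⟩ := h
  obtain ⟨l', hl', h1⟩ := Nat.sInf_mem (s := {k : ℕ | ∃ l : List (Bool × UniversalCover α),
    IsDecomposition l c ∧ l.countP (fun p => !p.1) = k}) ⟨_, l, hl, rfl⟩
  refine ⟨l', hl', ?_⟩
  rw [nuMinus, neg_neg]
  exact congrArg Int.ofNat h1

theorem nuOsc_one : nuOsc (1 : UniversalCover α) = 0 := by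
  have h1 := nuPlus_le (IsDecomposition.nil (α := α))
  have h2 := neg_nuMinus_le (IsDecomposition.nil (α := α))
  have h3 := nuPlus_nonneg (c := (1 : UniversalCover α))
  have h4 := neg_nuMinus_nonneg (c := (1 : UniversalCover α))
  rw [List.countP_nil] at h1 h2
  rw [nuOsc]
  push_cast at h1 h2
  omega

theorem nuOsc_nonneg : 0 ≤ nuOsc c := by
  have h3 := nuPlus_nonneg (c := c)
  have h4 := neg_nuMinus_nonneg (c := c)
  rw [nuOsc]
  omega

theorem nuOsc_mul_le (hc : ∃ l, IsDecomposition l c) (hd : ∃ l, IsDecomposition l d) :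
    nuOsc (c * d) ≤ nuOsc c + nuOsc d := by
  obtain ⟨l₁, h₁, e₁⟩ := exists_nuPlus_eq hc
  obtain ⟨l₂, h₂, e₂⟩ := exists_nuPlus_eq hd
  obtain ⟨l₃, h₃, e₃⟩ := exists_neg_nuMinus_eq hc
  obtain ⟨l₄, h₄, e₄⟩ := exists_neg_nuMinus_eq hd
  have h5 := nuPlus_le (h₁.append h₂)
  have h6 := neg_nuMinus_le (h₃.append h₄)
  rw [List.countP_append] at h5 h6
  push_cast at h5 h6
  simp only [nuOsc]
  omega

theorem nuOsc_eq_zero_iff (hc : ∃ l, IsDecomposition l c) :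
    nuOsc c = 0 ↔ c ∈ Submonoid.closure (positivePieces α) ∧
      c ∈ Submonoid.closure (negativePieces α) := by
  have h3 := nuPlus_nonneg (c := c)
  have h4 := neg_nuMinus_nonneg (c := c)
  constructor
  · intro h
    rw [nuOsc] at h
    obtain ⟨l, hl, e⟩ := exists_nuPlus_eq hc
    obtain ⟨l', hl', e'⟩ := exists_neg_nuMinus_eq hc
    exact ⟨hl'.mem_closure_positivePieces (by omega), hl.mem_closure_negativePieces (by omega)⟩
  · rintro ⟨hp, hn⟩
    obtain ⟨l, hl, e⟩ := exists_isDecomposition_of_mem_closure_positivePieces hp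
    obtain ⟨l', hl', e'⟩ := exists_isDecomposition_of_mem_closure_negativePieces hn
    have h1 := neg_nuMinus_le hl
    have h2 := nuPlus_le hl'
    rw [nuOsc]
    omega

variable [IsManifold (𝓡 (2 * n + 1)) ∞ M]

theorem nuOsc_conj_le (hc : ∃ l, IsDecomposition l c) (g : UniversalCover α) :
    nuOsc (g * c * g⁻¹) ≤ nuOsc c := by
  obtain ⟨l, h, e⟩ := exists_nuPlus_eq hc
  obtain ⟨l', h', e'⟩ := exists_neg_nuMinus_eq hc
  have h1 := nuPlus_le (h.conj g)
  have h2 := neg_nuMinus_le (h'.conj g)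
  rw [List.countP_map] at h1 h2
  change _ ≤ ((l.countP (fun p => p.1) : ℕ) : ℤ) at h1
  change _ ≤ ((l'.countP (fun p => !p.1) : ℕ) : ℤ) at h2
  simp only [nuOsc]
  omega

theorem nuOsc_inv_le (hc : ∃ l, IsDecomposition l c) : nuOsc c⁻¹ ≤ nuOsc c := by
  obtain ⟨l, h, e⟩ := exists_nuPlus_eq hc
  obtain ⟨l', h', e'⟩ := exists_neg_nuMinus_eq hc
  have h1 := nuPlus_le h'.inv
  have h2 := neg_nuMinus_le h.inv
  rw [List.countP_reverse, List.countP_map] at h1 h2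
  change _ ≤ ((l'.countP (fun p => !p.1) : ℕ) : ℤ) at h1
  have h3 : ((fun p : Bool × UniversalCover α => !p.1) ∘ Prod.map not (·⁻¹)) = fun p => p.1 := by
    funext p
    simp
  rw [h3] at h2
  simp only [nuOsc]
  omega

end Decompositions

end ContactGeometry

end

theorem proposition3p1 {n : ℕ} {M : Type*} [TopologicalSpace M] [ChartedSpace (Model n) M]
    [IsManifold (𝓡 (2 * n + 1)) ∞ M] [T2Space M] [CompactSpace M] [ConnectedSpace M]
    (α : ∀ x : M, TangentSpace (𝓡 (2 * n + 1)) x →L[ℝ] ℝ) (hα : IsContactForm α) :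
    (∀ c : UniversalCover α, ∃ l, IsDecomposition l c) ∧
    IsConjInvPseudoNorm (fun c : UniversalCover α => (nuOsc c : ℝ)) ∧
    ((∀ c : UniversalCover α, nuOsc c = 0 ↔ c = 1) ↔ Orderable α) := by
  have hdec : ∀ c : UniversalCover α, ∃ l, IsDecomposition l c := fun c =>
    exists_isDecomposition_of_mem_closure (mem_closure_pieces hα c)
  refine ⟨hdec, ⟨fun g => Int.cast_nonneg nuOsc_nonneg, by rw [nuOsc_one, Int.cast_zero],
    fun g => ?_, fun f g => ?_, fun f g => ?_⟩, fun h a b hab hba => ?_,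
    fun h c => ⟨fun hc => ?_, ?_⟩⟩
  · have h1 := nuOsc_inv_le (hdec g⁻¹)
    rw [inv_inv] at h1
    exact congrArg Int.cast (le_antisymm (nuOsc_inv_le (hdec g)) h1)
  · exact_mod_cast nuOsc_mul_le (hdec f) (hdec g)
  · have h1 := nuOsc_conj_le (hdec (g * f * g⁻¹)) g⁻¹
    rw [show g⁻¹ * (g * f * g⁻¹) * g⁻¹⁻¹ = f by group] at h1
    exact congrArg Int.cast (le_antisymm (nuOsc_conj_le (hdec f) g) h1)
  · by_contra hne
    have hne' : b * a⁻¹ ≠ 1 := fun h1 => hne (mul_inv_eq_one.1 h1).symm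
    have h2 : b * a⁻¹ ∈ nonnegClasses α := hab
    have h3 : (b * a⁻¹)⁻¹ ∈ nonnegClasses α := by
      rw [mul_inv_rev, inv_inv]
      exact hba
    -- a positive contractible loop makes all non-negative classes positive
    have h4 := one_mem_positiveClasses hα h2 h3 hne'
    have h5 := mem_closure_positivePieces (mul_mem_positiveClasses h2 h4)
    have h6 := inv_mem_closure_negativePieces
      (mem_closure_positivePieces (mul_mem_positiveClasses h3 h4))
    rw [mul_one] at h5
    rw [mul_one, inv_inv] at h6
    exact hne' ((h _).1 ((nuOsc_eq_zero_iff (hdec _)).2 ⟨h5, h6⟩))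
  · obtain ⟨h1, h2⟩ := (nuOsc_eq_zero_iff (hdec c)).1 hc
    refine (h 1 c ?_ ?_).symm
    · change c * 1⁻¹ ∈ nonnegClasses α
      rw [inv_one, mul_one]
      exact closure_positivePieces_le h1
    · change 1 * c⁻¹ ∈ nonnegClasses α
      rw [one_mul]
      exact closure_positivePieces_le (inv_mem_closure_positivePieces h2)
  · rintro rfl
    exact nuOsc_one
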